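/- Let $K$ be a field and let $0\le n\le \ell$ be integers. Let $\mathscr H=\mathscr H_{\ell,n}^{(0)}$ be the cyclotomic nilHecke algebra, that is, the unital associative $K$-algebra with generators $\psi_1,\dots,\psi_{n-1},y_1,\dots,y_n$ and relations $\psi_r^2=0$; $\psi_r\psi_k=\psi_k\psi_r$ for $|r-k|>1$; $\psi_r\psi_{r+1}\psi_r=\psi_{r+1}\psi_r\psi_{r+1}$; $y_sy_t=y_ty_s$; $\psi_ry_s=y_s\psi_r$ for $s\ne r,r+1$; $\psi_ry_{r+1}=y_r\psi_r+1$; $y_{r+1}\psi_r=\psi_ry_r+1$; and $y_1^\ell=0$ (the last one if $n\geq 1$). It is $\mathbb Z$-graded by $\deg\psi_r=-2$, $\deg y_s=2$. Let $Z$ be its center, and let $*$ be the anti-automorphism of $\mathscr H$ that fixes all the generators. For a reduced expression $w=s_{i_1}\cdots s_{i_k}$ of $w\in\mathfrak S_n$ put $\psi_w=\psi_{i_1}\cdots\psi_{i_k}$, and let $w_0=s_1(s_2s_1)\cdots(s_{n-1}\cdots s_1)$ be the longest element of $\mathfrak S_n$. Put $$y^\delta=y_1^{n-1}y_2^{n-2}\cdots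 y_{n-1},\qquad \mathfrak f_{1,1}=\psi_{w_0}^{*}\,y^\delta\,\psi_{w_0}\,y^\delta .$$ Let $\mathscr P_0$ be the set of $\ell$-multipartitions $\mu=(\mu^{(1)},\dots,\mu^{(\ell)})$ of $n$ with all $\mu^{(j)}\in\{\emptyset,(1)\}$. Let $k_1<\dots<k_n$ be the positions $j$ with $\mu^{(j)}=(1)$, and put $$y_\mu=y_1^{\ell-k_1}\cdots y_n^{\ell-k_n},\qquad b_\mu=\psi_{w_0}\,y_\mu\,\psi_{w_0}\,y^\delta .$$ For $\lambda\neq\mu$ in $\mathscr P_0$, with positions $k_i(\lambda)$ and $k_i(\mu)$, write $\lambda>\mu$ if $k_i(\lambda)\le k_i(\mu)$ for all $i$. Let $\mathscr H^{>\mu}$ be the two-sided ideal generated by the $y_\lambda$ with $\lambda>\mu$. Let $S^\mu=(y_\mu\mathscr H+\mathscr H^{>\mu})/\mathscr H^{>\mu}$ be the graded Specht (cell) right module, where the class of $y_\mu\psi_w$ has degree $\sum_i(\ell-k_i)-2\ell(w)$. It carries the cellular bilinear form, which is determined by $y_\mu g h^*y_\mu\equiv\langle [y_\mu g],[y_\mu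 h]\rangle\, y_\mu \pmod{\mathscr H^{>\mu}}$ for $g,h\in\mathscr H$. Let $D_0=S^{\lambda_{\min}}/\mathrm{rad}\,\langle\ ,\ \rangle$, where $\lambda_{\min}=(\emptyset,\dots,\emptyset,(1),\dots,(1))$. Then: 1. The elements $b_\mu$, $\mu\in\mathscr P_0$, lie in $\mathfrak f_{1,1}\mathscr H\mathfrak f_{1,1}$ and form a $K$-basis of it. 2. The graded right $\mathscr H$-module $D_0$ has a graded projective cover. For every graded projective cover $P_0$ of $D_0$, the algebra $\mathrm{End}_{\mathscr H}(P_0)$ is commutative, and there is an isomorphism of $K$-algebras $Z\to\mathrm{End}_{\mathscr H}(P_0)$ under which, for every $d\in\mathbb Z$, the elements of $Z$ of degree $d$ correspond exactly to the homogeneous endomorphisms of degree $d$. 3. The center $Z$ is finite-dimensional and $\dim_KZ=\binom{\ell}{n}$. -/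

import Mathlib

open MulOpposite

universe u v

noncomputable section

namespace NilHecke

/-! ### The cyclotomic nilHecke algebra

Indices are shifted to start at `0`: `psi r` (`r : Fin (n - 1)`) and `y s` (`s : Fin n`) are the
generators usually written `ψ_{r+1}` and `y_{s+1}`. -/

/-- The generators `ψ_1, …, ψ_{n-1}, y_1, …, y_n`. -/
inductive Gen (n : ℕ) : Type
  | psi (r : Fin (n - 1)) : Gen n
  | y (s : Fin n) : Gen n

/-- The index `r`, seen in `Fin n`. -/
def lo {n : ℕ} (r : Fin (n - 1)) : Fin n := ⟨r.val, by omega⟩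

/-- The index `r + 1`, seen in `Fin n`. -/
def hi {n : ℕ} (r : Fin (n - 1)) : Fin n := ⟨r.val + 1, by omega⟩

/-- The free generator `ψ_r`. -/
def fpsi (K : Type u) [Field K] {n : ℕ} (r : Fin (n - 1)) : FreeAlgebra K (Gen n) :=
  FreeAlgebra.ι K (Gen.psi r)

/-- The free generator `y_s`. -/
def fy (K : Type u) [Field K] {n : ℕ} (s : Fin n) : FreeAlgebra K (Gen n) :=
  FreeAlgebra.ι K (Gen.y s)

/-- The defining relations of the cyclotomic nilHecke algebra. -/
inductive Rel (K : Type u) [Field K] (ℓ n : ℕ) :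
    FreeAlgebra K (Gen n) → FreeAlgebra K (Gen n) → Prop
  | psi_sq (r : Fin (n - 1)) : Rel K ℓ n (fpsi K r * fpsi K r) 0
  | psi_comm (r k : Fin (n - 1)) (h : k.val + 1 < r.val) :
      Rel K ℓ n (fpsi K r * fpsi K k) (fpsi K k * fpsi K r)
  | braid (r r' : Fin (n - 1)) (h : r'.val = r.val + 1) :
      Rel K ℓ n (fpsi K r * fpsi K r' * fpsi K r) (fpsi K r' * fpsi K r * fpsi K r')
  | y_comm (s t : Fin n) : Rel K ℓ n (fy K s * fy K t) (fy K t * fy K s)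
  | psi_y_comm (r : Fin (n - 1)) (s : Fin n) (h : s ≠ lo r) (h' : s ≠ hi r) :
      Rel K ℓ n (fpsi K r * fy K s) (fy K s * fpsi K r)
  | psi_y (r : Fin (n - 1)) : Rel K ℓ n (fpsi K r * fy K (hi r)) (fy K (lo r) * fpsi K r + 1)
  | y_psi (r : Fin (n - 1)) : Rel K ℓ n (fy K (hi r) * fpsi K r) (fpsi K r * fy K (lo r) + 1)
  | cyclotomic (s : Fin n) (h : s.val = 0) : Rel K ℓ n (fy K s ^ ℓ) 0

/-- The cyclotomic nilHecke algebra `H_{ℓ,n}` over `K`. -/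
def Alg (K : Type u) [Field K] (ℓ n : ℕ) : Type u := RingQuot (Rel K ℓ n)

instance (K : Type u) [Field K] (ℓ n : ℕ) : Ring (Alg K ℓ n) :=
  inferInstanceAs (Ring (RingQuot (Rel K ℓ n)))

instance (K : Type u) [Field K] (ℓ n : ℕ) : Algebra K (Alg K ℓ n) :=
  inferInstanceAs (Algebra K (RingQuot (Rel K ℓ n)))

/-- The image of a free generator in `H_{ℓ,n}`. -/
def gen (K : Type u) [Field K] (ℓ : ℕ) {n : ℕ} (g : Gen n) : Alg K ℓ n :=
  RingQuot.mkAlgHom K (Rel K ℓ n) (FreeAlgebra.ι K g)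

/-- The generator `ψ_r` of `H_{ℓ,n}`. -/
def psi (K : Type u) [Field K] (ℓ : ℕ) {n : ℕ} (r : Fin (n - 1)) : Alg K ℓ n :=
  gen K ℓ (Gen.psi r)

/-- The generator `y_s` of `H_{ℓ,n}`. -/
def y (K : Type u) [Field K] (ℓ : ℕ) {n : ℕ} (s : Fin n) : Alg K ℓ n :=
  gen K ℓ (Gen.y s)

/-- `deg ψ_r = -2` and `deg y_s = 2`. -/
def Gen.deg {n : ℕ} : Gen n → ℤ
  | Gen.psi _ => -2
  | Gen.y _ => 2

/-- The homogeneous component of degree `d` of `H_{ℓ,n}`: the span of the monomials in the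
generators of total degree `d`. -/
def grade (K : Type u) [Field K] (ℓ n : ℕ) (d : ℤ) : Submodule K (Alg K ℓ n) :=
  Submodule.span K
    {x | ∃ w : List (Gen n), (w.map Gen.deg).sum = d ∧ x = (w.map (gen K ℓ)).prod}

/-! ### The elements `ψ_{w₀}`, `y_λ`, `𝔣_{1,1}` and `b_μ` -/

/-- The reduced expression `s_1 (s_2 s_1) ⋯ (s_{n-1} s_{n-2} ⋯ s_1)` of the longest element `w₀` of
the symmetric group. -/
def longWord (n : ℕ) : List (Fin (n - 1)) :=
  (List.finRange (n - 1)).flatMap fun j => ((List.finRange (n - 1)).filter (· ≤ j)).reverse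

/-- `ψ_{w₀}`. -/
def psiLong (K : Type u) [Field K] (ℓ n : ℕ) : Alg K ℓ n :=
  ((longWord n).map (psi K ℓ)).prod

/-- `ψ_{w₀}^*`, where `*` is the anti-automorphism that fixes all the generators. -/
def psiLongStar (K : Type u) [Field K] (ℓ n : ℕ) : Alg K ℓ n :=
  ((longWord n).reverse.map (psi K ℓ)).prod

/-- The monomial `y_1^{a_1} ⋯ y_n^{a_n}`. -/
def yMonomial (K : Type u) [Field K] (ℓ : ℕ) {n : ℕ} (a : Fin n → ℕ) : Alg K ℓ n :=
  (List.ofFn fun i => y K ℓ i ^ a i).prod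

/-- The monomial `y_1^{n-1} y_2^{n-2} ⋯ y_{n-1}`. -/
def yStair (K : Type u) [Field K] (ℓ n : ℕ) : Alg K ℓ n :=
  yMonomial K ℓ fun i : Fin n => n - 1 - i.val

/-- The idempotent `𝔣_{1,1} = ψ_{w₀}^* (y_1^{n-1} ⋯ y_{n-1}) ψ_{w₀} (y_1^{n-1} ⋯ y_{n-1})`. -/
def f11 (K : Type u) [Field K] (ℓ n : ℕ) : Alg K ℓ n :=
  psiLongStar K ℓ n * yStair K ℓ n * psiLong K ℓ n * yStair K ℓ n

/-- The subspace `𝔣_{1,1} H_{ℓ,n} 𝔣_{1,1}` of `H_{ℓ,n}`. -/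
def corner (K : Type u) [Field K] (ℓ n : ℕ) : Submodule K (Alg K ℓ n) :=
  LinearMap.range
    (LinearMap.mulLeft K (f11 K ℓ n) ∘ₗ LinearMap.mulRight K (f11 K ℓ n))

/-- The set `P_0` of `ℓ`-multipartitions of `n` all of whose components are `∅` or `(1)`. Such a
multipartition is recorded by the set of the `n` positions `j` whose component is `(1)`. -/
def MPart (ℓ n : ℕ) : Type := {s : Finset (Fin ℓ) // s.card = n}

/-- The increasing tuple `θ(λ) = (k_1 < ⋯ < k_n)` of positions of the nonempty components of `λ`,
with values counted from `0`: `k_i` is `(theta lam i).val + 1`. -/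
def theta {ℓ n : ℕ} (lam : MPart ℓ n) : Fin n ↪o Fin ℓ := lam.1.orderEmbOfFin lam.2

/-- The exponent `ℓ - k_i`. -/
def expo {ℓ n : ℕ} (lam : MPart ℓ n) (i : Fin n) : ℕ := ℓ - ((theta lam i).val + 1)

/-- `y_λ = y_1^{ℓ-k_1} ⋯ y_n^{ℓ-k_n}`. -/
def yPart (K : Type u) [Field K] {ℓ n : ℕ} (lam : MPart ℓ n) : Alg K ℓ n :=
  yMonomial K ℓ (expo lam)

/-- `b_μ = ψ_{w₀} y_μ ψ_{w₀} y_1^{n-1} y_2^{n-2} ⋯ y_{n-1}`. -/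
def bElt (K : Type u) [Field K] {ℓ n : ℕ} (mu : MPart ℓ n) : Alg K ℓ n :=
  psiLong K ℓ n * yPart K mu * psiLong K ℓ n * yStair K ℓ n

/-! ### Specht modules and the simple module `D₀`

A right `H_{ℓ,n}`-module is a module over the opposite ring, `op h • x` being `x · h`. -/

/-- Strict dominance of multipartitions: `λ > μ` when the boxes of `λ` are weakly to the left of
those of `μ` and `λ ≠ μ`. Then `deg y_λ > deg y_μ`. -/
def Dominates {ℓ n : ℕ} (lam mu : MPart ℓ n) : Prop :=
  (∀ i, theta lam i ≤ theta mu i) ∧ lam ≠ mu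

/-- The two-sided ideal `H^{>μ}` of the cellular structure, that is, the ideal generated by the
`y_λ` with `λ > μ` (it is spanned by the `ψ_w^* y_λ ψ_u`), as a right submodule of `H_{ℓ,n}`. -/
def higher (K : Type u) [Field K] {ℓ n : ℕ} (mu : MPart ℓ n) :
    Submodule (Alg K ℓ n)ᵐᵒᵖ (Alg K ℓ n) :=
  Submodule.span (Alg K ℓ n)ᵐᵒᵖ
    {x | ∃ (lam : MPart ℓ n) (h : Alg K ℓ n), Dominates lam mu ∧ x = h * yPart K lam}

/-- The Specht (cell) module `S^μ`: the right submodule of `H / H^{>μ}` generated by the class of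
`y_μ`. Its standard basis consists of the classes of the elements `y_μ ψ_w`. -/
def Specht (K : Type u) [Field K] {ℓ n : ℕ} (mu : MPart ℓ n) :
    Submodule (Alg K ℓ n)ᵐᵒᵖ (Alg K ℓ n ⧸ higher K mu) :=
  Submodule.span (Alg K ℓ n)ᵐᵒᵖ {(higher K mu).mkQ (yPart K mu)}

/-- The radical of the cellular bilinear form of `S^μ`. The form satisfies
`⟨x, [y_μ g]⟩ • [y_μ] = x · (g^* y_μ)` for `x ∈ S^μ` and `g ∈ H`, where `[·]` is the class in
`H / H^{>μ}`; as `*` is bijective, `x` is in the radical if and only if `x · (h y_μ) = 0` for all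
`h ∈ H`. -/
def spechtRad (K : Type u) [Field K] {ℓ n : ℕ} (mu : MPart ℓ n) :
    Submodule (Alg K ℓ n)ᵐᵒᵖ (Specht K mu) where
  carrier := {x | ∀ h : Alg K ℓ n, op (h * yPart K mu) • x = 0}
  add_mem' := by
    intro a b ha hb h
    rw [smul_add, ha h, hb h, add_zero]
  zero_mem' := by
    intro h
    exact smul_zero _
  smul_mem' := by
    intro c x hx h
    have := hx (unop c * h)
    rwa [mul_assoc, op_mul, op_unop, mul_smul] at this

/-- `D^μ = S^μ / rad`. -/
abbrev DMod (K : Type u) [Field K] {ℓ n : ℕ} (mu : MPart ℓ n) : Type u :=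
  Specht K mu ⧸ spechtRad K mu

/-- The class of `y_μ` in `D^μ`. -/
def dGen (K : Type u) [Field K] {ℓ n : ℕ} (mu : MPart ℓ n) : DMod K mu :=
  (spechtRad K mu).mkQ
    ⟨(higher K mu).mkQ (yPart K mu), Submodule.subset_span (Set.mem_singleton _)⟩

/-- The homogeneous component of degree `d` of `D^μ`, for the grading in which the class of
`y_μ ψ_w` has degree `(deg y_μ) / 2 - 2 ℓ(w)`, where `(deg y_μ) / 2 = ∑ i, (ℓ - k_i)`. -/
def dGrade (K : Type u) [Field K] {ℓ n : ℕ} (mu : MPart ℓ n) (d : ℤ) :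
    Submodule K (DMod K mu) :=
  Submodule.span K
    {x | ∃ h ∈ grade K ℓ n (d - ∑ i, (expo mu i : ℤ)), x = op h • dGen K mu}

/-- The multipartition `λ_min = (∅, …, ∅, (1), …, (1))`. -/
def lamMin {ℓ n : ℕ} (hn : n ≤ ℓ) : MPart ℓ n :=
  ⟨Finset.univ.map ⟨fun i : Fin n => (⟨ℓ - n + i.val, by omega⟩ : Fin ℓ), by
      intro a b hab
      simp only [Fin.mk.injEq] at hab
      exact Fin.ext (by omega)⟩, by simp⟩

/-- The simple module `D₀ = D^{λ_min}`. -/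
abbrev D0 (K : Type u) [Field K] {ℓ n : ℕ} (hn : n ≤ ℓ) : Type u := DMod K (lamMin hn)

/-! ### Graded projective covers -/

/-- `π : P → D^μ` is a projective cover of `D^μ` in the category of `ℤ`-graded right
`H_{ℓ,n}`-modules, where `P` is graded by the subspaces `gr d`. (A graded module is projective in
the graded category if and only if it is projective.) -/
structure IsGradedProjectiveCover (K : Type u) [Field K] {ℓ n : ℕ} (mu : MPart ℓ n)
    {P : Type v} [AddCommGroup P] [Module K P] [Module (Alg K ℓ n)ᵐᵒᵖ P]
    (gr : ℤ → Submodule K P) (π : P →ₗ[(Alg K ℓ n)ᵐᵒᵖ] DMod K mu) : Prop where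
  isInternal : DirectSum.IsInternal gr
  smul_mem : ∀ (i j : ℤ) (x : P) (h : Alg K ℓ n),
    x ∈ gr i → h ∈ grade K ℓ n j → op h • x ∈ gr (i + j)
  projective : Module.Projective (Alg K ℓ n)ᵐᵒᵖ P
  map_mem : ∀ (d : ℤ) (x : P), x ∈ gr d → π x ∈ dGrade K mu d
  surjective : Function.Surjective π
  /-- The kernel is superfluous among the graded submodules `N` of `P`. -/
  superfluous : ∀ N : Submodule (Alg K ℓ n)ᵐᵒᵖ P,
    Submodule.span (Alg K ℓ n)ᵐᵒᵖ {x | x ∈ N ∧ ∃ d, x ∈ gr d} = N →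
      N ⊔ LinearMap.ker π = ⊤ → N = ⊤

/-- The endomorphism `φ` of the graded module `P` is homogeneous of degree `d`. -/
def IsHomogeneousEnd {K : Type u} [Field K] {ℓ n : ℕ}
    {P : Type v} [AddCommGroup P] [Module K P] [Module (Alg K ℓ n)ᵐᵒᵖ P]
    (gr : ℤ → Submodule K P) (d : ℤ) (φ : Module.End (Alg K ℓ n)ᵐᵒᵖ P) : Prop :=
  ∀ (i : ℤ) (x : P), x ∈ gr i → φ x ∈ gr (i + d)

end NilHecke

end

/-! Write ψ for `psiLong`, y^δ for `yStair` and e for `f11`. The whole theorem is Morita theory for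
the idempotent e.

A left factor ψ_r kills ψ, and the relations then give ψ y^δ ψ = ±ψ (`psiLong_yStair_psiLong`).
Hence e = ±ψ y^δ is idempotent, and eHe = (ψHψ) y^δ. The normal form of H shows that ψHψ is spanned
by the ψ y^a ψ. Such an element changes sign when two adjacent exponents are exchanged, vanishes
when two adjacent exponents agree, and vanishes when the first exponent is at least ℓ, because y_1^ℓ
= 0. Only strictly decreasing exponents below ℓ survive, and these are the y_μ (`tElt_eq`); thus the
b_μ span eHe. For their independence (`linearIndependent_tElt`), H acts on polynomials by divided
differences and multiplication, modulo the polynomials f such that, for every p, the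
antisymmetrization of pf involves only monomials with some exponent at least ℓ. Divided differences
are self-adjoint for the form alt(pf), so this subspace is stable, and the antisymmetrizations of
the y_μ detect the coefficients of a relation.

Every ψ y^a ψ is a palindrome, so ψHψ is fixed by the anti-involution; this makes eHe commutative
(`corner_mul_comm`). Twisted commutators with the y_s strip ψ down to 1, so HeH = H
(`exists_one_eq_sum_f11`). Consequently z ↦ ze is a bijection from the center onto eHe, and counting
the b_μ gives the dimension.

For D_0, the degree of b_μ is 0 for μ = λ_min, where b_μ = e, and positive otherwise. Modulo the
ideal H^{>λ_min} only the multiples of e remain in eHe, and the elements of eHe in this ideal are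
nilpotent for degree reasons. So eHe is local, D_0 e is a line, and eH → D_0 is a projective cover.
An arbitrary graded projective cover is generated by a homogeneous p = pe with pk = 0 only if ek = 0
(`exists_generator`), so it behaves like eH: its endomorphisms are given by eHe, that is, by the
center, and degrees are read off from the image of p. -/

noncomputable section

namespace NilHecke

/-! ### Families of elements that satisfy the nilHecke relations -/

/-- The sequences `ψ`, `y` of elements of a ring satisfy the relations of the affine nilHecke
algebra on `N + 1` strands. -/
structure IsFamily {A : Type*} [Ring A] (N : ℕ) (ψ y : ℕ → A) : Prop where
  sq : ∀ r, ψ r * ψ r = 0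
  far : ∀ r k, r + 1 < k → ψ k * ψ r = ψ r * ψ k
  braid : ∀ r, ψ r * ψ (r + 1) * ψ r = ψ (r + 1) * ψ r * ψ (r + 1)
  ycomm : ∀ s t, y s * y t = y t * y s
  psiy : ∀ r s, s ≠ r → s ≠ r + 1 → ψ r * y s = y s * ψ r
  -- For sequences extended by zero, the other relations hold at all indices; the two with a
  -- constant term fail outside the range and need the bound.
  psi_y_succ : ∀ r, r < N → ψ r * y (r + 1) = y r * ψ r + 1
  y_succ_psi : ∀ r, r < N → y (r + 1) * ψ r = ψ r * y r + 1

section Family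

variable {A : Type*} [Ring A]

/-- `ψ_{m-1} ⋯ ψ_0`. -/
def dsc (ψ : ℕ → A) : ℕ → A
  | 0 => 1
  | m + 1 => ψ m * dsc ψ m

/-- `ψ_0 ⋯ ψ_{m-1}`. -/
def asc (ψ : ℕ → A) : ℕ → A
  | 0 => 1
  | m + 1 => asc ψ m * ψ m

/-- `ψ_{w₀}` for the longest element `w₀` of the symmetric group on `m + 1` letters. -/
def longest (ψ : ℕ → A) : ℕ → A
  | 0 => 1
  | m + 1 => longest ψ m * dsc ψ (m + 1)

/-- `y_0 ⋯ y_{m-1}`. -/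
def initProd (y : ℕ → A) : ℕ → A
  | 0 => 1
  | m + 1 => initProd y m * y m

/-- `y_0^m y_1^{m-1} ⋯ y_{m-1}`. -/
def stair (y : ℕ → A) : ℕ → A
  | 0 => 1
  | m + 1 => initProd y (m + 1) * stair y m

/-- `ψ_{k+l-1} ⋯ ψ_k`. -/
def seg (ψ : ℕ → A) : ℕ → ℕ → A
  | _, 0 => 1
  | k, l + 1 => seg ψ (k + 1) l * ψ k

namespace IsFamily

variable {N : ℕ} {ψ y : ℕ → A}

/-- The relations are invariant under reversal of products, so each identity for families also
yields its mirror image. -/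
theorem op (h : IsFamily N ψ y) :
    IsFamily N (fun r => MulOpposite.op (ψ r)) (fun s => MulOpposite.op (y s)) where
  sq r := by rw [← op_mul, h.sq, op_zero]
  far r k hk := by rw [← op_mul, ← op_mul, h.far r k hk]
  braid r := by simp only [← op_mul, ← mul_assoc, h.braid]
  ycomm s t := by rw [← op_mul, ← op_mul, h.ycomm]
  psiy r s h1 h2 := by rw [← op_mul, ← op_mul, h.psiy r s h1 h2]
  psi_y_succ r hr := by rw [← op_mul, ← op_mul, h.y_succ_psi r hr, op_add, op_one]
  y_succ_psi r hr := by rw [← op_mul, ← op_mul, h.psi_y_succ r hr, op_add, op_one]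

theorem psi_dsc (h : IsFamily N ψ y) {m k : ℕ} (hk : m < k) :
    ψ k * dsc ψ m = dsc ψ m * ψ k := by
  induction m with
  | zero => simp [dsc]
  | succ m ih =>
    rw [dsc, ← mul_assoc, h.far m k hk, mul_assoc, ih (by omega), mul_assoc]

theorem psi_longest (h : IsFamily N ψ y) {m k : ℕ} (hk : m < k) :
    ψ k * longest ψ m = longest ψ m * ψ k := by
  induction m with
  | zero => simp [longest]
  | succ m ih =>
    rw [longest, ← mul_assoc, ih (by omega), mul_assoc, h.psi_dsc hk, mul_assoc]

theorem y_dsc (h : IsFamily N ψ y) {m k : ℕ} (hk : m < k) :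
    y k * dsc ψ m = dsc ψ m * y k := by
  induction m with
  | zero => simp [dsc]
  | succ m ih =>
    rw [dsc, ← mul_assoc, ← h.psiy m k (by omega) (by omega), mul_assoc, ih (by omega), mul_assoc]

theorem y_longest (h : IsFamily N ψ y) {m k : ℕ} (hk : m < k) :
    y k * longest ψ m = longest ψ m * y k := by
  induction m with
  | zero => simp [longest]
  | succ m ih =>
    rw [longest, ← mul_assoc, ih (by omega), mul_assoc, h.y_dsc hk, mul_assoc]

/-- Two reduced words of the same longest element: the top generator of the ascending run commutes
with the longest element two ranks below. This is what makes `longest` invariant under reversal. -/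
theorem asc_mul_longest (h : IsFamily N ψ y) (m : ℕ) :
    asc ψ (m + 1) * longest ψ m = longest ψ (m + 1) := by
  induction m with
  | zero => simp [asc, longest, dsc]
  | succ m ih =>
    calc asc ψ (m + 2) * longest ψ (m + 1)
        = asc ψ (m + 1) * (ψ (m + 1) * longest ψ m) * dsc ψ (m + 1) := by
          simp only [asc, longest, mul_assoc]
      _ = asc ψ (m + 1) * longest ψ m * (ψ (m + 1) * dsc ψ (m + 1)) := by
          rw [h.psi_longest (by omega)]; simp only [mul_assoc]
      _ = longest ψ (m + 2) := by rw [ih]; rfl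

theorem dsc_op (ψ : ℕ → A) (m : ℕ) :
    dsc (fun r => MulOpposite.op (ψ r)) m = MulOpposite.op (asc ψ m) := by
  induction m with
  | zero => rfl
  | succ m ih => rw [dsc, ih, asc, op_mul]

theorem longest_op (h : IsFamily N ψ y) (m : ℕ) :
    longest (fun r => MulOpposite.op (ψ r)) m = MulOpposite.op (longest ψ m) := by
  induction m with
  | zero => rfl
  | succ m ih => rw [longest, ih, dsc_op, ← op_mul, h.asc_mul_longest]

theorem dsc_mul_psi (h : IsFamily N ψ y) {m j : ℕ} (hj : j < m) :
    dsc ψ (m + 1) * ψ (j + 1) = ψ j * dsc ψ (m + 1) := by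
  induction m with
  | zero => omega
  | succ m ih =>
    rcases Nat.lt_or_ge j m with hjm | hjm
    · rw [dsc, mul_assoc, ih hjm, ← mul_assoc, h.far j (m + 1) (by omega), mul_assoc]
    · obtain rfl : j = m := by omega
      rw [dsc, dsc, mul_assoc, mul_assoc, ← h.psi_dsc (show j < j + 1 by omega), ← mul_assoc,
        ← mul_assoc, ← h.braid]
      simp only [mul_assoc]

/-- Passing through the last descending run lowers the index of ψ_j by one, which reduces to a
smaller rank; for j = 0 the run already ends in ψ_0 and ψ_0² = 0. -/
theorem longest_mul_psi (h : IsFamily N ψ y) {m j : ℕ} (hj : j < m) :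
    longest ψ m * ψ j = 0 := by
  induction m generalizing j with
  | zero => omega
  | succ m ih =>
    rcases j with _ | j
    · have : dsc ψ (m + 1) * ψ 0 = 0 := by
        clear ih hj
        induction m with
        | zero => simp [dsc, h.sq]
        | succ m ih => rw [dsc, mul_assoc, ih, mul_zero]
      rw [longest, mul_assoc, this, mul_zero]
    · rw [longest, mul_assoc, h.dsc_mul_psi (by omega), ← mul_assoc, ih (by omega), zero_mul]

theorem psi_mul_longest (h : IsFamily N ψ y) {m j : ℕ} (hj : j < m) :
    ψ j * longest ψ m = 0 := by
  have := h.op.longest_mul_psi hj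
  rwa [h.longest_op, ← op_mul, op_eq_zero_iff] at this

theorem psi_mul_pair (h : IsFamily N ψ y) {r : ℕ} (hr : r < N) :
    ψ r * (y r * y (r + 1)) = y r * y (r + 1) * ψ r := by
  have h1 : ψ r * y r = y (r + 1) * ψ r - 1 := by rw [h.y_succ_psi r hr]; abel
  rw [← mul_assoc, h1, sub_mul, mul_assoc, h.psi_y_succ r hr, mul_add, ← mul_assoc, h.ycomm r]
  simp

theorem psi_mul_initProd_of_le (h : IsFamily N ψ y) {r m : ℕ} (hm : m ≤ r) :
    ψ r * initProd y m = initProd y m * ψ r := by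
  induction m with
  | zero => simp [initProd]
  | succ m ih =>
    rw [initProd, ← mul_assoc, ih (by omega), mul_assoc, h.psiy r m (by omega) (by omega),
      mul_assoc]

theorem psi_mul_initProd (h : IsFamily N ψ y) {r m : ℕ} (hr : r < N) (hm : r + 1 < m) :
    ψ r * initProd y m = initProd y m * ψ r := by
  induction m with
  | zero => omega
  | succ m ih =>
    rcases Nat.lt_or_ge (r + 1) m with h1 | h1
    · rw [initProd, ← mul_assoc, ih h1, mul_assoc, h.psiy r m (by omega) (by omega), mul_assoc]
    · obtain rfl : m = r + 1 := by omega
      rw [initProd, initProd, mul_assoc, ← mul_assoc, h.psi_mul_initProd_of_le le_rfl, mul_assoc,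
        h.psi_mul_pair hr]
      simp only [mul_assoc]

theorem longest_mul_initProd (h : IsFamily N ψ y) {m : ℕ} (hm : m ≤ N) :
    longest ψ m * initProd y (m + 1) = initProd y (m + 1) * longest ψ m := by
  have key : ∀ j ≤ m, dsc ψ j * initProd y (m + 1) = initProd y (m + 1) * dsc ψ j := by
    intro j hj
    induction j with
    | zero => simp [dsc]
    | succ j ih =>
      rw [dsc, mul_assoc, ih (by omega), ← mul_assoc, h.psi_mul_initProd (by omega) (by omega),
        mul_assoc]
  have : ∀ j ≤ m, longest ψ j * initProd y (m + 1) = initProd y (m + 1) * longest ψ j := by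
    intro j hj
    induction j with
    | zero => simp [longest]
    | succ j ih =>
      rw [longest, mul_assoc, key _ hj, ← mul_assoc, ih (by omega), mul_assoc]
  exact this m le_rfl

/-- The sign of the longest element of the symmetric group on `m + 1` letters. -/
def _root_.NilHecke.longSign : ℕ → ℤˣ
  | 0 => 1
  | m + 1 => (-1) ^ (m + 1) * longSign m

/-- Each ψ_m y_m equals y_{m+1} ψ_m - 1, and ψ_m kills z, so every strand contributes a factor -1.
-/
theorem asc_initProd_smul (h : IsFamily N ψ y) {V : Type*} [AddCommGroup V] [Module A V] {m : ℕ}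
    (hm : m ≤ N) (z : V) (hz : ∀ r < m, ψ r • z = 0) :
    (asc ψ m * initProd y m) • z = ((-1) ^ m : ℤˣ) • z := by
  induction m with
  | zero => simp [asc, initProd]
  | succ m ih =>
    have h1 : ψ m * y m = y (m + 1) * ψ m - 1 := by rw [h.y_succ_psi m (by omega)]; abel
    have h2 : asc ψ (m + 1) * initProd y (m + 1)
        = asc ψ m * initProd y m * (y (m + 1) * ψ m) - asc ψ m * initProd y m := by
      rw [asc, initProd, mul_assoc, ← mul_assoc (ψ m), h.psi_mul_initProd_of_le le_rfl,
        mul_assoc _ (ψ m), h1]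
      noncomm_ring
    rw [h2, sub_smul, ← mul_assoc, mul_smul _ (ψ m), hz m (by omega), smul_zero, zero_sub,
      ih (by omega) (fun r hr => hz r (by omega)), pow_succ, mul_neg_one, Units.neg_smul]

/-- Peel off one ascending run and one factor y_0 ⋯ y_m; the latter is symmetric in the strands that
the smaller longest element involves, hence commutes with it. A general module V serves two uses: z
= 1 in the polynomial ring and z = ψ_{w₀} in the regular module. -/
theorem longest_stair_smul (h : IsFamily N ψ y) {V : Type*} [AddCommGroup V] [Module A V] {m : ℕ}
    (hm : m ≤ N) (z : V) (hz : ∀ r < m, ψ r • z = 0) :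
    (longest ψ m * stair y m) • z = longSign m • z := by
  induction m with
  | zero => simp [longest, stair, longSign]
  | succ m ih =>
    rw [← h.asc_mul_longest, stair, mul_assoc, ← mul_assoc (longest ψ m),
      h.longest_mul_initProd (by omega), mul_assoc, ← mul_assoc, mul_smul,
      ih (by omega) (fun r hr => hz r (by omega)), smul_comm, h.asc_initProd_smul hm z hz, longSign,
      mul_comm, mul_smul]

theorem seg_comm (h : IsFamily N ψ y) {k l j : ℕ} (hj : j + 1 < k) :
    ψ j * seg ψ k l = seg ψ k l * ψ j := by
  induction l generalizing k with
  | zero => simp [seg]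
  | succ l ih =>
    rw [seg, ← mul_assoc, ih (by omega), mul_assoc, mul_assoc, h.far j k hj]

/-- The difference between multiplying by y_{m+1} on the left and by y_k on the right deletes the
last letter ψ_k of the run. A ψ_k left behind by the recursion commutes with the remaining run and
is killed by `longest ψ m`. -/
theorem longest_seg_y (h : IsFamily N ψ y) {m k l : ℕ} (hm : m < N) (hkl : k + l = m) :
    longest ψ m * seg ψ k (l + 1) * y k =
      y (m + 1) * (longest ψ m * seg ψ k (l + 1)) - longest ψ m * seg ψ (k + 1) l := by
  induction l generalizing k with
  | zero =>
    obtain rfl : k = m := by omega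
    have h1 : ψ k * y k = y (k + 1) * ψ k - 1 := by rw [h.y_succ_psi k hm]; abel
    simp only [seg, one_mul, mul_one]
    rw [mul_assoc, h1, mul_sub, mul_one, ← mul_assoc, ← h.y_longest (by omega), mul_assoc]
  | succ l ih =>
    have h1 : ψ k * y k = y (k + 1) * ψ k - 1 := by rw [h.y_succ_psi k (by omega)]; abel
    have h2 := ih (show k + 1 + l = m by omega)
    have h3 : longest ψ m * seg ψ (k + 1 + 1) l * ψ k = 0 := by
      rw [mul_assoc, ← h.seg_comm (by omega), ← mul_assoc, h.longest_mul_psi (by omega), zero_mul]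
    rw [seg, mul_assoc, mul_assoc, h1, mul_sub, mul_sub, mul_one, ← mul_assoc (seg ψ _ _),
      ← mul_assoc (longest ψ m), ← mul_assoc (longest ψ m), h2, sub_mul, h3]
    simp only [sub_zero, mul_assoc]

theorem dsc_eq_seg (ψ : ℕ → A) (m : ℕ) : dsc ψ m = seg ψ 0 m := by
  have : ∀ l k, seg ψ k (l + 1) = ψ (k + l) * seg ψ k l := by
    intro l
    induction l with
    | zero => intro k; simp [seg]
    | succ l ih =>
      intro k
      rw [seg, ih, seg, mul_assoc, show k + 1 + l = k + (l + 1) by omega]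
  induction m with
  | zero => rfl
  | succ m ih => rw [dsc, this, ih, zero_add]

/-- A two-sided ideal that contains `ψ_{w₀}` is everything. -/
theorem one_mem_of_longest_mem (h : IsFamily N ψ y) (I : AddSubgroup A)
    (hl : ∀ a x, x ∈ I → a * x ∈ I) (hr : ∀ a x, x ∈ I → x * a ∈ I)
    {m : ℕ} (hm : m ≤ N) (hI : longest ψ m ∈ I) : (1 : A) ∈ I := by
  induction m with
  | zero => exact hI
  | succ m ih =>
    apply ih (by omega)
    -- The last descending run is stripped letter by letter from its right end, by the twisted
    -- commutators of `longest_seg_y`, without leaving the ideal.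
    have : ∀ k ≤ m + 1, longest ψ m * seg ψ k (m + 1 - k) ∈ I := by
      intro k hk
      induction k with
      | zero => rwa [Nat.sub_zero, ← dsc_eq_seg]
      | succ k ihk =>
        have h1 := ihk (by omega)
        rw [show m + 1 - k = (m - k) + 1 by omega] at h1
        have h2 := h.longest_seg_y (show m < N by omega) (show k + (m - k) = m by omega)
        rw [show m + 1 - (k + 1) = m - k by omega]
        have h3 : longest ψ m * seg ψ (k + 1) (m - k) = y (m + 1) * (longest ψ m * seg ψ k (m - k + 1))
            - longest ψ m * seg ψ k (m - k + 1) * y k := by rw [h2]; abel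
        rw [h3]
        exact I.sub_mem (hl _ _ h1) (hr _ _ h1)
    simpa [seg] using this (m + 1) le_rfl

/-- If `f` commutes with `ψ_r` then `ψ_{w₀} f ψ_{w₀} = 0`. -/
theorem longest_mul_mul_longest (h : IsFamily N ψ y) {r : ℕ} (hr : r < N) {f : A}
    (hf : ψ r * f = f * ψ r) : longest ψ N * f * longest ψ N = 0 := by
  -- This expression for 1 is inserted to the left of f; in each of the two terms ψ_r can reach one
  -- of the outer factors, which it kills.
  have h1 : (1 : A) = ψ r * y (r + 1) - y r * ψ r := by rw [h.psi_y_succ r hr]; abel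
  calc longest ψ N * f * longest ψ N = longest ψ N * 1 * f * longest ψ N := by rw [mul_one]
    _ = longest ψ N * ψ r * y (r + 1) * f * longest ψ N
        - longest ψ N * y r * (ψ r * f) * longest ψ N := by rw [h1]; noncomm_ring
    _ = 0 := by
      rw [h.longest_mul_psi hr, hf, ← mul_assoc, mul_assoc _ (ψ r), h.psi_mul_longest hr]; simp

/-- Polynomials symmetric in `y_r`, `y_{r+1}` commute with `ψ_r`. -/
theorem psi_mul_symm (h : IsFamily N ψ y) {r : ℕ} (hr : r < N) (a b : ℕ) :
    ψ r * (y r ^ a * y (r + 1) ^ b + y r ^ b * y (r + 1) ^ a) =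
      (y r ^ a * y (r + 1) ^ b + y r ^ b * y (r + 1) ^ a) * ψ r := by
  have hc : Commute (y r) (y (r + 1)) := h.ycomm _ _
  have h1 : ψ r * y r = y (r + 1) * ψ r - 1 := by rw [h.y_succ_psi r hr]; abel
  have hs : Commute (ψ r) (y r + y (r + 1)) := by
    rw [commute_iff_eq, mul_add, add_mul, h1, h.psi_y_succ r hr]; abel
  have hp : Commute (ψ r) (y r * y (r + 1)) := h.psi_mul_pair hr
  have hpow : ∀ k, Commute (ψ r) (y r ^ k + y (r + 1) ^ k) := by
    intro k
    induction k using Nat.twoStepInduction with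
    | zero => simp
    | one => simpa using hs
    | more k h1 h2 =>
      -- Newton's recursion for power sums in two variables.
      have : y r ^ (k + 2) + y (r + 1) ^ (k + 2) = (y r + y (r + 1)) *
          (y r ^ (k + 1) + y (r + 1) ^ (k + 1)) - y r * y (r + 1) * (y r ^ k + y (r + 1) ^ k) := by
        have e1 : y (r + 1) * y r ^ (k + 1) = y r * y (r + 1) * y r ^ k := by
          rw [hc.eq, mul_assoc, ← pow_succ']
        have e2 : y r * y (r + 1) * y (r + 1) ^ k = y r * y (r + 1) ^ (k + 1) := by
          rw [mul_assoc, ← pow_succ']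
        rw [mul_add (y r * y (r + 1)), ← e1, e2, pow_succ' (y r) (k + 1),
          pow_succ' (y (r + 1)) (k + 1)]
        noncomm_ring
      rw [this]
      exact (hs.mul_right h2).sub_right (hp.mul_right h1)
  have main : ∀ a k, Commute (ψ r)
      (y r ^ a * y (r + 1) ^ (a + k) + y r ^ (a + k) * y (r + 1) ^ a) := by
    intro a k
    have : y r ^ a * y (r + 1) ^ (a + k) + y r ^ (a + k) * y (r + 1) ^ a
        = (y r * y (r + 1)) ^ a * (y r ^ k + y (r + 1) ^ k) := by
      rw [hc.mul_pow, mul_add, mul_assoc, mul_assoc, ← pow_add, ← (hc.pow_pow k a).eq, ← mul_assoc,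
        ← pow_add, add_comm]
    rw [this]
    exact (hp.pow_right a).mul_right (hpow k)
  rcases Nat.le_total a b with hab | hab
  · obtain ⟨k, rfl⟩ := Nat.exists_eq_add_of_le hab
    exact main a k
  · obtain ⟨k, rfl⟩ := Nat.exists_eq_add_of_le hab
    have := main b k
    rwa [add_comm] at this

/-- Not a consequence of `psi_mul_symm` with a = b, which gives only twice this identity and is
empty in characteristic 2. -/
theorem psi_mul_pow_pow (h : IsFamily N ψ y) {r : ℕ} (hr : r < N) (a : ℕ) :
    ψ r * (y r ^ a * y (r + 1) ^ a) = y r ^ a * y (r + 1) ^ a * ψ r := by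
  have hc : Commute (y r) (y (r + 1)) := h.ycomm _ _
  have hp : Commute (ψ r) (y r * y (r + 1)) := h.psi_mul_pair hr
  rw [← hc.mul_pow]
  exact hp.pow_right a

end IsFamily

end Family

/-! ### Relations, anti-involution and normal forms -/

section Alg

variable (K : Type u) [Field K] (ℓ n : ℕ)

/-- The universal property of the cyclotomic nilHecke algebra. -/
def liftAlg {B : Type*} [Ring B] [Algebra K B] (g : Gen n → B)
    (hg : ∀ ⦃a b⦄, Rel K ℓ n a b → FreeAlgebra.lift K g a = FreeAlgebra.lift K g b) :
    Alg K ℓ n →ₐ[K] B :=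
  RingQuot.liftAlgHom K ⟨FreeAlgebra.lift K g, hg⟩

variable {K ℓ n}

theorem liftAlg_gen {B : Type*} [Ring B] [Algebra K B] (g : Gen n → B)
    (hg : ∀ ⦃a b⦄, Rel K ℓ n a b → FreeAlgebra.lift K g a = FreeAlgebra.lift K g b) (x : Gen n) :
    liftAlg K ℓ n g hg (gen K ℓ x) = g x := by
  have := RingQuot.liftAlgHom_mkAlgHom_apply (S := K) (FreeAlgebra.lift K g) hg
    (FreeAlgebra.ι K x)
  rw [FreeAlgebra.lift_ι_apply] at this
  exact this

variable (K ℓ n) in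
/-- The projection from the free algebra. -/
def mkAlg : FreeAlgebra K (Gen n) →ₐ[K] Alg K ℓ n := RingQuot.mkAlgHom K (Rel K ℓ n)

theorem mk_rel {a b : FreeAlgebra K (Gen n)} (h : Rel K ℓ n a b) :
    mkAlg K ℓ n a = mkAlg K ℓ n b :=
  RingQuot.mkAlgHom_rel K h

theorem mk_fpsi (r : Fin (n - 1)) : mkAlg K ℓ n (fpsi K r) = psi K ℓ r := rfl

theorem mk_fy (s : Fin n) : mkAlg K ℓ n (fy K s) = y K ℓ s := rfl

theorem psi_mul_self (r : Fin (n - 1)) : psi K ℓ r * psi K ℓ r = 0 := by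
  simpa only [map_mul, map_zero, mk_fpsi] using mk_rel (Rel.psi_sq (K := K) (ℓ := ℓ) r)

theorem psi_comm_of_lt (r k : Fin (n - 1)) (h : k.val + 1 < r.val) :
    psi K ℓ r * psi K ℓ k = psi K ℓ k * psi K ℓ r := by
  simpa only [map_mul, mk_fpsi] using mk_rel (Rel.psi_comm (K := K) (ℓ := ℓ) r k h)

theorem psi_braid (r r' : Fin (n - 1)) (h : r'.val = r.val + 1) :
    psi K ℓ r * psi K ℓ r' * psi K ℓ r = psi K ℓ r' * psi K ℓ r * psi K ℓ r' := by
  simpa only [map_mul, mk_fpsi] using mk_rel (Rel.braid (K := K) (ℓ := ℓ) r r' h)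

theorem y_mul_comm (s t : Fin n) : y K ℓ s * y K ℓ t = y K ℓ t * y K ℓ s := by
  simpa only [map_mul, mk_fy] using mk_rel (Rel.y_comm (K := K) (ℓ := ℓ) s t)

theorem psi_mul_y_of_ne (r : Fin (n - 1)) (s : Fin n) (h : s ≠ lo r) (h' : s ≠ hi r) :
    psi K ℓ r * y K ℓ s = y K ℓ s * psi K ℓ r := by
  simpa only [map_mul, mk_fy, mk_fpsi] using mk_rel (Rel.psi_y_comm (K := K) (ℓ := ℓ) r s h h')

theorem psi_mul_y_hi (r : Fin (n - 1)) :
    psi K ℓ r * y K ℓ (hi r) = y K ℓ (lo r) * psi K ℓ r + 1 := by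
  simpa only [map_mul, map_add, map_one, mk_fy, mk_fpsi] using
    mk_rel (Rel.psi_y (K := K) (ℓ := ℓ) r)

theorem y_hi_mul_psi (r : Fin (n - 1)) :
    y K ℓ (hi r) * psi K ℓ r = psi K ℓ r * y K ℓ (lo r) + 1 := by
  simpa only [map_mul, map_add, map_one, mk_fy, mk_fpsi] using
    mk_rel (Rel.y_psi (K := K) (ℓ := ℓ) r)

theorem y_pow_eq_zero (s : Fin n) (h : s.val = 0) : y K ℓ s ^ ℓ = 0 := by
  simpa only [map_pow, map_zero, mk_fy] using mk_rel (Rel.cyclotomic (K := K) (ℓ := ℓ) s h)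

/-- To define a homomorphism out of the cyclotomic nilHecke algebra it suffices to check the
relations. -/
theorem lift_rel {B : Type*} [Ring B] [Algebra K B] (g : Gen n → B)
    (h1 : ∀ r, g (.psi r) * g (.psi r) = 0)
    (h2 : ∀ r k : Fin (n - 1), k.val + 1 < r.val →
      g (.psi r) * g (.psi k) = g (.psi k) * g (.psi r))
    (h3 : ∀ r r' : Fin (n - 1), r'.val = r.val + 1 →
      g (.psi r) * g (.psi r') * g (.psi r) = g (.psi r') * g (.psi r) * g (.psi r'))
    (h4 : ∀ s t, g (.y s) * g (.y t) = g (.y t) * g (.y s))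
    (h5 : ∀ r s, s ≠ lo r → s ≠ hi r → g (.psi r) * g (.y s) = g (.y s) * g (.psi r))
    (h6 : ∀ r, g (.psi r) * g (.y (hi r)) = g (.y (lo r)) * g (.psi r) + 1)
    (h7 : ∀ r, g (.y (hi r)) * g (.psi r) = g (.psi r) * g (.y (lo r)) + 1)
    (h8 : ∀ s : Fin n, s.val = 0 → g (.y s) ^ ℓ = 0) ⦃a b⦄ (h : Rel K ℓ n a b) :
    FreeAlgebra.lift K g a = FreeAlgebra.lift K g b := by
  cases h <;> simp only [map_mul, map_add, map_one, map_zero, map_pow, fpsi, fy,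
    FreeAlgebra.lift_ι_apply]
  · exact h1 _
  · exact h2 _ _ ‹_›
  · exact h3 _ _ ‹_›
  · exact h4 _ _
  · exact h5 _ _ ‹_› ‹_›
  · exact h6 _
  · exact h7 _
  · exact h8 _ ‹_›

/-- The words in the generators span the algebra. -/
theorem span_words : Submodule.span K
    {x : Alg K ℓ n | ∃ w : List (Gen n), x = (w.map (gen K ℓ)).prod} = ⊤ := by
  rw [eq_top_iff]
  rintro x -
  obtain ⟨f, rfl⟩ : ∃ f, mkAlg K ℓ n f = x := RingQuot.mkAlgHom_surjective K (Rel K ℓ n) x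
  induction f using FreeAlgebra.induction with
  | grade0 r =>
    rw [AlgHom.commutes, Algebra.algebraMap_eq_smul_one]
    exact Submodule.smul_mem _ _ (Submodule.subset_span ⟨[], rfl⟩)
  | grade1 g => exact Submodule.subset_span ⟨[g], by rw [List.map_singleton, List.prod_singleton]; rfl⟩
  | mul a b ha hb =>
    rw [map_mul]
    have := Submodule.mul_mem_mul ha hb
    rw [Submodule.span_mul_span] at this
    refine Submodule.span_mono ?_ this
    rintro _ ⟨_, ⟨w, rfl⟩, _, ⟨w', rfl⟩, rfl⟩
    exact ⟨w ++ w', by simp⟩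
  | add a b ha hb => rw [map_add]; exact Submodule.add_mem _ ha hb

/-- A subspace that contains `1` and is stable under left multiplication by the generators is
everything. -/
theorem eq_top_of_gen_mul (S : Submodule K (Alg K ℓ n)) (h1 : 1 ∈ S)
    (hS : ∀ g, ∀ x ∈ S, gen K ℓ g * x ∈ S) : S = ⊤ := by
  rw [eq_top_iff, ← span_words, Submodule.span_le]
  rintro _ ⟨w, rfl⟩
  induction w with
  | nil => exact h1
  | cons g w ih => rw [List.map_cons, List.prod_cons]; exact hS _ _ ih

/-- The anti-automorphism that fixes all the generators, as a homomorphism to the opposite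
algebra. -/
def starHom : Alg K ℓ n →ₐ[K] (Alg K ℓ n)ᵐᵒᵖ :=
  liftAlg K ℓ n (fun g => op (gen K ℓ g)) <| by
    apply lift_rel
    · intro r; rw [← op_mul, ← op_zero]; exact congrArg op (psi_mul_self r)
    · intro r k h; rw [← op_mul, ← op_mul]; exact congrArg op (psi_comm_of_lt r k h).symm
    · intro r r' h
      simp only [← op_mul, ← mul_assoc]; exact congrArg op (psi_braid r r' h)
    · intro s t; rw [← op_mul, ← op_mul]; exact congrArg op (y_mul_comm t s)
    · intro r s h h'; rw [← op_mul, ← op_mul]; exact congrArg op (psi_mul_y_of_ne r s h h').symm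
    · intro r; rw [← op_mul, ← op_mul, ← op_one, ← op_add]; exact congrArg op (y_hi_mul_psi r)
    · intro r; rw [← op_mul, ← op_mul, ← op_one, ← op_add]; exact congrArg op (psi_mul_y_hi r)
    · intro s h; rw [← op_pow, ← op_zero]; exact congrArg op (y_pow_eq_zero s h)

/-- The anti-automorphism that fixes all the generators. -/
def star (x : Alg K ℓ n) : Alg K ℓ n := unop (starHom x)

theorem star_mul (a b : Alg K ℓ n) : star (a * b) = star b * star a := by
  rw [star, map_mul, unop_mul]; rfl

theorem star_add (a b : Alg K ℓ n) : star (a + b) = star a + star b := by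
  rw [star, map_add, unop_add]; rfl

theorem star_zero : star (0 : Alg K ℓ n) = 0 := by rw [star, map_zero, unop_zero]

theorem star_smul (c : K) (a : Alg K ℓ n) : star (c • a) = c • star a := by
  rw [star, map_smul, unop_smul]; rfl

theorem star_gen (g : Gen n) : star (gen K ℓ g) = gen K ℓ g := by
  rw [star, starHom, liftAlg_gen, unop_op]

theorem star_list_prod (l : List (Alg K ℓ n)) :
    star l.prod = (l.map star).reverse.prod := by
  induction l with
  | nil => simp [star]
  | cons a l ih => simp [star_mul, ih]

theorem star_star (x : Alg K ℓ n) : star (star x) = x := by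
  have : x ∈ (⊤ : Submodule K (Alg K ℓ n)) := trivial
  rw [← span_words] at this
  induction this using Submodule.span_induction with
  | mem x h =>
    obtain ⟨w, rfl⟩ := h
    rw [star_list_prod, star_list_prod]
    simp [Function.comp_def, star_gen]
  | zero => rw [star_zero, star_zero]
  | add a b _ _ ha hb => rw [star_add, star_add, ha, hb]
  | smul c a _ ha => rw [star_smul, star_smul, ha]

/-! ### The nilHecke family of the cyclotomic nilHecke algebra -/

/-- Extension of a family indexed by `Fin m` by zero. -/
def ext0 {A : Type*} [Zero A] {m : ℕ} (f : Fin m → A) (i : ℕ) : A :=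
  if h : i < m then f ⟨i, h⟩ else 0

theorem ext0_of_lt {A : Type*} [Zero A] {m : ℕ} (f : Fin m → A) {i : ℕ} (h : i < m) :
    ext0 f i = f ⟨i, h⟩ := dif_pos h

theorem ext0_val {A : Type*} [Zero A] {m : ℕ} (f : Fin m → A) (i : Fin m) :
    ext0 f i = f i := dif_pos i.2

theorem ext0_of_le {A : Type*} [Zero A] {m : ℕ} (f : Fin m → A) {i : ℕ} (h : m ≤ i) :
    ext0 f i = 0 := dif_neg (by omega)

/-- Elements indexed by `Fin (n - 1)` and `Fin n` with the nilHecke relations form a nilHecke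
family. -/
theorem isFamily_ext0 {B : Type*} [Ring B] (p : Fin (n - 1) → B) (q : Fin n → B)
    (h1 : ∀ r, p r * p r = 0)
    (h2 : ∀ r k : Fin (n - 1), k.val + 1 < r.val → p r * p k = p k * p r)
    (h3 : ∀ r r' : Fin (n - 1), r'.val = r.val + 1 → p r * p r' * p r = p r' * p r * p r')
    (h4 : ∀ s t, q s * q t = q t * q s)
    (h5 : ∀ r s, s ≠ lo r → s ≠ hi r → p r * q s = q s * p r)
    (h6 : ∀ r, p r * q (hi r) = q (lo r) * p r + 1)
    (h7 : ∀ r, q (hi r) * p r = p r * q (lo r) + 1) :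
    IsFamily (n - 1) (ext0 p) (ext0 q) where
  sq r := by
    by_cases hr : r < n - 1
    · rw [ext0_of_lt _ hr, h1]
    · rw [ext0_of_le _ (by omega), zero_mul]
  far r k hk := by
    by_cases hr : k < n - 1
    · rw [ext0_of_lt _ hr, ext0_of_lt _ (show r < n - 1 by omega), h2 _ _ hk]
    · rw [ext0_of_le p (show n - 1 ≤ k by omega), zero_mul, mul_zero]
  braid r := by
    by_cases hr : r + 1 < n - 1
    · rw [ext0_of_lt _ hr, ext0_of_lt _ (show r < n - 1 by omega), h3 _ _ rfl]
    · rw [ext0_of_le p (show n - 1 ≤ r + 1 by omega)]; simp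
  ycomm s t := by
    by_cases hs : s < n
    · by_cases ht : t < n
      · rw [ext0_of_lt _ hs, ext0_of_lt _ ht, h4]
      · rw [ext0_of_le q (show n ≤ t by omega), zero_mul, mul_zero]
    · rw [ext0_of_le q (show n ≤ s by omega), zero_mul, mul_zero]
  psiy r s hs hs' := by
    by_cases hr : r < n - 1
    · by_cases ht : s < n
      · rw [ext0_of_lt _ hr, ext0_of_lt _ ht]
        exact h5 _ _ (by simpa [lo] using hs) (by simpa [hi] using hs')
      · rw [ext0_of_le q (show n ≤ s by omega), zero_mul, mul_zero]
    · rw [ext0_of_le p (show n - 1 ≤ r by omega), zero_mul, mul_zero]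
  psi_y_succ r hr := by
    rw [ext0_of_lt _ hr, ext0_of_lt q (show r < n by omega),
      ext0_of_lt q (show r + 1 < n by omega)]
    exact h6 ⟨r, hr⟩
  y_succ_psi r hr := by
    rw [ext0_of_lt _ hr, ext0_of_lt q (show r < n by omega),
      ext0_of_lt q (show r + 1 < n by omega)]
    exact h7 ⟨r, hr⟩

theorem isFamily : IsFamily (n - 1) (ext0 (psi K ℓ (n := n))) (ext0 (y K ℓ)) :=
  isFamily_ext0 _ _ psi_mul_self psi_comm_of_lt psi_braid y_mul_comm psi_mul_y_of_ne psi_mul_y_hi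
    y_hi_mul_psi

theorem longWord_map_val (n : ℕ) : (longWord n).map Fin.val =
    (List.range (n - 1)).flatMap fun j => (List.range (j + 1)).reverse := by
  rw [longWord, List.map_flatMap, ← List.map_coe_finRange_eq_range, List.flatMap_map]
  congr 1
  funext j
  rw [List.map_reverse]
  congr 1
  have : ∀ (m : ℕ) (j : Fin m), ((List.finRange m).filter (· ≤ j)).map Fin.val
      = (List.range m).filter (· ≤ j.val) := by
    intro m j
    rw [← List.map_coe_finRange_eq_range, List.filter_map]
    congr 1
  rw [this]
  have h2 : List.range (n - 1) = List.range (j.val + 1) ++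
      (List.range (n - 1 - (j.val + 1))).map (j.val + 1 + ·) := by
    rw [← List.range_add]; congr 1; omega
  rw [h2, List.filter_append]
  rw [List.filter_eq_self.2, List.filter_eq_nil_iff.2, List.append_nil]
  · intro a ha; simp at ha; simp; omega
  · intro a ha; simp at ha; simp; omega

/-- The product over `longWord n` is the longest element of a family. -/
theorem prod_longWord {B : Type*} [Ring B] (p : Fin (n - 1) → B) :
    ((longWord n).map p).prod = longest (ext0 p) (n - 1) := by
  have h1 : (longWord n).map p = ((longWord n).map Fin.val).map (ext0 p) := by
    rw [List.map_map]; congr 1; funext i; exact (ext0_val p i).symm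
  rw [h1, longWord_map_val]
  generalize ext0 p = q
  generalize n - 1 = m
  have hd : ∀ j, ((List.range j).reverse.map q).prod = dsc q j := by
    intro j
    induction j with
    | zero => rfl
    | succ j ih => simp [List.range_succ, dsc, ← ih]
  induction m with
  | zero => rfl
  | succ m ih =>
    rw [List.range_succ, List.flatMap_append, List.map_append, List.prod_append, ih, longest]
    congr 1
    rw [← hd]; simp

theorem psiLong_eq : psiLong K ℓ n = longest (ext0 (psi K ℓ (n := n))) (n - 1) := prod_longWord _

theorem star_psiLong : star (psiLong K ℓ n) = psiLong K ℓ n := by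
  have h := (isFamily (K := K) (ℓ := ℓ) (n := n)).longest_op (n - 1)
  rw [← psiLong_eq] at h
  have : (fun r => op (ext0 (psi K ℓ (n := n)) r)) = ext0 fun r => op (psi K ℓ r) := by
    funext r
    by_cases hr : r < n - 1
    · rw [ext0_of_lt _ hr, ext0_of_lt _ hr]
    · rw [ext0_of_le _ (by omega), ext0_of_le _ (by omega), op_zero]
  rw [this, ← prod_longWord] at h
  rw [star, psiLong, map_list_prod, List.map_map]
  have h2 : (⇑(starHom (K := K) (ℓ := ℓ) (n := n)) ∘ psi K ℓ) = fun r => op (psi K ℓ r) := by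
    funext r; exact liftAlg_gen _ _ _
  rw [h2, h, unop_op]; rfl

theorem psiLongStar_eq : psiLongStar K ℓ n = psiLong K ℓ n := by
  rw [← star_psiLong, psiLong, star_list_prod, psiLongStar, List.map_map, List.map_reverse]
  congr 3
  funext r
  exact (star_gen _).symm

theorem psi_mul_psiLong (r : Fin (n - 1)) : psi K ℓ r * psiLong K ℓ n = 0 := by
  rw [psiLong_eq, ← ext0_val (psi K ℓ (n := n)) r]
  exact isFamily.psi_mul_longest r.2

/-! ### The commutative subalgebra generated by the `y_s` -/

variable (K ℓ n) in
/-- The subalgebra generated by the `y_s`. -/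
abbrev YAlg : Subalgebra K (Alg K ℓ n) := Algebra.adjoin K (Set.range (y K ℓ))

instance : IsMulCommutative (YAlg K ℓ n) :=
  Algebra.isMulCommutative_adjoin K (by rintro _ ⟨s, rfl⟩ _ ⟨t, rfl⟩; exact y_mul_comm s t)

open scoped IsMulCommutative in
instance : CommRing (YAlg K ℓ n) := inferInstance

/-- The generator `y_s` in the commutative subalgebra. -/
def yc (s : Fin n) : YAlg K ℓ n := ⟨y K ℓ s, Algebra.subset_adjoin ⟨s, rfl⟩⟩

theorem yMonomial_eq (a : Fin n → ℕ) :
    yMonomial K ℓ a = ((∏ i, yc i ^ a i : YAlg K ℓ n) : Alg K ℓ n) := by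
  rw [← List.prod_ofFn, yMonomial, ← Subalgebra.coe_val, map_list_prod, List.map_ofFn]
  rfl

theorem yMonomial_zero : yMonomial K ℓ (0 : Fin n → ℕ) = 1 := by
  simp [yMonomial_eq]

theorem yMonomial_add (a b : Fin n → ℕ) :
    yMonomial K ℓ (a + b) = yMonomial K ℓ a * yMonomial K ℓ b := by
  simp only [yMonomial_eq, Pi.add_apply, pow_add, Finset.prod_mul_distrib]; rfl

theorem yMonomial_single (s : Fin n) (k : ℕ) : yMonomial K ℓ (Pi.single s k) = y K ℓ s ^ k := by
  rw [yMonomial_eq, Finset.prod_eq_single s]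
  · simp [yc]
  · intro b _ hb; simp [hb]
  · simp

theorem star_yMonomial (a : Fin n → ℕ) : star (yMonomial K ℓ a) = yMonomial K ℓ a := by
  have : yMonomial K ℓ a ∈ YAlg K ℓ n := by rw [yMonomial_eq]; exact Subtype.property _
  generalize yMonomial K ℓ a = x at this
  induction this using Algebra.adjoin_induction with
  | mem x h => obtain ⟨s, rfl⟩ := h; exact star_gen _
  | algebraMap c =>
    rw [Algebra.algebraMap_eq_smul_one, star_smul]; congr 1; rw [star, map_one, unop_one]
  | add a b _ _ ha hb => rw [star_add, ha, hb]
  | mul a b ha hb iha ihb =>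
    rw [star_mul, iha, ihb]
    exact congrArg Subtype.val (mul_comm (⟨b, hb⟩ : YAlg K ℓ n) ⟨a, ha⟩)

/-- Induction on exponents. -/
theorem expo_induction {p : (Fin n → ℕ) → Prop} (h0 : p 0)
    (hs : ∀ a s, p a → p (Pi.single s 1 + a)) (a : Fin n → ℕ) : p a := by
  induction hk : ∑ i, a i generalizing a with
  | zero =>
    have : a = 0 := by funext i; simpa using (Finset.sum_eq_zero_iff.1 hk) i (Finset.mem_univ _)
    rwa [this]
  | succ k ih =>
    obtain ⟨s, hsa⟩ : ∃ s, a s ≠ 0 := by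
      by_contra! h
      simp [h] at hk
    have h1 : a = Pi.single s 1 + (a - Pi.single s 1) := by
      funext i
      by_cases hi : i = s
      · subst hi; simp; omega
      · simp [hi]
    rw [h1]
    refine hs _ _ (ih _ ?_)
    rw [h1] at hk
    simp only [Pi.add_apply, Finset.sum_add_distrib] at hk
    have : ∑ i, (Pi.single s 1 : Fin n → ℕ) i = 1 := by simp
    omega

/-- The `ψ`-part of a monomial in normal form. -/
def psiWord (l : List (Fin (n - 1))) : Alg K ℓ n := (l.map (psi K ℓ)).prod

/-- Every element is a linear combination of the `y^a ψ_{i_1} ⋯ ψ_{i_k}`. -/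
theorem span_normal : Submodule.span K
    {x : Alg K ℓ n | ∃ (a : Fin n → ℕ) (l : List (Fin (n - 1))),
      x = yMonomial K ℓ a * psiWord l} = ⊤ := by
  set S := Submodule.span K {x : Alg K ℓ n | ∃ (a : Fin n → ℕ) (l : List (Fin (n - 1))),
      x = yMonomial K ℓ a * psiWord l} with hS
  have hy : ∀ s, ∀ x ∈ S, y K ℓ s * x ∈ S := by
    intro s x hx
    induction hx using Submodule.span_induction with
    | mem x h =>
      obtain ⟨a, l, rfl⟩ := h
      refine Submodule.subset_span ⟨Pi.single s 1 + a, l, ?_⟩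
      rw [yMonomial_add, yMonomial_single, pow_one, mul_assoc]
    | zero => rw [mul_zero]; exact S.zero_mem
    | add a b _ _ ha hb => rw [mul_add]; exact S.add_mem ha hb
    | smul c a _ ha => rw [mul_smul_comm]; exact S.smul_mem _ ha
  -- The letter ψ_r moves to the right through y^a one variable at a time; the error terms have lost
  -- ψ_r and are again in normal form.
  have hp : ∀ (r : Fin (n - 1)) (l : List (Fin (n - 1))) (a : Fin n → ℕ),
      psi K ℓ r * (yMonomial K ℓ a * psiWord l) ∈ S := by
    intro r l a
    induction a using expo_induction with
    | h0 =>
      refine Submodule.subset_span ⟨0, r :: l, ?_⟩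
      rw [yMonomial_zero, one_mul, one_mul]; simp [psiWord]
    | hs a s ih =>
      rw [yMonomial_add, yMonomial_single, pow_one, mul_assoc, ← mul_assoc]
      have hmem : yMonomial K ℓ a * psiWord l ∈ S := Submodule.subset_span ⟨a, l, rfl⟩
      by_cases h1 : s = lo r
      · subst h1
        have h1 : psi K ℓ r * y K ℓ (lo r) = y K ℓ (hi r) * psi K ℓ r - 1 := by
          rw [y_hi_mul_psi]; abel
        rw [h1, sub_mul, one_mul, mul_assoc]
        exact S.sub_mem (hy _ _ ih) hmem
      · by_cases h2 : s = hi r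
        · subst h2
          rw [psi_mul_y_hi, add_mul, one_mul, mul_assoc]
          exact S.add_mem (hy _ _ ih) hmem
        · rw [psi_mul_y_of_ne r s h1 h2, mul_assoc]
          exact hy _ _ ih
  apply eq_top_of_gen_mul
  · refine Submodule.subset_span ⟨0, [], ?_⟩
    rw [yMonomial_zero]; simp [psiWord]
  · rintro (r | s) x hx
    · induction hx using Submodule.span_induction with
      | mem x h => obtain ⟨a, l, rfl⟩ := h; exact hp r l a
      | zero => rw [mul_zero]; exact S.zero_mem
      | add a b _ _ ha hb => rw [mul_add]; exact S.add_mem ha hb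
      | smul c a _ ha => rw [mul_smul_comm]; exact S.smul_mem _ ha
    · exact hy s x hx

theorem psiWord_mul_psiLong (l : List (Fin (n - 1))) :
    psiWord l * psiLong K ℓ n = if l = [] then psiLong K ℓ n else 0 := by
  rcases List.eq_nil_or_concat' l with rfl | ⟨l, r, rfl⟩
  · simp [psiWord]
  · simp [psiWord, mul_assoc, psi_mul_psiLong]

/-- `H ψ_{w₀}` is spanned by the `y^a ψ_{w₀}`. -/
theorem mul_psiLong_mem (h : Alg K ℓ n) : h * psiLong K ℓ n ∈
    Submodule.span K (Set.range fun a => yMonomial K ℓ a * psiLong K ℓ n) := by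
  have : h ∈ (⊤ : Submodule K (Alg K ℓ n)) := trivial
  rw [← span_normal] at this
  induction this using Submodule.span_induction with
  | mem x h =>
    obtain ⟨a, l, rfl⟩ := h
    rw [mul_assoc, psiWord_mul_psiLong]
    split_ifs
    · exact Submodule.subset_span ⟨a, rfl⟩
    · rw [mul_zero]; exact Submodule.zero_mem _
  | zero => rw [zero_mul]; exact Submodule.zero_mem _
  | add a b _ _ ha hb => rw [add_mul]; exact Submodule.add_mem _ ha hb
  | smul c a _ ha => rw [smul_mul_assoc]; exact Submodule.smul_mem _ _ ha

theorem psiLong_mul_mem (h : Alg K ℓ n) : psiLong K ℓ n * h ∈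
    Submodule.span K (Set.range fun a => psiLong K ℓ n * yMonomial K ℓ a) := by
  have h2 : psiLong K ℓ n * h = star (star h * psiLong K ℓ n) := by
    rw [star_mul, star_star, star_psiLong]
  have h3 := mul_psiLong_mem (star h)
  rw [h2]
  generalize star h * psiLong K ℓ n = x at h3
  induction h3 using Submodule.span_induction with
  | mem x h =>
    obtain ⟨a, rfl⟩ := h
    exact Submodule.subset_span ⟨a, by simp only [star_mul, star_psiLong, star_yMonomial]⟩
  | zero => rw [star_zero]; exact Submodule.zero_mem _
  | add a b _ _ ha hb => rw [star_add]; exact Submodule.add_mem _ ha hb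
  | smul c a _ ha => rw [star_smul]; exact Submodule.smul_mem _ _ ha

end Alg

/-! ### The grading -/

section Grading

variable {K : Type u} [Field K] {ℓ n : ℕ}

/-- The coaction `x ↦ x t^d`, for `x` of degree `d`, that encodes the grading. -/
def coaction : Alg K ℓ n →ₐ[K] AddMonoidAlgebra (Alg K ℓ n) ℤ :=
  liftAlg K ℓ n (fun g => AddMonoidAlgebra.single g.deg (gen K ℓ g)) <| by
    have hp : ∀ r : Fin (n - 1), gen K ℓ (Gen.psi r) = psi K ℓ r := fun _ => rfl
    have hy : ∀ s : Fin n, gen K ℓ (Gen.y s) = y K ℓ s := fun _ => rfl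
    apply lift_rel <;> simp only [hp, hy, AddMonoidAlgebra.single_mul_single, Gen.deg]
    · intro r; rw [psi_mul_self, AddMonoidAlgebra.single_zero]
    · intro r k h; rw [psi_comm_of_lt r k h]
    · intro r r' h; rw [psi_braid r r' h]
    · intro s t; rw [y_mul_comm]
    · intro r s h h'; rw [psi_mul_y_of_ne r s h h', add_comm]
    · intro r; rw [psi_mul_y_hi, AddMonoidAlgebra.single_add, AddMonoidAlgebra.one_def]; norm_num
    · intro r; rw [y_hi_mul_psi, AddMonoidAlgebra.single_add, AddMonoidAlgebra.one_def]; norm_num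
    · intro s h; rw [AddMonoidAlgebra.single_pow, y_pow_eq_zero s h, AddMonoidAlgebra.single_zero]

theorem one_mem_grade : (1 : Alg K ℓ n) ∈ grade K ℓ n 0 :=
  Submodule.subset_span ⟨[], rfl, rfl⟩

theorem gen_mem_grade (g : Gen n) : gen K ℓ g ∈ grade K ℓ n g.deg :=
  Submodule.subset_span ⟨[g], by simp, by simp⟩

theorem mul_mem_grade {i j : ℤ} {a b : Alg K ℓ n} (ha : a ∈ grade K ℓ n i)
    (hb : b ∈ grade K ℓ n j) : a * b ∈ grade K ℓ n (i + j) := by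
  have := Submodule.mul_mem_mul ha hb
  rw [grade, grade, Submodule.span_mul_span] at this
  refine Submodule.span_mono ?_ this
  rintro _ ⟨_, ⟨w, hw, rfl⟩, _, ⟨w', hw', rfl⟩, rfl⟩
  exact ⟨w ++ w', by simp [hw, hw'], by simp⟩

theorem coaction_of_mem {d : ℤ} {x : Alg K ℓ n} (hx : x ∈ grade K ℓ n d) :
    coaction x = AddMonoidAlgebra.single d x := by
  induction hx using Submodule.span_induction with
  | mem x h =>
    obtain ⟨w, rfl, rfl⟩ := h
    induction w with
    | nil => rw [List.map_nil, List.prod_nil, map_one]; rfl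
    | cons g w ih =>
      rw [List.map_cons, List.prod_cons, map_mul, ih, coaction, liftAlg_gen,
        AddMonoidAlgebra.single_mul_single]
      simp
  | zero => simp
  | add a b _ _ ha hb => rw [map_add, ha, hb, AddMonoidAlgebra.single_add]
  | smul c a _ ha => rw [map_smul, ha, AddMonoidAlgebra.smul_single]

/-- The projection to the homogeneous component of degree `d`. -/
def comp (d : ℤ) : Alg K ℓ n →ₗ[K] Alg K ℓ n where
  toFun x := (coaction x).coeff d
  map_add' a b := by simp
  map_smul' c a := by simp

theorem comp_of_mem {d : ℤ} {x : Alg K ℓ n} (hx : x ∈ grade K ℓ n d) : comp d x = x := by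
  change (coaction x).coeff d = x
  rw [coaction_of_mem hx, AddMonoidAlgebra.coeff_single, Finsupp.single_eq_same]

theorem comp_of_mem_ne {d d' : ℤ} {x : Alg K ℓ n} (hx : x ∈ grade K ℓ n d) (h : d ≠ d') :
    comp d' x = 0 := by
  change (coaction x).coeff d' = 0
  rw [coaction_of_mem hx, AddMonoidAlgebra.coeff_single, Finsupp.single_eq_of_ne h.symm]

/-- Induction on homogeneous elements. -/
theorem homogeneous_induction {p : Alg K ℓ n → Prop}
    (hom : ∀ d, ∀ x ∈ grade K ℓ n d, p x) (add : ∀ x y, p x → p y → p (x + y)) (x : Alg K ℓ n) :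
    p x := by
  have : x ∈ (⊤ : Submodule K (Alg K ℓ n)) := trivial
  rw [← span_words] at this
  induction this using Submodule.closure_induction with
  | zero => exact hom 0 0 (Submodule.zero_mem _)
  | add a b _ _ ha hb => exact add _ _ ha hb
  | smul_mem c x h =>
    obtain ⟨w, rfl⟩ := h
    exact hom _ _ (Submodule.smul_mem _ _ (Submodule.subset_span ⟨w, rfl, rfl⟩))

theorem comp_mem (d : ℤ) (x : Alg K ℓ n) : comp d x ∈ grade K ℓ n d := by
  induction x using homogeneous_induction with
  | hom i x hx =>
    by_cases h : i = d
    · subst h; rwa [comp_of_mem hx]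
    · rw [comp_of_mem_ne hx h]; exact Submodule.zero_mem _
  | add a b ha hb => rw [map_add]; exact Submodule.add_mem _ ha hb

theorem comp_mul_of_mem (d j : ℤ) (x : Alg K ℓ n) {h : Alg K ℓ n} (hh : h ∈ grade K ℓ n j) :
    comp (d + j) (x * h) = comp d x * h := by
  induction x using homogeneous_induction with
  | hom i x hx =>
    by_cases hd : i = d
    · subst hd; rw [comp_of_mem hx, comp_of_mem (mul_mem_grade hx hh)]
    · rw [comp_of_mem_ne hx hd, comp_of_mem_ne (mul_mem_grade hx hh) (by omega), zero_mul]
  | add a b ha hb => rw [add_mul, map_add, ha, hb, map_add, add_mul]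

theorem mul_comp_of_mem (d j : ℤ) (x : Alg K ℓ n) {h : Alg K ℓ n} (hh : h ∈ grade K ℓ n j) :
    comp (j + d) (h * x) = h * comp d x := by
  induction x using homogeneous_induction with
  | hom i x hx =>
    by_cases hd : i = d
    · subst hd; rw [comp_of_mem hx, comp_of_mem (mul_mem_grade hh hx)]
    · rw [comp_of_mem_ne hx hd, comp_of_mem_ne (mul_mem_grade hh hx) (by omega), mul_zero]
  | add a b ha hb => rw [mul_add, map_add, ha, hb, map_add, mul_add]

/-- Allowing every larger index set T makes the statement additive in x and lets a prescribed degree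
be added to T later. -/
theorem sum_comp (x : Alg K ℓ n) : ∃ S : Finset ℤ, ∀ T, S ⊆ T → ∑ d ∈ T, comp d x = x := by
  induction x using homogeneous_induction with
  | hom i x hx =>
    refine ⟨{i}, fun T hT => ?_⟩
    rw [Finset.sum_eq_single i, comp_of_mem hx]
    · intro b _ hb; exact comp_of_mem_ne hx hb.symm
    · intro h; exact absurd (hT (Finset.mem_singleton_self i)) h
  | add a b ha hb =>
    obtain ⟨S, hS⟩ := ha
    obtain ⟨S', hS'⟩ := hb
    refine ⟨S ∪ S', fun T hT => ?_⟩
    simp only [map_add, Finset.sum_add_distrib]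
    rw [hS T (Finset.union_subset_left hT), hS' T (Finset.union_subset_right hT)]

theorem eq_zero_of_comp {x : Alg K ℓ n} (h : ∀ d, comp d x = 0) : x = 0 := by
  obtain ⟨S, hS⟩ := sum_comp x
  rw [← hS S subset_rfl]
  exact Finset.sum_eq_zero fun d _ => h d

theorem y_mem_grade (s : Fin n) : y K ℓ s ∈ grade K ℓ n 2 := gen_mem_grade (Gen.y s)

theorem yMonomial_mem_grade (a : Fin n → ℕ) :
    yMonomial K ℓ a ∈ grade K ℓ n (2 * ∑ i, (a i : ℤ)) := by
  induction a using expo_induction with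
  | h0 => rw [yMonomial_zero]; simpa using one_mem_grade
  | hs a s ih =>
    rw [yMonomial_add, yMonomial_single, pow_one]
    convert mul_mem_grade (y_mem_grade s) ih using 1
    simp only [Pi.add_apply, Nat.cast_add, Finset.sum_add_distrib]
    have : ∑ i, ((Pi.single s 1 : Fin n → ℕ) i : ℤ) = 1 := by
      rw [← Nat.cast_sum]; simp
    rw [this, mul_add, mul_one]

theorem psiWord_mem_grade (l : List (Fin (n - 1))) :
    psiWord l ∈ grade K ℓ n (-2 * (l.length : ℤ)) := by
  refine Submodule.subset_span ⟨l.map Gen.psi, ?_, ?_⟩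
  · induction l with
    | nil => simp
    | cons r l ih =>
      simp only [List.map_cons, List.sum_cons, ih, Gen.deg, List.length_cons]; push_cast; ring
  · rw [psiWord, List.map_map]; rfl

/-- The length of the longest word. -/
theorem two_mul_length_longWord (n : ℕ) : 2 * (longWord n).length = (n - 1) * n := by
  have h := congrArg List.length (longWord_map_val n)
  rw [List.length_map] at h
  rw [h]
  rcases n with _ | n
  · rfl
  · rw [Nat.add_sub_cancel]
    clear h
    induction n with
    | zero => rfl
    | succ n ih =>
      rw [List.range_succ, List.flatMap_append, List.length_append, mul_add, ih]
      simp; ring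

theorem psiLong_mem_grade : psiLong K ℓ n ∈ grade K ℓ n (-(((n - 1) * n : ℕ) : ℤ)) := by
  have := psiWord_mem_grade (K := K) (ℓ := ℓ) (longWord n)
  have e : -(((n - 1) * n : ℕ) : ℤ) = -2 * ((longWord n).length : ℤ) := by
    rw [← two_mul_length_longWord]; omega
  rw [e]
  exact this

/-- Normal forms respect degrees: an element of degree `0` is a scalar up to an element of
`∑ y_s H`. -/
theorem exists_smul_one_add {x : Alg K ℓ n} (hx : x ∈ grade K ℓ n 0) :
    ∃ c : K, ∃ h : Fin n → Alg K ℓ n, x = c • 1 + ∑ s, y K ℓ s * h s := by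
  have key : ∀ x : Alg K ℓ n, ∃ c : K, ∃ h : Fin n → Alg K ℓ n,
      comp 0 x = c • 1 + ∑ s, y K ℓ s * h s := by
    intro x
    have : x ∈ (⊤ : Submodule K (Alg K ℓ n)) := trivial
    rw [← span_normal] at this
    induction this using Submodule.span_induction with
    | mem x h =>
      obtain ⟨a, l, rfl⟩ := h
      have hm := mul_mem_grade (yMonomial_mem_grade (K := K) (ℓ := ℓ) a)
        (psiWord_mem_grade (K := K) (ℓ := ℓ) l)
      by_cases ha : a = 0
      · subst ha
        rcases l with _ | ⟨r, l⟩
        · refine ⟨1, 0, ?_⟩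
          rw [comp_of_mem (by simpa using hm), yMonomial_zero]
          simp [psiWord]
        -- A nonempty product of ψ's without y's has negative degree, hence no component of degree
        -- 0.
        · refine ⟨0, 0, ?_⟩
          rw [comp_of_mem_ne hm]
          · simp
          · simp; omega
      · have : ∃ (s : Fin n) (b : Fin n → ℕ), a = Pi.single s 1 + b := by
          obtain ⟨s, hs⟩ : ∃ s, a s ≠ 0 := by
            by_contra! h; exact ha (funext h)
          refine ⟨s, a - Pi.single s 1, ?_⟩
          funext i
          by_cases hi : i = s
          · subst hi; simp; omega
          · simp [hi]
        obtain ⟨s, b, rfl⟩ := this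
        -- Since y_s has degree 2, the degree 0 part of y_s x is y_s times the degree -2 part of x.
        refine ⟨0, Pi.single s (comp (-2) (yMonomial K ℓ b * psiWord l)), ?_⟩
        rw [Finset.sum_eq_single s]
        · rw [yMonomial_add, yMonomial_single, pow_one, mul_assoc, Pi.single_eq_same,
            ← mul_comp_of_mem _ _ _ (y_mem_grade s)]
          simp
        · intro i _ hi; simp [hi]
        · simp
    | zero => exact ⟨0, 0, by simp⟩
    | add a b _ _ ha hb =>
      obtain ⟨c, h, e⟩ := ha
      obtain ⟨c', h', e'⟩ := hb
      refine ⟨c + c', h + h', ?_⟩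
      rw [map_add, e, e']
      simp only [add_smul, Pi.add_apply, mul_add, Finset.sum_add_distrib]
      abel
    | smul t a _ ha =>
      obtain ⟨c, h, e⟩ := ha
      refine ⟨t * c, t • h, ?_⟩
      rw [map_smul, e]
      simp [mul_smul, smul_add, Finset.smul_sum]
  obtain ⟨c, h, e⟩ := key x
  rw [comp_of_mem hx] at e
  exact ⟨c, h, e⟩

end Grading

/-! ### The elements `ψ_{w₀} y^a ψ_{w₀}` -/

section Alternating

variable {K : Type u} [Field K] {ℓ n : ℕ}

/-- The element `ψ_{w₀} y^a ψ_{w₀}`. -/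
def tElt (K : Type u) [Field K] (ℓ : ℕ) {n : ℕ} (a : Fin n → ℕ) : Alg K ℓ n :=
  psiLong K ℓ n * yMonomial K ℓ a * psiLong K ℓ n

theorem star_tElt (a : Fin n → ℕ) : star (tElt K ℓ a) = tElt K ℓ a := by
  rw [tElt, star_mul, star_mul, star_psiLong, star_yMonomial, mul_assoc]

theorem psiLong_mul_mul_psiLong {r : Fin (n - 1)} {f : Alg K ℓ n}
    (hf : psi K ℓ r * f = f * psi K ℓ r) : psiLong K ℓ n * f * psiLong K ℓ n = 0 := by
  rw [psiLong_eq]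
  exact isFamily.longest_mul_mul_longest r.2 (by rwa [ext0_val])

/-- Splitting off the powers of `y_r` and `y_{r+1}` from a monomial. -/
theorem yMonomial_split (r : Fin (n - 1)) (a : Fin n → ℕ) :
    yMonomial K ℓ a = yMonomial K ℓ (fun i => if i = lo r ∨ i = hi r then 0 else a i) *
      (y K ℓ (lo r) ^ a (lo r) * y K ℓ (hi r) ^ a (hi r)) := by
  have hne : lo r ≠ hi r := by simp [lo, hi]
  rw [← yMonomial_single, ← yMonomial_single, ← yMonomial_add, ← yMonomial_add]
  congr 1
  funext i
  by_cases h1 : i = lo r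
  · subst h1; simp [hne]
  · by_cases h2 : i = hi r
    · subst h2; simp [hne.symm]
    · simp [h1, h2]

theorem psi_mul_yMonomial_away (r : Fin (n - 1)) (a : Fin n → ℕ) (h1 : a (lo r) = 0)
    (h2 : a (hi r) = 0) : psi K ℓ r * yMonomial K ℓ a = yMonomial K ℓ a * psi K ℓ r := by
  have : ∀ i, Commute (psi K ℓ r) (y K ℓ i ^ a i) := by
    intro i
    by_cases hi1 : i = lo r
    · subst hi1; rw [h1, pow_zero]; exact Commute.one_right _
    · by_cases hi2 : i = hi r
      · subst hi2; rw [h2, pow_zero]; exact Commute.one_right _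
      · exact Commute.pow_right (psi_mul_y_of_ne r i hi1 hi2) _
  exact Commute.list_prod_right _ _ (by simpa [List.mem_ofFn] using this)

/-- The sum of the two monomials is symmetric in y_r and y_{r+1}, so it commutes with ψ_r and
vanishes between two copies of ψ_{w₀}. -/
theorem tElt_swap (r : Fin (n - 1)) (a : Fin n → ℕ) :
    tElt K ℓ (a ∘ Equiv.swap (lo r) (hi r)) = - tElt K ℓ a := by
  rw [eq_neg_iff_add_eq_zero, add_comm, tElt, tElt, ← add_mul, ← mul_add]
  apply psiLong_mul_mul_psiLong (r := r)
  have h := (isFamily (K := K) (ℓ := ℓ) (n := n)).psi_mul_symm r.2 (a (lo r)) (a (hi r))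
  rw [ext0_val, ext0_of_lt _ (show r.val < n by omega),
    ext0_of_lt _ (show r.val + 1 < n by omega)] at h
  change psi K ℓ r * (y K ℓ (lo r) ^ _ * y K ℓ (hi r) ^ _ + y K ℓ (lo r) ^ _ * y K ℓ (hi r) ^ _) =
    (y K ℓ (lo r) ^ _ * y K ℓ (hi r) ^ _ + y K ℓ (lo r) ^ _ * y K ℓ (hi r) ^ _) * psi K ℓ r at h
  rw [yMonomial_split r a, yMonomial_split r (a ∘ _)]
  have h2 : (fun i => if i = lo r ∨ i = hi r then 0 else (a ∘ Equiv.swap (lo r) (hi r)) i) =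
      fun i => if i = lo r ∨ i = hi r then 0 else a i := by
    funext i
    split_ifs with hi
    · rfl
    · push Not at hi; simp [Equiv.swap_apply_of_ne_of_ne hi.1 hi.2]
  rw [h2]
  simp only [Function.comp_apply, Equiv.swap_apply_left, Equiv.swap_apply_right]
  rw [← mul_add, ← mul_assoc, psi_mul_yMonomial_away r _ (by simp) (by simp), mul_assoc, h,
    mul_assoc]

theorem tElt_eq_zero_of_eq (r : Fin (n - 1)) (a : Fin n → ℕ) (ha : a (lo r) = a (hi r)) :
    tElt K ℓ a = 0 := by
  apply psiLong_mul_mul_psiLong (r := r)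
  have h := (isFamily (K := K) (ℓ := ℓ) (n := n)).psi_mul_pow_pow r.2 (a (lo r))
  rw [ext0_val, ext0_of_lt _ (show r.val < n by omega),
    ext0_of_lt _ (show r.val + 1 < n by omega)] at h
  change psi K ℓ r * (y K ℓ (lo r) ^ _ * y K ℓ (hi r) ^ _) =
    (y K ℓ (lo r) ^ _ * y K ℓ (hi r) ^ _) * psi K ℓ r at h
  rw [yMonomial_split r a, ← ha, ← mul_assoc, psi_mul_yMonomial_away r _ (by simp) (by simp),
    mul_assoc, h]
  simp only [mul_assoc]

theorem tElt_perm (σ : Equiv.Perm (Fin n)) (a : Fin n → ℕ) :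
    tElt K ℓ (a ∘ σ) = tElt K ℓ a ∨ tElt K ℓ (a ∘ σ) = - tElt K ℓ a := by
  rcases n with _ | m
  · left; congr 1; exact Subsingleton.elim _ _
  · have hσ : σ ∈ Submonoid.closure
        (Set.range fun i : Fin m => Equiv.swap i.castSucc i.succ) := by
      rw [Equiv.Perm.mclosure_swap_castSucc_succ]; trivial
    induction hσ using Submonoid.closure_induction generalizing a with
    | mem x hx => obtain ⟨i, rfl⟩ := hx; right; exact tElt_swap (n := m + 1) i a
    | one => left; rfl
    | mul x y _ _ hx hy =>
      rw [Equiv.Perm.coe_mul, ← Function.comp_assoc]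
      rcases hy (a ∘ x) with h | h <;> rcases hx a with h' | h' <;> rw [h, h'] <;> simp

theorem theta_strictMono (mu : MPart ℓ n) : StrictMono (theta mu) := (theta mu).strictMono

theorem expo_strictAnti (mu : MPart ℓ n) : StrictAnti (expo mu) := by
  intro i j hij
  have : (theta mu i).val < (theta mu j).val := theta_strictMono mu hij
  have := (theta mu j).2
  simp only [expo]; omega

theorem expo_lt (mu : MPart ℓ n) (i : Fin n) : expo mu i < ℓ := by
  have := (theta mu i).2
  simp only [expo]; omega

theorem theta_injective : Function.Injective (theta (ℓ := ℓ) (n := n)) := by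
  intro s t h
  apply Subtype.ext
  rw [← Finset.coe_inj, ← Finset.range_orderEmbOfFin s.1 s.2,
    ← Finset.range_orderEmbOfFin t.1 t.2]
  exact congrArg (fun f : Fin n ↪o Fin ℓ => Set.range f) h

theorem expo_injective : Function.Injective (expo (ℓ := ℓ) (n := n)) := by
  intro s t h
  apply theta_injective
  ext i
  have := congrFun h i
  have h1 := (theta s i).2
  have h2 := (theta t i).2
  simp only [expo] at this; omega

theorem exists_expo_eq {a : Fin n → ℕ} (ha : StrictAnti a) (hl : ∀ i, a i < ℓ) :
    ∃ mu : MPart ℓ n, expo mu = a := by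
  -- The position is k_i = ℓ - a_i, which is ℓ - 1 - a_i when positions are counted from 0.
  have hm : StrictMono fun i => (⟨ℓ - 1 - a i, by have := hl i; omega⟩ : Fin ℓ) := by
    intro i j hij
    have := ha hij
    have := hl i
    rw [Fin.mk_lt_mk]; omega
  refine ⟨⟨Finset.univ.map ⟨_, hm.injective⟩, by simp⟩, ?_⟩
  funext i
  have : ∀ i, theta (⟨Finset.univ.map ⟨_, hm.injective⟩, by simp⟩ : MPart ℓ n) i
      = (⟨ℓ - 1 - a i, by have := hl i; omega⟩ : Fin ℓ) := by
    have := Finset.orderEmbOfFin_unique (s := Finset.univ.map ⟨_, hm.injective⟩) (k := n) (by simp)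
      (fun i => by simp) hm
    intro i
    exact (congrFun this i).symm
  have h2 := hl i
  change ℓ - ((theta _ i).val + 1) = a i
  rw [this]
  change ℓ - (ℓ - 1 - a i + 1) = a i
  omega

/-- `ψ_{w₀} y^a ψ_{w₀}` vanishes or is, up to sign, `ψ_{w₀} y_μ ψ_{w₀}` for some `μ` with
`deg y_μ = deg y^a`. -/
theorem tElt_eq (a : Fin n → ℕ) : tElt K ℓ a = 0 ∨ ∃ mu : MPart ℓ n,
    ∑ i, expo mu i = ∑ i, a i ∧
      (tElt K ℓ a = tElt K ℓ (expo mu) ∨ tElt K ℓ a = - tElt K ℓ (expo mu)) := by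
  have hsort : ∃ σ : Equiv.Perm (Fin n), Antitone (a ∘ σ) := by
    refine ⟨Tuple.sort (fun i => OrderDual.toDual (a i)), ?_⟩
    exact Tuple.monotone_sort (fun i => OrderDual.toDual (a i))
  obtain ⟨σ, hσ⟩ := hsort
  -- With the exponents sorted decreasingly, a repetition occurs at adjacent places, and an exponent
  -- that is too large forces the first one to be too large, where the cyclotomic relation applies.
  have key : tElt K ℓ (a ∘ σ) = 0 ∨ ∃ mu : MPart ℓ n, expo mu = a ∘ σ := by
    by_cases hs : StrictAnti (a ∘ σ)
    · by_cases hl : ∀ i, (a ∘ σ) i < ℓ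
      · right; exact exists_expo_eq hs hl
      · left
        push Not at hl
        obtain ⟨i, hi⟩ := hl
        have hn : 0 < n := i.pos
        have h0 : ℓ ≤ (a ∘ σ) ⟨0, hn⟩ := hi.trans (hσ (Fin.mk_le_of_le_val (Nat.zero_le _)))
        have : a ∘ σ = Pi.single ⟨0, hn⟩ ℓ + (a ∘ σ - Pi.single ⟨0, hn⟩ ℓ) := by
          funext j
          by_cases hj : j = ⟨0, hn⟩
          · subst hj
            simp only [Pi.add_apply, Pi.sub_apply, Pi.single_eq_same]
            omega
          · simp [hj]
        rw [this, tElt, yMonomial_add, yMonomial_single, y_pow_eq_zero _ rfl]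
        simp
    · left
      have : ∃ r : Fin (n - 1), (a ∘ σ) (lo r) = (a ∘ σ) (hi r) := by
        by_contra! h
        apply hs
        rcases n with _ | m
        · intro i; exact i.elim0
        · apply Fin.strictAnti_iff_succ_lt.2
          intro i
          have h1 : (a ∘ σ) i.succ ≤ (a ∘ σ) i.castSucc := hσ (Fin.castSucc_le_succ i)
          exact lt_of_le_of_ne h1 (fun e => h i e.symm)
      obtain ⟨r, hr⟩ := this
      exact tElt_eq_zero_of_eq r _ hr
  rcases key with h0 | ⟨mu, hmu⟩
  · left
    rcases tElt_perm (K := K) (ℓ := ℓ) σ a with h | h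
    · rw [← h, h0]
    · rw [← neg_eq_zero, ← h, h0]
  · right
    refine ⟨mu, ?_, ?_⟩
    · rw [hmu]; exact Equiv.sum_comp σ a
    · rw [hmu]
      rcases tElt_perm (K := K) (ℓ := ℓ) σ a with h | h
      · left; exact h.symm
      · right; rw [h, neg_neg]

theorem tElt_mem_span (a : Fin n → ℕ) : tElt K ℓ a ∈ Submodule.span K
    {x | ∃ mu : MPart ℓ n, ∑ i, expo mu i = ∑ i, a i ∧ x = tElt K ℓ (expo mu)} := by
  rcases tElt_eq (K := K) (ℓ := ℓ) a with h | ⟨mu, h1, h | h⟩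
  · rw [h]; exact Submodule.zero_mem _
  · rw [h]; exact Submodule.subset_span ⟨mu, h1, rfl⟩
  · rw [h]; exact Submodule.neg_mem _ (Submodule.subset_span ⟨mu, h1, rfl⟩)

/-- `ψ_{w₀} H ψ_{w₀}` is spanned by the `ψ_{w₀} y^a ψ_{w₀}`. -/
theorem psiLong_mul_mul_psiLong_mem (h : Alg K ℓ n) : psiLong K ℓ n * h * psiLong K ℓ n ∈
    Submodule.span K (Set.range (tElt K ℓ (n := n))) := by
  rw [mul_assoc]
  have := mul_psiLong_mem h
  generalize h * psiLong K ℓ n = x at this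
  induction this using Submodule.span_induction with
  | mem x h =>
    obtain ⟨a, rfl⟩ := h
    exact Submodule.subset_span ⟨a, mul_assoc _ _ _⟩
  | zero => rw [mul_zero]; exact Submodule.zero_mem _
  | add a b _ _ ha hb => rw [mul_add]; exact Submodule.add_mem _ ha hb
  | smul c a _ ha => rw [mul_smul_comm]; exact Submodule.smul_mem _ _ ha

/-- The spanning elements ψ_{w₀} y^a ψ_{w₀} are palindromes. The commutativity of the corner rests
on this. -/
theorem star_psiLong_mul_mul_psiLong (h : Alg K ℓ n) :
    star (psiLong K ℓ n * h * psiLong K ℓ n) = psiLong K ℓ n * h * psiLong K ℓ n := by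
  have := psiLong_mul_mul_psiLong_mem h
  generalize psiLong K ℓ n * h * psiLong K ℓ n = x at this
  induction this using Submodule.span_induction with
  | mem x h => obtain ⟨a, rfl⟩ := h; exact star_tElt a
  | zero => exact star_zero
  | add a b _ _ ha hb => rw [star_add, ha, hb]
  | smul c a _ ha => rw [star_smul, ha]

end Alternating

/-! ### Divided differences and the linear independence of the `ψ_{w₀} y_μ ψ_{w₀}` -/

section Polynomial

open MvPolynomial

variable {K : Type u} [Field K] {n : ℕ}

/-- The transposition of `r` and `r + 1` on polynomials. -/
def swapHom (r : Fin (n - 1)) : MvPolynomial (Fin n) K →ₐ[K] MvPolynomial (Fin n) K :=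
  rename (Equiv.swap (lo r) (hi r))

/-- The difference `y_{r+1} - y_r`. -/
def rootPoly (r : Fin (n - 1)) : MvPolynomial (Fin n) K := X (hi r) - X (lo r)

theorem lo_ne_hi (r : Fin (n - 1)) : lo r ≠ hi r := by simp [lo, hi]

theorem rootPoly_ne_zero (r : Fin (n - 1)) : (rootPoly r : MvPolynomial (Fin n) K) ≠ 0 := by
  rw [rootPoly, sub_ne_zero]
  exact fun h => lo_ne_hi r (X_injective h).symm

theorem swapHom_lo (r : Fin (n - 1)) : swapHom r (X (lo r) : MvPolynomial (Fin n) K) = X (hi r) := by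
  simp [swapHom]

theorem swapHom_hi (r : Fin (n - 1)) : swapHom r (X (hi r) : MvPolynomial (Fin n) K) = X (lo r) := by
  simp [swapHom]

theorem swapHom_of_ne (r : Fin (n - 1)) {s : Fin n} (h : s ≠ lo r) (h' : s ≠ hi r) :
    swapHom r (X s : MvPolynomial (Fin n) K) = X s := by
  simp [swapHom, Equiv.swap_apply_of_ne_of_ne h h']

theorem swapHom_swapHom (r : Fin (n - 1)) (f : MvPolynomial (Fin n) K) :
    swapHom r (swapHom r f) = f := by
  rw [swapHom, rename_rename]
  have : (⇑(Equiv.swap (lo r) (hi r)) ∘ ⇑(Equiv.swap (lo r) (hi r))) = id := by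
    funext i; simp
  rw [this, rename_id_apply]

theorem swapHom_rootPoly (r : Fin (n - 1)) :
    swapHom r (rootPoly r : MvPolynomial (Fin n) K) = - rootPoly r := by
  rw [rootPoly, map_sub, swapHom_lo, swapHom_hi]; ring

theorem rootPoly_dvd (r : Fin (n - 1)) (f : MvPolynomial (Fin n) K) :
    rootPoly r ∣ f - swapHom r f := by
  induction f using MvPolynomial.induction_on with
  | C a => rw [swapHom, rename_C, sub_self]; exact dvd_zero _
  | add p q hp hq => rw [map_add, add_sub_add_comm]; exact dvd_add hp hq
  | mul_X p s hp =>
    have hX : rootPoly r ∣ (X s - swapHom r (X s) : MvPolynomial (Fin n) K) := by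
      by_cases h1 : s = lo r
      · subst h1; rw [swapHom_lo, ← dvd_neg, neg_sub]; exact dvd_rfl
      · by_cases h2 : s = hi r
        · subst h2; rw [swapHom_hi]; exact dvd_rfl
        · rw [swapHom_of_ne r h1 h2, sub_self]; exact dvd_zero _
    have : p * X s - swapHom r (p * X s)
        = (p - swapHom r p) * X s + swapHom r p * (X s - swapHom r (X s)) := by
      rw [map_mul]; ring
    rw [this]
    exact dvd_add (hp.mul_right _) (hX.mul_left _)

/-- The divided difference as a function. -/
def ddFun (r : Fin (n - 1)) (f : MvPolynomial (Fin n) K) : MvPolynomial (Fin n) K :=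
  (rootPoly_dvd r f).choose

theorem rootPoly_mul_ddFun (r : Fin (n - 1)) (f : MvPolynomial (Fin n) K) :
    rootPoly r * ddFun r f = f - swapHom r f := (rootPoly_dvd r f).choose_spec.symm

theorem ddFun_eq {r : Fin (n - 1)} {f g : MvPolynomial (Fin n) K}
    (h : rootPoly r * g = f - swapHom r f) : ddFun r f = g :=
  mul_left_cancel₀ (rootPoly_ne_zero r) ((rootPoly_mul_ddFun r f).trans h.symm)

/-- The divided difference operator `f ↦ (f - s_r f) / (y_{r+1} - y_r)`. -/
def dd (r : Fin (n - 1)) : Module.End K (MvPolynomial (Fin n) K) where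
  toFun := ddFun r
  map_add' f g := ddFun_eq <| by
    rw [mul_add, rootPoly_mul_ddFun, rootPoly_mul_ddFun, map_add]; ring
  map_smul' c f := ddFun_eq <| by
    rw [RingHom.id_apply, mul_smul_comm, rootPoly_mul_ddFun, map_smul, smul_sub]

theorem rootPoly_mul_dd (r : Fin (n - 1)) (f : MvPolynomial (Fin n) K) :
    rootPoly r * dd r f = f - swapHom r f := rootPoly_mul_ddFun r f

theorem dd_eq {r : Fin (n - 1)} {f g : MvPolynomial (Fin n) K}
    (h : rootPoly r * g = f - swapHom r f) : dd r f = g := ddFun_eq h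

/-- Multiplication by the variable `y_s`. -/
def mulX (s : Fin n) : Module.End K (MvPolynomial (Fin n) K) := LinearMap.mulLeft K (X s)

theorem mulX_apply (s : Fin n) (f : MvPolynomial (Fin n) K) : mulX s f = X s * f := rfl

theorem swapHom_dd (r : Fin (n - 1)) (f : MvPolynomial (Fin n) K) :
    swapHom r (dd r f) = dd r f := by
  apply mul_left_cancel₀ (rootPoly_ne_zero r)
  have := congrArg (swapHom r) (rootPoly_mul_dd r f)
  rw [map_mul, map_sub, swapHom_swapHom, swapHom_rootPoly] at this
  rw [rootPoly_mul_dd]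
  linear_combination -this

theorem dd_dd (r : Fin (n - 1)) : (dd r * dd r : Module.End K (MvPolynomial (Fin n) K)) = 0 := by
  apply LinearMap.ext
  intro f
  change dd r (dd r f) = 0
  exact dd_eq (by rw [swapHom_dd, sub_self, mul_zero])

theorem dd_comm (r k : Fin (n - 1)) (h : k.val + 1 < r.val) :
    (dd r * dd k : Module.End K (MvPolynomial (Fin n) K)) = dd k * dd r := by
  have h1 : lo k ≠ lo r := by simp [lo]; omega
  have h2 : lo k ≠ hi r := by simp [lo, hi]; omega
  have h3 : hi k ≠ lo r := by simp [lo, hi]; omega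
  have h4 : hi k ≠ hi r := by simp [hi]; omega
  have e1 : swapHom r (rootPoly k) = (rootPoly k : MvPolynomial (Fin n) K) := by
    rw [rootPoly, map_sub, swapHom_of_ne r h1 h2, swapHom_of_ne r h3 h4]
  have e2 : swapHom k (rootPoly r) = (rootPoly r : MvPolynomial (Fin n) K) := by
    rw [rootPoly, map_sub, swapHom_of_ne k h1.symm h3.symm, swapHom_of_ne k h2.symm h4.symm]
  have e3 : ∀ f : MvPolynomial (Fin n) K, swapHom r (swapHom k f) = swapHom k (swapHom r f) := by
    intro f
    rw [swapHom, swapHom, rename_rename, rename_rename, ← Equiv.Perm.coe_mul,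
      ← Equiv.Perm.coe_mul]
    congr 2
    refine congrArg _ (Equiv.Perm.Disjoint.commute ?_).eq
    rw [Equiv.Perm.disjoint_iff_disjoint_support, Equiv.Perm.support_swap (lo_ne_hi r),
      Equiv.Perm.support_swap (lo_ne_hi k)]
    simp [h1, h2, h3, h4]
  apply LinearMap.ext
  intro f
  change dd r (dd k f) = dd k (dd r f)
  apply mul_left_cancel₀ (mul_ne_zero (rootPoly_ne_zero k) (rootPoly_ne_zero r))
  have a1 := rootPoly_mul_dd r (dd k f)
  have a2 := rootPoly_mul_dd k f
  have a3 := congrArg (swapHom r) a2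
  have b1 := rootPoly_mul_dd k (dd r f)
  have b2 := rootPoly_mul_dd r f
  have b3 := congrArg (swapHom k) b2
  rw [map_mul, map_sub, e1] at a3
  rw [map_mul, map_sub, e2] at b3
  rw [e3] at a3
  linear_combination rootPoly k * a1 - rootPoly r * b1 + a2 - a3 - b2 + b3

theorem dd_braid (r r' : Fin (n - 1)) (h : r'.val = r.val + 1) :
    (dd r * dd r' * dd r : Module.End K (MvPolynomial (Fin n) K)) = dd r' * dd r * dd r' := by
  have hl : lo r' = hi r := by simp [lo, hi, h]
  have h1 : lo r ≠ hi r := lo_ne_hi r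
  have h2 : hi r ≠ hi r' := by simp [hi, h]
  have h3 : lo r ≠ hi r' := by simp [lo, hi, h]; omega
  have ra : rootPoly r' = (X (hi r') - X (hi r) : MvPolynomial (Fin n) K) := by rw [rootPoly, hl]
  have e1 : swapHom r (rootPoly r') = (X (hi r') - X (lo r) : MvPolynomial (Fin n) K) := by
    rw [ra, map_sub, swapHom_hi, swapHom_of_ne r h3.symm h2.symm]
  have e2 : swapHom r' (rootPoly r) = (X (hi r') - X (lo r) : MvPolynomial (Fin n) K) := by
    rw [rootPoly, map_sub, swapHom_of_ne r' (s := lo r) (by rw [hl]; exact h1) h3, ← hl, swapHom_lo]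
  have e5 : swapHom r (X (hi r') - X (lo r)) = (rootPoly r' : MvPolynomial (Fin n) K) := by
    rw [← e1, swapHom_swapHom]
  have e6 : swapHom r' (X (hi r') - X (lo r)) = (rootPoly r : MvPolynomial (Fin n) K) := by
    rw [← e2, swapHom_swapHom]
  have e3 : ∀ f : MvPolynomial (Fin n) K,
      swapHom r (swapHom r' (swapHom r f)) = swapHom r' (swapHom r (swapHom r' f)) := by
    intro f
    simp only [swapHom, rename_rename]
    congr 2
    funext i
    simp only [Function.comp_apply, hl]
    have b1 := Equiv.swap_mul_swap_mul_swap h1 h3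
    have b2 := Equiv.swap_mul_swap_mul_swap h2.symm h3.symm
    have c1 : Equiv.swap (lo r) (hi r) * Equiv.swap (hi r) (hi r') * Equiv.swap (lo r) (hi r)
        = Equiv.swap (hi r) (hi r') * Equiv.swap (lo r) (hi r) * Equiv.swap (hi r) (hi r') := by
      rw [b1, Equiv.swap_comm (hi r') (lo r), ← b2, Equiv.swap_comm (hi r) (lo r),
        Equiv.swap_comm (hi r') (hi r)]
    exact congrArg (fun σ : Equiv.Perm (Fin n) => σ i) c1
  apply LinearMap.ext
  intro f
  change dd r (dd r' (dd r f)) = dd r' (dd r (dd r' f))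
  apply mul_left_cancel₀ (rootPoly_ne_zero r)
  apply mul_left_cancel₀ (rootPoly_ne_zero r')
  have hne : (X (hi r') - X (lo r) : MvPolynomial (Fin n) K) ≠ 0 := by
    rw [sub_ne_zero]; exact fun h => h3 (X_injective h).symm
  apply mul_left_cancel₀ hne
  set γ : MvPolynomial (Fin n) K := X (hi r') - X (lo r) with hγ
  have hsum : γ = rootPoly r + rootPoly r' := by rw [ra, rootPoly]; ring
  -- After clearing the three roots of S₃, a threefold divided difference becomes the alternating
  -- sum over S₃. This is symmetric in p and q except for its last term, where the braid relation of
  -- the transpositions takes over.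
  have main : ∀ (p q : Fin (n - 1)), rootPoly p + rootPoly q = γ → swapHom p (rootPoly q) = γ →
      swapHom q (rootPoly p) = γ → swapHom p γ = rootPoly q →
      rootPoly p * (rootPoly q * (γ * dd p (dd q (dd p f)))) = f - swapHom p f - swapHom q f +
        swapHom q (swapHom p f) + swapHom p (swapHom q f) -
          swapHom p (swapHom q (swapHom p f)) := by
    intro p q hs h12 h21 hg
    have a1 := rootPoly_mul_dd p f
    have a2 := congrArg (swapHom q) a1
    rw [map_mul, map_sub, h21] at a2
    have a3 := rootPoly_mul_dd q (dd p f)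
    have a4 : rootPoly q * rootPoly p * γ * dd q (dd p f) =
        γ * (f - swapHom p f) - rootPoly p * (swapHom q f - swapHom q (swapHom p f)) := by
      linear_combination rootPoly p * γ * a3 + γ * a1 - rootPoly p * a2
    have a5 := congrArg (swapHom p) a4
    simp only [map_mul, map_sub, h12, hg, swapHom_rootPoly, swapHom_swapHom] at a5
    have a6 := rootPoly_mul_dd p (dd q (dd p f))
    apply mul_left_cancel₀ (rootPoly_ne_zero p)
    linear_combination rootPoly p * rootPoly q * γ * a6 + a4 + a5 -
      (f - swapHom p f) * hs
  have m1 := main r r' hsum.symm e1 e2 e5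
  have m2 := main r' r (by rw [hsum]; ring) e2 e1 e6
  rw [← e3] at m2
  linear_combination m1 - m2

theorem dd_mulX_hi (r : Fin (n - 1)) :
    (dd r * mulX (hi r) : Module.End K (MvPolynomial (Fin n) K)) = mulX (lo r) * dd r + 1 := by
  apply LinearMap.ext
  intro f
  rw [LinearMap.add_apply, Module.End.mul_apply, Module.End.mul_apply, mulX_apply, mulX_apply,
    Module.End.one_apply]
  apply dd_eq
  rw [map_mul, swapHom_hi]
  have := rootPoly_mul_dd r f
  rw [rootPoly] at this ⊢
  linear_combination X (lo r) * this

theorem mulX_hi_dd (r : Fin (n - 1)) :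
    (mulX (hi r) * dd r : Module.End K (MvPolynomial (Fin n) K)) = dd r * mulX (lo r) + 1 := by
  rw [← sub_eq_iff_eq_add]
  symm
  apply LinearMap.ext
  intro f
  rw [LinearMap.sub_apply, Module.End.mul_apply, Module.End.mul_apply, mulX_apply, mulX_apply,
    Module.End.one_apply]
  apply dd_eq
  rw [map_mul, swapHom_lo]
  have := rootPoly_mul_dd r f
  rw [rootPoly] at this ⊢
  linear_combination X (hi r) * this

theorem dd_mulX_of_ne (r : Fin (n - 1)) (s : Fin n) (h : s ≠ lo r) (h' : s ≠ hi r) :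
    (dd r * mulX s : Module.End K (MvPolynomial (Fin n) K)) = mulX s * dd r := by
  apply LinearMap.ext
  intro f
  rw [Module.End.mul_apply, Module.End.mul_apply, mulX_apply, mulX_apply]
  apply dd_eq
  rw [map_mul, swapHom_of_ne r h h']
  linear_combination X s * rootPoly_mul_dd r f

theorem mulX_comm (s t : Fin n) :
    (mulX s * mulX t : Module.End K (MvPolynomial (Fin n) K)) = mulX t * mulX s := by
  apply LinearMap.ext
  intro f
  exact mul_left_comm (X s) (X t) f

theorem isFamily_dd : IsFamily (n - 1) (ext0 (dd (K := K) (n := n))) (ext0 mulX) :=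
  isFamily_ext0 _ _ dd_dd dd_comm dd_braid mulX_comm dd_mulX_of_ne dd_mulX_hi mulX_hi_dd

theorem dd_one (r : Fin (n - 1)) : dd r (1 : MvPolynomial (Fin n) K) = 0 :=
  dd_eq (by rw [map_one, sub_self, mul_zero])

/-- Antisymmetrization of polynomials. -/
def alt : MvPolynomial (Fin n) K →ₗ[K] MvPolynomial (Fin n) K :=
  ∑ σ : Equiv.Perm (Fin n), (Equiv.Perm.sign σ : ℤ) • (rename σ).toLinearMap

theorem alt_apply (f : MvPolynomial (Fin n) K) :
    alt f = ∑ σ : Equiv.Perm (Fin n), (Equiv.Perm.sign σ : ℤ) • rename σ f := by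
  simp [alt]

/-- The terms of σ and σ s_r cancel in pairs. No division by 2 is involved, so the characteristic is
arbitrary. -/
theorem alt_eq_zero {r : Fin (n - 1)} {f : MvPolynomial (Fin n) K} (hf : swapHom r f = f) :
    alt f = 0 := by
  rw [alt_apply]
  refine Finset.sum_involution (fun σ _ => σ * Equiv.swap (lo r) (hi r)) ?_ ?_ ?_ ?_
  · intro σ _
    have : rename (⇑(σ * Equiv.swap (lo r) (hi r))) f = rename σ f := by
      rw [Equiv.Perm.coe_mul, ← rename_rename]; exact congrArg _ hf
    rw [this, Equiv.Perm.sign_mul, Equiv.Perm.sign_swap (lo_ne_hi r)]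
    simp
  · intro σ _ _ h
    rw [mul_eq_left, Equiv.swap_eq_one_iff] at h
    exact lo_ne_hi r h
  · intro σ _; exact Finset.mem_univ _
  · intro σ _; simp [mul_assoc]

/-- Divided differences are self-adjoint for the form alt(pf), because p ∂f - (∂p) f is invariant
under s_r. -/
theorem alt_mul_dd (r : Fin (n - 1)) (p f : MvPolynomial (Fin n) K) :
    alt (p * dd r f) = alt (dd r p * f) := by
  rw [← sub_eq_zero, ← map_sub]
  apply alt_eq_zero (r := r)
  apply mul_left_cancel₀ (rootPoly_ne_zero r)
  rw [map_sub, map_mul, map_mul, swapHom_dd, swapHom_dd]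
  linear_combination (swapHom r p - p) * rootPoly_mul_dd r f
    + (f - swapHom r f) * rootPoly_mul_dd r p

theorem alt_mul_ext0_dd (r : ℕ) (p f : MvPolynomial (Fin n) K) :
    alt (p * ext0 dd r f) = alt (ext0 dd r p * f) := by
  by_cases hr : r < n - 1
  · rw [ext0_of_lt _ hr, alt_mul_dd]
  · rw [ext0_of_le _ (by omega)]; simp

/-- Taking adjoints reverses the word, and the reversed word is again a word of the longest element
by `asc_mul_longest`. -/
theorem alt_mul_longest (m : ℕ) (p f : MvPolynomial (Fin n) K) :
    alt (p * longest (ext0 dd) m f) = alt (longest (ext0 dd) m p * f) := by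
  have hd : ∀ m (p f : MvPolynomial (Fin n) K),
      alt (p * dsc (ext0 dd) m f) = alt (asc (ext0 dd) m p * f) := by
    intro m
    induction m with
    | zero => intro p f; rfl
    | succ m ih =>
      intro p f
      change alt (p * ext0 dd m (dsc (ext0 dd) m f)) = _
      rw [alt_mul_ext0_dd, ih]; rfl
  induction m generalizing p f with
  | zero => rfl
  | succ m ih =>
    change alt (p * longest (ext0 dd) m (dsc (ext0 dd) (m + 1) f)) = _
    rw [ih, hd, ← isFamily_dd.asc_mul_longest]; rfl

/-- The polynomial `y^δ`, as the operator `y^δ` applied to `1`. -/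
def stairPoly (K : Type u) [Field K] (n : ℕ) : MvPolynomial (Fin n) K :=
  stair (ext0 mulX) (n - 1) 1

theorem longest_stairPoly :
    longest (ext0 (dd (K := K) (n := n))) (n - 1) (stairPoly K n) = longSign (n - 1) • 1 :=
  isFamily_dd.longest_stair_smul (V := MvPolynomial (Fin n) K) le_rfl 1 fun r hr => by
    rw [ext0_of_lt _ hr, Module.End.smul_def, dd_one]

/-! ### The polynomial representation of the cyclotomic quotient -/

variable (ℓ : ℕ)

/-- The largest ideal of the polynomial ring whose antisymmetrization only involves monomials with
some exponent at least `ℓ`. -/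
def vanishing (K : Type u) [Field K] (n ℓ : ℕ) : Submodule K (MvPolynomial (Fin n) K) where
  carrier := {f | ∀ p, ∀ a : Fin n →₀ ℕ, (∀ i, a i < ℓ) → coeff a (alt (p * f)) = 0}
  add_mem' {f g} hf hg p a ha := by
    rw [mul_add, map_add, coeff_add, hf p a ha, hg p a ha, add_zero]
  zero_mem' p a _ := by rw [mul_zero, map_zero, coeff_zero]
  smul_mem' c f hf p a ha := by
    rw [mul_smul_comm, map_smul, coeff_smul, hf p a ha, smul_zero]

variable {ℓ}

/-- Self-adjointness moves the divided difference to the test polynomial p, over which `vanishing`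
quantifies. This quantifier is what makes the quotient a module. -/
theorem dd_mem_vanishing (r : Fin (n - 1)) {f : MvPolynomial (Fin n) K}
    (hf : f ∈ vanishing K n ℓ) : dd r f ∈ vanishing K n ℓ := by
  intro p a ha
  rw [alt_mul_dd]
  exact hf _ a ha

theorem mulX_mem_vanishing (s : Fin n) {f : MvPolynomial (Fin n) K}
    (hf : f ∈ vanishing K n ℓ) : mulX s f ∈ vanishing K n ℓ := by
  intro p a ha
  rw [mulX_apply, ← mul_assoc]
  exact hf _ a ha

theorem X_pow_mul_mem_vanishing (s : Fin n) (f : MvPolynomial (Fin n) K) :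
    X s ^ ℓ * f ∈ vanishing K n ℓ := by
  intro p a ha
  rw [alt_apply, coeff_sum]
  refine Finset.sum_eq_zero fun σ _ => ?_
  rw [mul_left_comm, map_mul, map_pow, rename_X, X_pow_eq_monomial, ← coeffAddMonoidHom_apply,
    map_zsmul, coeffAddMonoidHom_apply, coeff_monomial_mul', if_neg, smul_zero]
  intro h
  have := h (σ s)
  rw [Finsupp.single_eq_same] at this
  exact absurd (ha (σ s)) (by omega)

/-- The action of the generators on polynomials. -/
def genOp : Gen n → Module.End K (MvPolynomial (Fin n) K)
  | .psi r => dd r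
  | .y s => mulX s

theorem genOp_mem (g : Gen n) : vanishing K n ℓ ≤ (vanishing K n ℓ).comap (genOp g) := by
  rcases g with r | s
  · exact fun f hf => dd_mem_vanishing r hf
  · exact fun f hf => mulX_mem_vanishing s hf

/-- The module obtained from the polynomial ring. -/
abbrev PolyRep (K : Type u) [Field K] (n ℓ : ℕ) : Type u :=
  MvPolynomial (Fin n) K ⧸ vanishing K n ℓ

/-- The action of the generators on `PolyRep`. -/
def genRep (ℓ : ℕ) (g : Gen n) : Module.End K (PolyRep K n ℓ) :=
  (vanishing K n ℓ).mapQ (vanishing K n ℓ) (genOp g) (genOp_mem g)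

theorem genRep_mk (g : Gen n) (f : MvPolynomial (Fin n) K) :
    genRep ℓ g ((vanishing K n ℓ).mkQ f) = (vanishing K n ℓ).mkQ (genOp g f) := rfl

/-- The polynomial representation. -/
def polyRep (K : Type u) [Field K] (n ℓ : ℕ) : Alg K ℓ n →ₐ[K] Module.End K (PolyRep K n ℓ) :=
  liftAlg K ℓ n (genRep ℓ) <| by
    have ext2 : ∀ {A B : Module.End K (PolyRep K n ℓ)}
        (A' B' : Module.End K (MvPolynomial (Fin n) K)),
        (∀ f, A ((vanishing K n ℓ).mkQ f) = (vanishing K n ℓ).mkQ (A' f)) →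
        (∀ f, B ((vanishing K n ℓ).mkQ f) = (vanishing K n ℓ).mkQ (B' f)) →
        A' = B' → A = B := by
      intro A B A' B' hA hB h
      apply Submodule.linearMap_qext
      apply LinearMap.ext
      intro f
      exact (hA f).trans ((congrArg _ (by rw [h])).trans (hB f).symm)
    apply lift_rel
    · intro r
      exact ext2 (dd r * dd r) 0 (fun f => rfl) (fun f => (map_zero _).symm) (dd_dd r)
    · intro r k h; exact ext2 (dd r * dd k) (dd k * dd r) (fun f => rfl) (fun f => rfl) (dd_comm r k h)
    · intro r r' h
      exact ext2 (dd r * dd r' * dd r) (dd r' * dd r * dd r') (fun f => rfl) (fun f => rfl)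
        (dd_braid r r' h)
    · intro s t
      exact ext2 (mulX s * mulX t) (mulX t * mulX s) (fun f => rfl) (fun f => rfl) (mulX_comm s t)
    · intro r s h h'
      exact ext2 (dd r * mulX s) (mulX s * dd r) (fun f => rfl) (fun f => rfl)
        (dd_mulX_of_ne r s h h')
    · intro r
      exact ext2 (dd r * mulX (hi r)) (mulX (lo r) * dd r + 1) (fun f => rfl) (fun f => rfl)
        (dd_mulX_hi r)
    · intro r
      exact ext2 (mulX (hi r) * dd r) (dd r * mulX (lo r) + 1) (fun f => rfl) (fun f => rfl)
        (mulX_hi_dd r)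
    · intro s _
      have hpow : ∀ k (f : MvPolynomial (Fin n) K), (genRep ℓ (Gen.y s) ^ k)
          ((vanishing K n ℓ).mkQ f) = (vanishing K n ℓ).mkQ (X s ^ k * f) := by
        intro k
        induction k with
        | zero => intro f; simp
        | succ k ih =>
          intro f
          rw [pow_succ, Module.End.mul_apply, genRep_mk, ih]
          change _ = (vanishing K n ℓ).mkQ _
          congr 1
          change X s ^ k * (X s * f) = _
          ring
      apply Submodule.linearMap_qext
      apply LinearMap.ext
      intro f
      rw [LinearMap.comp_apply, hpow]
      exact (Submodule.Quotient.mk_eq_zero _).2 (X_pow_mul_mem_vanishing s f)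

theorem polyRep_psiLong (f : MvPolynomial (Fin n) K) :
    polyRep K n ℓ (psiLong K ℓ n) ((vanishing K n ℓ).mkQ f) =
      (vanishing K n ℓ).mkQ (longest (ext0 dd) (n - 1) f) := by
  rw [← prod_longWord, psiLong]
  generalize longWord n = l
  induction l with
  | nil => simp
  | cons r l ih =>
    rw [List.map_cons, List.prod_cons, map_mul, Module.End.mul_apply, ih, List.map_cons,
      List.prod_cons]
    have : polyRep K n ℓ (psi K ℓ r) = genRep ℓ (.psi r) := liftAlg_gen _ _ _
    rw [this, genRep_mk]; rfl

theorem polyRep_yMonomial (a : Fin n → ℕ) (f : MvPolynomial (Fin n) K) :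
    polyRep K n ℓ (yMonomial K ℓ a) ((vanishing K n ℓ).mkQ f) =
      (vanishing K n ℓ).mkQ (monomial (Finsupp.equivFunOnFinite.symm a) 1 * f) := by
  induction a using expo_induction with
  | h0 =>
    have : (Finsupp.equivFunOnFinite.symm 0 : Fin n →₀ ℕ) = 0 := by ext; rfl
    rw [yMonomial_zero, map_one, this, monomial_zero', C_1, one_mul]; rfl
  | hs a s ih =>
    have h1 : (Finsupp.equivFunOnFinite.symm (Pi.single s 1 + a) : Fin n →₀ ℕ) =
        Finsupp.single s 1 + Finsupp.equivFunOnFinite.symm a := by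
      ext i
      simp [Finsupp.single_apply, Pi.single_apply, eq_comm]
    have h2 : polyRep K n ℓ (y K ℓ s) = genRep ℓ (.y s) := liftAlg_gen _ _ _
    rw [yMonomial_add, yMonomial_single, pow_one, map_mul, Module.End.mul_apply, ih, h2, genRep_mk,
      h1]
    congr 1
    change X s * _ = _
    rw [← mul_assoc, X, monomial_mul, one_mul]

instance : DecidableEq (MPart ℓ n) := inferInstanceAs (DecidableEq {s : Finset (Fin ℓ) // s.card = n})

/-- A permutation that carries one strictly decreasing exponent vector to another is increasing,
hence the identity, so only the term σ = 1 can contribute. -/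
theorem coeff_alt_expo (mu lam : MPart ℓ n) :
    coeff (Finsupp.equivFunOnFinite.symm (expo lam))
      (alt (monomial (Finsupp.equivFunOnFinite.symm (expo mu)) (1 : K))) =
        if mu = lam then 1 else 0 := by
  have key : ∀ σ : Equiv.Perm (Fin n),
      (Finsupp.equivFunOnFinite.symm (expo mu)).mapDomain σ =
        Finsupp.equivFunOnFinite.symm (expo lam) → σ = 1 ∧ mu = lam := by
    intro σ h
    have h1 : ∀ i, expo mu i = expo lam (σ i) := by
      intro i
      have := DFunLike.congr_fun h (σ i)
      rw [Finsupp.mapDomain_apply σ.injective] at this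
      simpa using this
    have hs : StrictMono σ := by
      intro i j hij
      have := expo_strictAnti mu hij
      rw [h1, h1] at this
      exact (expo_strictAnti lam).lt_iff_gt.1 this
    have : σ = 1 := by
      apply Equiv.ext
      intro i
      exact congrFun ((hs.range_inj strictMono_id).1 (by simp [σ.surjective.range_eq])) i
    subst this
    exact ⟨rfl, expo_injective (funext h1)⟩
  rw [alt_apply, coeff_sum, Finset.sum_eq_single 1]
  · split_ifs with h
    · subst h; simp
    · rw [Equiv.Perm.sign_one, Units.val_one, one_smul, rename_monomial, coeff_monomial, if_neg]
      exact fun e => h (key 1 e).2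
  · intro σ _ hσ
    rw [← coeffAddMonoidHom_apply, map_zsmul, coeffAddMonoidHom_apply, rename_monomial,
      coeff_monomial, if_neg, smul_zero]
    exact fun e => hσ (key σ e).1
  · simp

instance : Fintype (MPart ℓ n) := inferInstanceAs (Fintype {s : Finset (Fin ℓ) // s.card = n})

/-- The elements `ψ_{w₀} y_μ ψ_{w₀}` are linearly independent. -/
theorem linearIndependent_tElt :
    LinearIndependent K fun mu : MPart ℓ n => tElt K ℓ (expo mu) := by
  rw [Fintype.linearIndependent_iff]
  intro c hc lam
  set G : MvPolynomial (Fin n) K :=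
    ∑ mu : MPart ℓ n, c mu • monomial (Finsupp.equivFunOnFinite.symm (expo mu)) 1 with hG
  -- The relation is applied to y^δ: the right-hand ψ_{w₀} turns y^δ into ±1, and what remains is
  -- that ψ_{w₀} annihilates G in the quotient.
  have h1 : longest (ext0 dd) (n - 1) G ∈ vanishing K n ℓ := by
    have h2 : ∀ mu : MPart ℓ n, polyRep K n ℓ (tElt K ℓ (expo mu))
        ((vanishing K n ℓ).mkQ (stairPoly K n)) = longSign (n - 1) • (vanishing K n ℓ).mkQ
          (longest (ext0 dd) (n - 1)
            (monomial (Finsupp.equivFunOnFinite.symm (expo mu)) 1)) := by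
      intro mu
      rw [tElt, map_mul, map_mul, Module.End.mul_apply, Module.End.mul_apply, polyRep_psiLong,
        longest_stairPoly, polyRep_yMonomial, polyRep_psiLong]
      rcases Int.units_eq_one_or (longSign (n - 1)) with h | h <;> rw [h] <;> simp
    have h3 := congrArg (fun x => longSign (n - 1) • polyRep K n ℓ x
      ((vanishing K n ℓ).mkQ (stairPoly K n))) hc
    simp only [map_sum, map_smul, LinearMap.sum_apply, LinearMap.smul_apply, h2, map_zero,
      LinearMap.zero_apply, smul_zero, Finset.smul_sum] at h3
    rw [← Submodule.Quotient.mk_eq_zero, ← Submodule.mkQ_apply, hG, map_sum, map_sum, ← h3]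
    refine Finset.sum_congr rfl fun mu _ => ?_
    rw [map_smul, map_smul]
    rcases Int.units_eq_one_or (longSign (n - 1)) with h | h <;> rw [h] <;> simp
  -- With y^δ as test polynomial, adjointness moves ψ_{w₀} off G and onto y^δ, leaving ±alt(G); its
  -- coefficient at `expo lam` is `c lam`, up to the sign.
  have h4 := h1 (stairPoly K n) (Finsupp.equivFunOnFinite.symm (expo lam)) (expo_lt lam)
  rw [alt_mul_longest, longest_stairPoly] at h4
  have h5 : coeff (Finsupp.equivFunOnFinite.symm (expo lam)) (alt G) = c lam := by
    rw [hG, map_sum, coeff_sum, Finset.sum_eq_single lam]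
    · rw [map_smul, coeff_smul, coeff_alt_expo]; simp
    · intro b _ hb
      rw [map_smul, coeff_smul, coeff_alt_expo, if_neg hb, smul_zero]
    · simp
  rw [← h5]
  rcases Int.units_eq_one_or (longSign (n - 1)) with h | h <;> rw [h] at h4 <;> simpa using h4

end Polynomial

/-! ### The idempotent `𝔣_{1,1}` and its corner -/

section Corner

variable {K : Type u} [Field K] {ℓ n : ℕ}

theorem initProd_eq (m : ℕ) (hm : m ≤ n) :
    initProd (ext0 (y K ℓ (n := n))) m = yMonomial K ℓ fun i : Fin n => if i.val < m then 1 else 0 := by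
  induction m with
  | zero => simp only [initProd, Nat.not_lt_zero, if_false]; exact (yMonomial_zero).symm
  | succ m ih =>
    rw [initProd, ih (by omega), ext0_of_lt _ (show m < n by omega),
      ← pow_one (y K ℓ (⟨m, by omega⟩ : Fin n)), ← yMonomial_single, ← yMonomial_add]
    congr 1
    funext i
    simp only [Pi.add_apply, Pi.single_apply, Fin.ext_iff]
    split_ifs <;> omega

theorem stair_eq (m : ℕ) (hm : m ≤ n) :
    stair (ext0 (y K ℓ (n := n))) m = yMonomial K ℓ fun i : Fin n => m - i.val := by
  induction m with
  | zero => simp only [stair, Nat.zero_sub]; exact (yMonomial_zero).symm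
  | succ m ih =>
    rw [stair, ih (by omega), initProd_eq _ hm, ← yMonomial_add]
    congr 1
    funext i
    simp only [Pi.add_apply]
    split_ifs <;> omega

theorem yStair_eq : yStair K ℓ n = stair (ext0 (y K ℓ (n := n))) (n - 1) :=
  (stair_eq _ (by omega)).symm

variable (K n) in
/-- The sign of the longest element as a scalar. -/
def sgn : K := (((longSign (n - 1) : ℤˣ) : ℤ) : K)

theorem sgn_mul_sgn : sgn K n * sgn K n = 1 := by
  rw [sgn]
  rcases Int.units_eq_one_or (longSign (n - 1)) with h | h <;> rw [h] <;> simp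

/-- This is `longest_stair_smul` for z = ψ_{w₀} in the regular module, since ψ_{w₀} is killed by
every ψ_r on the left. It makes ±ψ_{w₀} y^δ idempotent. -/
theorem psiLong_yStair_psiLong :
    psiLong K ℓ n * yStair K ℓ n * psiLong K ℓ n = sgn K n • psiLong K ℓ n := by
  have h := (isFamily (K := K) (ℓ := ℓ) (n := n)).longest_stair_smul (V := Alg K ℓ n) le_rfl
    (psiLong K ℓ n) (fun r hr => by
      rw [psiLong_eq, smul_eq_mul]; exact isFamily.psi_mul_longest hr)
  rw [← yStair_eq, ← psiLong_eq, smul_eq_mul] at h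
  rw [h, sgn]
  rcases Int.units_eq_one_or (longSign (n - 1)) with h | h <;> rw [h] <;> simp

theorem f11_eq' : f11 K ℓ n = psiLong K ℓ n * yStair K ℓ n * psiLong K ℓ n * yStair K ℓ n := by
  rw [f11, psiLongStar_eq]

theorem f11_eq : f11 K ℓ n = sgn K n • (psiLong K ℓ n * yStair K ℓ n) := by
  rw [f11_eq', psiLong_yStair_psiLong, smul_mul_assoc]

theorem f11_mul_psiLong : f11 K ℓ n * psiLong K ℓ n = psiLong K ℓ n := by
  rw [f11_eq, smul_mul_assoc, psiLong_yStair_psiLong, smul_smul, sgn_mul_sgn, one_smul]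

theorem psiLong_mul_yStair_mul_f11 :
    psiLong K ℓ n * yStair K ℓ n * f11 K ℓ n = psiLong K ℓ n * yStair K ℓ n := by
  rw [f11_eq, mul_smul_comm, ← mul_assoc, psiLong_yStair_psiLong, smul_mul_assoc, smul_smul,
    sgn_mul_sgn, one_smul]

theorem f11_mul_self : f11 K ℓ n * f11 K ℓ n = f11 K ℓ n := by
  nth_rw 1 [f11_eq]
  rw [smul_mul_assoc, psiLong_mul_yStair_mul_f11, ← f11_eq]

theorem bElt_eq (mu : MPart ℓ n) : bElt K mu = tElt K ℓ (expo mu) * yStair K ℓ n := rfl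

theorem f11_mul_bElt (mu : MPart ℓ n) : f11 K ℓ n * bElt K mu = bElt K mu := by
  simp only [bElt, ← mul_assoc, f11_mul_psiLong]

theorem bElt_mul_f11 (mu : MPart ℓ n) : bElt K mu * f11 K ℓ n = bElt K mu := by
  rw [bElt, mul_assoc _ (psiLong K ℓ n) (yStair K ℓ n), mul_assoc, psiLong_mul_yStair_mul_f11]

theorem mem_corner {x : Alg K ℓ n} :
    x ∈ corner K ℓ n ↔ f11 K ℓ n * x = x ∧ x * f11 K ℓ n = x := by
  constructor
  · rintro ⟨z, rfl⟩
    simp only [LinearMap.comp_apply, LinearMap.mulLeft_apply, LinearMap.mulRight_apply]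
    constructor
    · rw [← mul_assoc, f11_mul_self]
    · rw [mul_assoc, mul_assoc, f11_mul_self]
  · rintro ⟨h1, h2⟩
    refine ⟨x, ?_⟩
    simp only [LinearMap.comp_apply, LinearMap.mulLeft_apply, LinearMap.mulRight_apply]
    rw [h2, h1]

theorem bElt_mem_corner (mu : MPart ℓ n) : bElt K mu ∈ corner K ℓ n :=
  mem_corner.2 ⟨f11_mul_bElt mu, bElt_mul_f11 mu⟩

/-- Elements of the corner have the form `ψ_{w₀} h ψ_{w₀} y^δ`. -/
theorem eq_of_mem_corner {x : Alg K ℓ n} (hx : x ∈ corner K ℓ n) :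
    x = psiLong K ℓ n * (yStair K ℓ n * x) * psiLong K ℓ n * yStair K ℓ n := by
  obtain ⟨h1, h2⟩ := mem_corner.1 hx
  have : x = f11 K ℓ n * x * f11 K ℓ n := by rw [h1, h2]
  nth_rw 1 [this]
  rw [f11_eq]
  simp only [smul_mul_assoc, mul_smul_comm, smul_smul, sgn_mul_sgn, one_smul, mul_assoc]

theorem mem_span_bElt {x : Alg K ℓ n} (hx : x ∈ corner K ℓ n) :
    x ∈ Submodule.span K (Set.range (bElt K (ℓ := ℓ) (n := n))) := by
  rw [eq_of_mem_corner hx]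
  have := psiLong_mul_mul_psiLong_mem (yStair K ℓ n * x)
  generalize psiLong K ℓ n * (yStair K ℓ n * x) * psiLong K ℓ n = t at this
  induction this using Submodule.span_induction with
  | mem t h =>
    obtain ⟨a, rfl⟩ := h
    have h2 := tElt_mem_span (K := K) (ℓ := ℓ) a
    generalize tElt K ℓ a = t at h2
    induction h2 using Submodule.span_induction with
    | mem t h => obtain ⟨mu, -, rfl⟩ := h; exact Submodule.subset_span ⟨mu, rfl⟩
    | zero => rw [zero_mul]; exact Submodule.zero_mem _
    | add a b _ _ ha hb => rw [add_mul]; exact Submodule.add_mem _ ha hb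
    | smul c a _ ha => rw [smul_mul_assoc]; exact Submodule.smul_mem _ _ ha
  | zero => rw [zero_mul]; exact Submodule.zero_mem _
  | add a b _ _ ha hb => rw [add_mul]; exact Submodule.add_mem _ ha hb
  | smul c a _ ha => rw [smul_mul_assoc]; exact Submodule.smul_mem _ _ ha

theorem corner_eq_span :
    Submodule.span K (Set.range (bElt K (ℓ := ℓ) (n := n))) = corner K ℓ n := by
  apply le_antisymm
  · rw [Submodule.span_le]
    rintro _ ⟨mu, rfl⟩
    exact bElt_mem_corner mu
  · exact fun x hx => mem_span_bElt hx

theorem linearIndependent_bElt : LinearIndependent K (bElt K (ℓ := ℓ) (n := n)) := by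
  -- Right multiplication by ±ψ_{w₀} undoes the factor y^δ, because ψ_{w₀} y^δ ψ_{w₀} = ±ψ_{w₀}.
  apply LinearIndependent.of_comp (sgn K n • LinearMap.mulRight K (psiLong K ℓ n))
  have : ⇑(sgn K n • LinearMap.mulRight K (psiLong K ℓ n)) ∘ bElt K (ℓ := ℓ) (n := n) =
      fun mu : MPart ℓ n => tElt K ℓ (expo mu) := by
    funext mu
    rw [Function.comp_apply, LinearMap.smul_apply, LinearMap.mulRight_apply, bElt_eq,
      mul_assoc, tElt, mul_assoc _ (psiLong K ℓ n), ← mul_assoc (psiLong K ℓ n) (yStair K ℓ n),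
      psiLong_yStair_psiLong, mul_smul_comm, smul_smul, sgn_mul_sgn, one_smul]
  rw [this]
  exact linearIndependent_tElt

/-- The basis `b_μ` of the corner. -/
def cornerBasis (K : Type u) [Field K] (ℓ n : ℕ) : Module.Basis (MPart ℓ n) K (corner K ℓ n) :=
  (Module.Basis.span (linearIndependent_bElt (K := K) (ℓ := ℓ) (n := n))).map
    (LinearEquiv.ofEq _ _ corner_eq_span)

theorem cornerBasis_apply (mu : MPart ℓ n) :
    (cornerBasis K ℓ n mu : Alg K ℓ n) = bElt K mu := by
  rw [cornerBasis, Module.Basis.map_apply, LinearEquiv.coe_ofEq_apply, Module.Basis.span_apply]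

/-- For A and B in ψ_{w₀} H ψ_{w₀}, the product A y^δ B lies there too, so it is fixed by `star`,
which on the other hand turns it into B y^δ A. -/
theorem corner_mul_comm {x z : Alg K ℓ n} (hx : x ∈ corner K ℓ n) (hz : z ∈ corner K ℓ n) :
    x * z = z * x := by
  have key : ∀ a b : Alg K ℓ n, psiLong K ℓ n * a * psiLong K ℓ n * yStair K ℓ n *
      (psiLong K ℓ n * b * psiLong K ℓ n) = psiLong K ℓ n * b * psiLong K ℓ n * yStair K ℓ n *
      (psiLong K ℓ n * a * psiLong K ℓ n) := by
    intro a b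
    have h := star_psiLong_mul_mul_psiLong
      (a * psiLong K ℓ n * yStair K ℓ n * psiLong K ℓ n * b)
    have e1 : psiLong K ℓ n * (a * psiLong K ℓ n * yStair K ℓ n * psiLong K ℓ n * b) *
        psiLong K ℓ n = psiLong K ℓ n * a * psiLong K ℓ n * yStair K ℓ n *
          (psiLong K ℓ n * b * psiLong K ℓ n) := by simp only [mul_assoc]
    rw [e1] at h
    rw [← h, star_mul _ (psiLong K ℓ n * b * psiLong K ℓ n), star_mul _ (yStair K ℓ n),
      star_psiLong_mul_mul_psiLong, star_psiLong_mul_mul_psiLong, yStair, star_yMonomial, ← yStair]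
    simp only [mul_assoc]
  have e := key (yStair K ℓ n * x) (yStair K ℓ n * z)
  rw [eq_of_mem_corner hx, eq_of_mem_corner hz, ← mul_assoc, e, mul_assoc]

theorem mul_mem_corner {x z : Alg K ℓ n} (hx : x ∈ corner K ℓ n) (hz : z ∈ corner K ℓ n) :
    x * z ∈ corner K ℓ n := by
  rw [mem_corner] at *
  exact ⟨by rw [← mul_assoc, hx.1], by rw [mul_assoc, hz.2]⟩

/-- The two-sided ideal generated by `ψ_{w₀}` is everything. -/
theorem exists_one_eq_sum_psiLong : ∃ (m : ℕ) (a b : Fin m → Alg K ℓ n),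
    1 = ∑ i, a i * psiLong K ℓ n * b i := by
  set S := Submodule.span K {x : Alg K ℓ n | ∃ a b, x = a * psiLong K ℓ n * b} with hS
  have h1 : (1 : Alg K ℓ n) ∈ S := by
    refine isFamily.one_mem_of_longest_mem S.toAddSubgroup ?_ ?_ (le_refl (n - 1)) ?_
    · intro a x hx
      change x ∈ S at hx
      change a * x ∈ S
      induction hx using Submodule.span_induction with
      | mem x h =>
        obtain ⟨c, d, rfl⟩ := h
        exact Submodule.subset_span ⟨a * c, d, by simp only [mul_assoc]⟩
      | zero => rw [mul_zero]; exact S.zero_mem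
      | add a b _ _ ha hb => rw [mul_add]; exact S.add_mem ha hb
      | smul c a _ ha => rw [mul_smul_comm]; exact S.smul_mem _ ha
    · intro a x hx
      change x ∈ S at hx
      change x * a ∈ S
      induction hx using Submodule.span_induction with
      | mem x h =>
        obtain ⟨c, d, rfl⟩ := h
        exact Submodule.subset_span ⟨c, d * a, by simp only [mul_assoc]⟩
      | zero => rw [zero_mul]; exact S.zero_mem
      | add a b _ _ ha hb => rw [add_mul]; exact S.add_mem ha hb
      | smul c a _ ha => rw [smul_mul_assoc]; exact S.smul_mem _ ha
    · rw [← psiLong_eq]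
      exact Submodule.subset_span ⟨1, 1, by simp⟩
  rw [hS, Submodule.mem_span_set'] at h1
  obtain ⟨m, c, g, h⟩ := h1
  choose a b hab using fun i => (g i).2
  refine ⟨m, fun i => c i • a i, b, ?_⟩
  rw [← h]
  refine Finset.sum_congr rfl fun i _ => ?_
  rw [hab, smul_mul_assoc, smul_mul_assoc]

/-- The idempotent `𝔣_{1,1}` is full. -/
theorem exists_one_eq_sum_f11 : ∃ (m : ℕ) (a b : Fin m → Alg K ℓ n),
    1 = ∑ i, a i * f11 K ℓ n * b i := by
  obtain ⟨m, a, b, h⟩ := exists_one_eq_sum_psiLong (K := K) (ℓ := ℓ) (n := n)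
  refine ⟨m, a, fun i => psiLong K ℓ n * b i, ?_⟩
  rw [h]
  refine Finset.sum_congr rfl fun i _ => ?_
  rw [mul_assoc, mul_assoc, ← mul_assoc (f11 K ℓ n), f11_mul_psiLong]

theorem eq_zero_of_central_mul_f11 {z : Alg K ℓ n} (hz : z ∈ Subalgebra.center K (Alg K ℓ n))
    (h : z * f11 K ℓ n = 0) : z = 0 := by
  obtain ⟨m, a, b, hab⟩ := exists_one_eq_sum_f11 (K := K) (ℓ := ℓ) (n := n)
  rw [← mul_one z, hab, Finset.mul_sum]
  refine Finset.sum_eq_zero fun i _ => ?_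
  have hc := Subalgebra.mem_center_iff.1 hz
  rw [← mul_assoc, ← mul_assoc, ← hc (a i), mul_assoc (a i), h, mul_zero, zero_mul]

/-- From 1 = ∑ a_i e b_i, with e the idempotent, the central lift of r is ∑ a_i r b_i; both
centrality and the value on e use that the corner is commutative. -/
theorem exists_central_mul_f11 {r : Alg K ℓ n} (hr : r ∈ corner K ℓ n) :
    ∃ z ∈ Subalgebra.center K (Alg K ℓ n), z * f11 K ℓ n = r := by
  obtain ⟨m, a, b, hab⟩ := exists_one_eq_sum_f11 (K := K) (ℓ := ℓ) (n := n)
  obtain ⟨h1, h2⟩ := mem_corner.1 hr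
  have hcorner : ∀ h, f11 K ℓ n * h * f11 K ℓ n ∈ corner K ℓ n := fun h => ⟨h, by
    simp [mul_assoc]⟩
  -- A second copy of 1 = ∑ a_j e b_j is put in front, and r is moved to the left of e b_j h a_i e
  -- inside the corner; summing over i afterwards gives 1 again.
  have key : ∀ h, ∑ i, h * (a i * r * b i) = ∑ i, ∑ j, a j * r * b j * h * a i * f11 K ℓ n * b i := by
    intro h
    refine Finset.sum_congr rfl fun i _ => ?_
    calc h * (a i * r * b i) = 1 * (h * (a i * r * b i)) := by rw [one_mul]
      _ = ∑ j, a j * (f11 K ℓ n * (b j * h * a i) * f11 K ℓ n * r) * b i := by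
        rw [hab, Finset.sum_mul]
        refine Finset.sum_congr rfl fun j _ => ?_
        rw [mul_assoc _ (f11 K ℓ n) r, h1]
        simp only [mul_assoc]
      _ = _ := by
        refine Finset.sum_congr rfl fun j _ => ?_
        rw [corner_mul_comm (hcorner _) hr]
        simp only [← mul_assoc]
        rw [mul_assoc (a j) r, h2]
  refine ⟨∑ i, a i * r * b i, ?_, ?_⟩
  · rw [Subalgebra.mem_center_iff]
    intro h
    rw [Finset.mul_sum, key, Finset.sum_comm]
    calc _ = ∑ j, a j * r * b j * h * ∑ i, a i * f11 K ℓ n * b i := by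
          refine Finset.sum_congr rfl fun j _ => ?_
          rw [Finset.mul_sum]
          refine Finset.sum_congr rfl fun i _ => ?_
          simp only [mul_assoc]
      _ = _ := by rw [← hab, Finset.sum_mul]; simp only [mul_one]
  · rw [Finset.sum_mul]
    calc _ = ∑ i, a i * (f11 K ℓ n * b i * f11 K ℓ n * r) := by
          refine Finset.sum_congr rfl fun i _ => ?_
          rw [corner_mul_comm (hcorner _) hr, ← mul_assoc r, ← mul_assoc r, h2]
          simp only [mul_assoc]
      _ = (∑ i, a i * f11 K ℓ n * b i) * (f11 K ℓ n * r) := by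
          rw [Finset.sum_mul]
          refine Finset.sum_congr rfl fun i _ => ?_
          simp only [mul_assoc]
      _ = r := by rw [← hab, one_mul, h1]

theorem central_mul_f11_mem {z : Alg K ℓ n} (hz : z ∈ Subalgebra.center K (Alg K ℓ n)) :
    z * f11 K ℓ n ∈ corner K ℓ n := by
  rw [mem_corner]
  have hc := Subalgebra.mem_center_iff.1 hz
  exact ⟨by rw [← mul_assoc, hc, mul_assoc, f11_mul_self], by rw [mul_assoc, f11_mul_self]⟩

/-- The center is isomorphic to the corner as a vector space. -/
def centerEquivCorner : Subalgebra.center K (Alg K ℓ n) ≃ₗ[K] corner K ℓ n :=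
  LinearEquiv.ofBijective
    (((LinearMap.mulRight K (f11 K ℓ n)).comp (Subalgebra.center K (Alg K ℓ n)).val.toLinearMap
      ).codRestrict (corner K ℓ n) fun z => central_mul_f11_mem z.2) <| by
    constructor
    · rw [injective_iff_map_eq_zero]
      intro z hz
      exact Subtype.ext (eq_zero_of_central_mul_f11 z.2 (congrArg Subtype.val hz))
    · intro r
      obtain ⟨z, hz, h⟩ := exists_central_mul_f11 r.2
      exact ⟨⟨z, hz⟩, Subtype.ext h⟩

theorem card_mPart : Fintype.card (MPart ℓ n) = ℓ.choose n := by
  have := Fintype.card_finset_len (α := Fin ℓ) n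
  rw [Fintype.card_fin] at this
  rw [← this]
  exact Fintype.card_congr (Equiv.refl _)

theorem finite_center : Module.Finite K (Subalgebra.center K (Alg K ℓ n)) :=
  Module.Finite.of_basis ((cornerBasis K ℓ n).map centerEquivCorner.symm)

theorem finrank_center : Module.finrank K (Subalgebra.center K (Alg K ℓ n)) = ℓ.choose n := by
  rw [Module.finrank_eq_card_basis ((cornerBasis K ℓ n).map centerEquivCorner.symm), card_mPart]

end Corner

/-! ### The ideal `H^{>λ_min}` -/

section Higher

variable {K : Type u} [Field K] {ℓ n : ℕ} (hn : n ≤ ℓ)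

theorem theta_lamMin (i : Fin n) : (theta (lamMin hn) i).val = ℓ - n + i.val := by
  have hm : StrictMono fun i : Fin n => (⟨ℓ - n + i.val, by omega⟩ : Fin ℓ) := by
    intro i j hij
    have : i.val < j.val := hij
    rw [Fin.mk_lt_mk]; omega
  have := Finset.orderEmbOfFin_unique (s := (lamMin hn).1) (k := n) (lamMin hn).2
      (fun i => Finset.mem_map.2 ⟨i, Finset.mem_univ i, rfl⟩) hm
  exact congrArg Fin.val (congrFun this i).symm

theorem expo_lamMin : expo (lamMin hn) = fun i : Fin n => n - 1 - i.val := by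
  funext i
  have := i.2
  rw [expo, theta_lamMin]; omega

theorem yPart_lamMin : yPart K (lamMin hn) = yStair K ℓ n := by
  rw [yPart, expo_lamMin]; rfl

theorem le_of_strictAnti {a : Fin n → ℕ} (ha : StrictAnti a) (i : Fin n) : n - 1 - i.val ≤ a i := by
  have : ∀ k, ∀ i : Fin n, n - 1 - i.val = k → k ≤ a i := by
    intro k
    induction k with
    | zero => intro i _; exact Nat.zero_le _
    | succ k ih =>
      intro i hi
      have h1 := ih ⟨i.val + 1, by omega⟩ (by simp only; omega)
      have h2 := ha (show i < ⟨i.val + 1, by omega⟩ from Fin.mk_lt_mk.2 (Nat.lt_succ_self _))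
      omega
  exact this _ i rfl

/-- Strictly decreasing exponents are bounded below by the staircase, entry by entry. So λ_min is
the least element, and H^{>λ_min} is generated by all the other y_μ. -/
theorem dominates_lamMin {mu : MPart ℓ n} (h : mu ≠ lamMin hn) : Dominates mu (lamMin hn) := by
  refine ⟨fun i => ?_, h⟩
  have h1 := le_of_strictAnti (expo_strictAnti mu) i
  rw [Fin.le_def, theta_lamMin]
  have := (theta mu i).2
  simp only [expo] at h1
  have := i.2
  omega

theorem sum_expo_lt {mu : MPart ℓ n} (h : mu ≠ lamMin hn) :
    ∑ i, expo (lamMin hn) i < ∑ i, expo mu i := by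
  have hle : ∀ i, expo (lamMin hn) i ≤ expo mu i := by
    intro i; rw [expo_lamMin]; exact le_of_strictAnti (expo_strictAnti mu) i
  refine lt_of_le_of_ne (Finset.sum_le_sum fun i _ => hle i) fun e => h ?_
  have := (Finset.sum_eq_sum_iff_of_le fun i _ => hle i).1 e
  exact (expo_injective (funext fun i => this i (Finset.mem_univ i))).symm

theorem mul_mem_higher {mu : MPart ℓ n} (a : Alg K ℓ n) {x : Alg K ℓ n} (hx : x ∈ higher K mu) :
    a * x ∈ higher K mu := by
  induction hx using Submodule.span_induction with
  | mem x h =>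
    obtain ⟨lam, h, hd, rfl⟩ := h
    exact Submodule.subset_span ⟨lam, a * h, hd, by rw [mul_assoc]⟩
  | zero => rw [mul_zero]; exact Submodule.zero_mem _
  | add a b _ _ ha hb => rw [mul_add]; exact Submodule.add_mem _ ha hb
  | smul c x _ hx =>
    rw [← op_unop c, op_smul_eq_mul, ← mul_assoc, ← op_smul_eq_mul]
    exact Submodule.smul_mem _ _ hx

theorem higher_mul_mem {mu : MPart ℓ n} (a : Alg K ℓ n) {x : Alg K ℓ n} (hx : x ∈ higher K mu) :
    x * a ∈ higher K mu := by
  rw [← op_smul_eq_mul]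
  exact Submodule.smul_mem _ _ hx

theorem smul_mem_higher {mu : MPart ℓ n} (c : K) {x : Alg K ℓ n} (hx : x ∈ higher K mu) :
    c • x ∈ higher K mu := by
  rw [← one_mul x, ← smul_mul_assoc]
  exact mul_mem_higher _ hx

theorem tElt_mem_higher {mu : MPart ℓ n} (h : mu ≠ lamMin hn) :
    tElt K ℓ (expo mu) ∈ higher K (lamMin hn) :=
  higher_mul_mem _ (Submodule.subset_span ⟨mu, _, dominates_lamMin hn h, rfl⟩)

/-- The span of the `ψ_{w₀} y_μ ψ_{w₀}` with `μ ≠ λ_min`. -/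
def tSpan (K : Type u) [Field K] : Submodule K (Alg K ℓ n) :=
  Submodule.span K ((fun mu : MPart ℓ n => tElt K ℓ (expo mu)) '' {mu | mu ≠ lamMin hn})

theorem tElt_mem_tSpan {a : Fin n → ℕ} (ha : ∑ i, expo (lamMin hn) i < ∑ i, a i) :
    tElt K ℓ a ∈ tSpan hn K := by
  have h1 : ∀ mu : MPart ℓ n, ∑ i, expo mu i = ∑ i, a i → tElt K ℓ (expo mu) ∈ tSpan hn K :=
    fun mu h => Submodule.subset_span ⟨mu, by rintro rfl; omega, rfl⟩
  rcases tElt_eq (K := K) (ℓ := ℓ) a with h | ⟨mu, hmu, h | h⟩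
  · rw [h]; exact Submodule.zero_mem _
  · rw [h]; exact h1 mu hmu
  · rw [h]; exact Submodule.neg_mem _ (h1 mu hmu)

theorem tSpan_le_higher {x : Alg K ℓ n} (hx : x ∈ tSpan hn K) : x ∈ higher K (lamMin hn) := by
  induction hx using Submodule.span_induction with
  | mem x h => obtain ⟨mu, hmu, rfl⟩ := h; exact tElt_mem_higher hn hmu
  | zero => exact Submodule.zero_mem _
  | add a b _ _ ha hb => exact Submodule.add_mem _ ha hb
  | smul c a _ ha => exact smul_mem_higher c ha

/-- If `deg y^a` is large, then `ψ_{w₀} H y^a H ψ_{w₀}` is contained in `tSpan`. -/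
theorem psiLong_mul_yMonomial_mem {a : Fin n → ℕ} (ha : ∑ i, expo (lamMin hn) i < ∑ i, a i)
    (h h' : Alg K ℓ n) :
    psiLong K ℓ n * h * yMonomial K ℓ a * (h' * psiLong K ℓ n) ∈ tSpan hn K := by
  have h1 := psiLong_mul_mem h
  have h2 := mul_psiLong_mem h'
  generalize psiLong K ℓ n * h = p at h1
  generalize h' * psiLong K ℓ n = q at h2
  induction h1 using Submodule.span_induction with
  | mem x h =>
    obtain ⟨b, rfl⟩ := h
    induction h2 using Submodule.span_induction with
    | mem x h =>
      obtain ⟨c, rfl⟩ := h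
      have : psiLong K ℓ n * yMonomial K ℓ b * yMonomial K ℓ a * (yMonomial K ℓ c * psiLong K ℓ n)
          = tElt K ℓ (b + a + c) := by
        rw [tElt, yMonomial_add, yMonomial_add]; simp only [mul_assoc]
      simp only [this]
      apply tElt_mem_tSpan
      simp only [Pi.add_apply, Finset.sum_add_distrib]; omega
    | zero => rw [mul_zero]; exact Submodule.zero_mem _
    | add a b _ _ ha hb => rw [mul_add]; exact Submodule.add_mem _ ha hb
    | smul c a _ ha => rw [mul_smul_comm]; exact Submodule.smul_mem _ _ ha
  | zero => rw [zero_mul, zero_mul]; exact Submodule.zero_mem _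
  | add a b _ _ ha hb => rw [add_mul, add_mul]; exact Submodule.add_mem _ ha hb
  | smul c a _ ha => rw [smul_mul_assoc, smul_mul_assoc]; exact Submodule.smul_mem _ _ ha

/-- Sandwiching between two copies of ψ_{w₀} turns membership in the ideal into membership in a span
of basis elements, where linear independence decides. -/
theorem psiLong_mul_higher_mem {x : Alg K ℓ n} (hx : x ∈ higher K (lamMin hn)) (h : Alg K ℓ n) :
    psiLong K ℓ n * x * (h * psiLong K ℓ n) ∈ tSpan hn K := by
  induction hx using Submodule.span_induction generalizing h with
  | mem x hx =>
    obtain ⟨lam, h', hd, rfl⟩ := hx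
    rw [← mul_assoc (psiLong K ℓ n)]
    exact psiLong_mul_yMonomial_mem hn (sum_expo_lt hn hd.2) h' h
  | zero => rw [mul_zero, zero_mul]; exact Submodule.zero_mem _
  | add a b _ _ ha hb => rw [mul_add, add_mul]; exact Submodule.add_mem _ (ha h) (hb h)
  | smul c x _ hx =>
    have := hx (unop c * h)
    rw [← op_unop c, op_smul_eq_mul]
    simpa only [mul_assoc] using this

theorem tElt_lamMin : tElt K ℓ (expo (lamMin hn)) = sgn K n • psiLong K ℓ n := by
  rw [tElt, ← psiLong_yStair_psiLong, ← yPart_lamMin hn]; rfl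

theorem psiLong_notMem_tSpan : psiLong K ℓ n ∉ tSpan hn K := by
  intro h
  have h2 := (tSpan hn K).smul_mem (sgn K n) h
  rw [← tElt_lamMin hn] at h2
  exact linearIndependent_tElt.notMem_span_image (s := {mu : MPart ℓ n | mu ≠ lamMin hn})
    (x := lamMin hn) (by simp) h2

/-- The ideal `H^{>λ_min}` is proper. -/
theorem yStair_psiLong_yStair_notMem_higher :
    yStair K ℓ n * psiLong K ℓ n * yStair K ℓ n ∉ higher K (lamMin hn) := by
  intro h
  have h1 := psiLong_mul_higher_mem hn h 1
  have : psiLong K ℓ n * (yStair K ℓ n * psiLong K ℓ n * yStair K ℓ n) * (1 * psiLong K ℓ n)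
      = psiLong K ℓ n := by
    rw [one_mul, ← mul_assoc, ← mul_assoc, psiLong_yStair_psiLong, smul_mul_assoc, smul_mul_assoc,
      psiLong_yStair_psiLong, smul_smul, sgn_mul_sgn, one_smul]
  rw [this] at h1
  exact psiLong_notMem_tSpan hn h1

/-- Since ψ_{w₀} generates the unit ideal, y^a can be surrounded by copies of ψ_{w₀}; the sandwiched
elements are combinations of ψ_{w₀} y_μ ψ_{w₀} with μ ≠ λ_min, because straightening preserves the
degree. -/
theorem yMonomial_mem_higher {a : Fin n → ℕ} (ha : ∑ i, expo (lamMin hn) i < ∑ i, a i) :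
    yMonomial K ℓ a ∈ higher K (lamMin hn) := by
  obtain ⟨m, c, d, h⟩ := exists_one_eq_sum_psiLong (K := K) (ℓ := ℓ) (n := n)
  have : yMonomial K ℓ a = ∑ i, ∑ j, c i * (psiLong K ℓ n * d i * yMonomial K ℓ a *
      (c j * psiLong K ℓ n)) * d j := by
    calc yMonomial K ℓ a = (∑ i, c i * psiLong K ℓ n * d i) * yMonomial K ℓ a *
          (∑ i, c i * psiLong K ℓ n * d i) := by rw [← h, one_mul, mul_one]
      _ = _ := by
        simp only [Finset.sum_mul, Finset.mul_sum]
        rw [Finset.sum_comm]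
        simp only [mul_assoc]
  rw [this]
  refine Submodule.sum_mem _ fun i _ => Submodule.sum_mem _ fun j _ => ?_
  exact higher_mul_mem _ (mul_mem_higher _ (tSpan_le_higher hn (psiLong_mul_yMonomial_mem hn ha _ _)))

theorem sum_stair (n : ℕ) : 2 * ∑ i : Fin n, (n - 1 - i.val) = (n - 1) * n := by
  rw [Fin.sum_univ_eq_sum_range (fun i => n - 1 - i) n, Finset.sum_range_reflect (fun i => i) n,
    mul_comm, Finset.sum_range_id_mul_two, mul_comm]

theorem yStair_mem_grade : yStair K ℓ n ∈ grade K ℓ n (((n - 1) * n : ℕ) : ℤ) := by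
  have := yMonomial_mem_grade (K := K) (ℓ := ℓ) (fun i : Fin n => n - 1 - i.val)
  rw [← sum_stair]
  push_cast
  exact_mod_cast this

theorem psiLong_mul_yStair_mem_grade : psiLong K ℓ n * yStair K ℓ n ∈ grade K ℓ n 0 := by
  have := mul_mem_grade (psiLong_mem_grade (K := K) (ℓ := ℓ) (n := n)) yStair_mem_grade
  rwa [neg_add_cancel] at this

theorem f11_mem_grade : f11 K ℓ n ∈ grade K ℓ n 0 := by
  rw [f11_eq]
  exact Submodule.smul_mem _ _ psiLong_mul_yStair_mem_grade

/-- Modulo `H^{>λ_min}`, the element `y^δ ψ_{w₀} y^δ` is a nonzero multiple of `y^δ`. -/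
theorem exists_yStair_mul_f11 : ∃ c : K, c ≠ 0 ∧
    yStair K ℓ n * f11 K ℓ n - c • yStair K ℓ n ∈ higher K (lamMin hn) := by
  -- The idempotent has degree 0, so it is a scalar c plus terms y_s h_s; the terms y^δ y_s h_s have
  -- too many y's and lie in the ideal. If c were 0, y^δ ψ_{w₀} y^δ would lie in it as well.
  obtain ⟨c, h, e⟩ := exists_smul_one_add (f11_mem_grade (K := K) (ℓ := ℓ) (n := n))
  have key : yStair K ℓ n * f11 K ℓ n - c • yStair K ℓ n ∈ higher K (lamMin hn) := by
    rw [e, mul_add, mul_smul_comm, mul_one, add_sub_cancel_left, Finset.mul_sum]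
    refine Submodule.sum_mem _ fun s _ => ?_
    rw [← mul_assoc]
    refine higher_mul_mem _ ?_
    rw [yStair, ← pow_one (y K ℓ s), ← yMonomial_single, ← yMonomial_add]
    apply yMonomial_mem_higher
    rw [expo_lamMin]
    simp only [Pi.add_apply, Finset.sum_add_distrib]
    have : ∑ i, (Pi.single s 1 : Fin n → ℕ) i = 1 := by simp
    omega
  refine ⟨c, ?_, key⟩
  rintro rfl
  rw [zero_smul, sub_zero, f11_eq] at key
  apply yStair_psiLong_yStair_notMem_higher (K := K) hn
  have := smul_mem_higher (sgn K n) key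
  rwa [mul_smul_comm, smul_smul, sgn_mul_sgn, one_smul, ← mul_assoc] at this

theorem bElt_lamMin : bElt K (lamMin hn) = f11 K ℓ n := by
  rw [f11_eq', bElt, yPart_lamMin]

theorem bElt_mem_higher {mu : MPart ℓ n} (h : mu ≠ lamMin hn) :
    bElt K mu ∈ higher K (lamMin hn) :=
  higher_mul_mem _ (tElt_mem_higher hn h)

/-- The corner is spanned by `𝔣_{1,1}` modulo `H^{>λ_min}`. -/
theorem exists_sub_mem_higher {x : Alg K ℓ n} (hx : x ∈ corner K ℓ n) :
    ∃ c : K, x - c • f11 K ℓ n ∈ higher K (lamMin hn) := by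
  have := mem_span_bElt hx
  induction this using Submodule.span_induction with
  | mem x h =>
    obtain ⟨mu, rfl⟩ := h
    by_cases hmu : mu = lamMin hn
    · subst hmu
      refine ⟨1, ?_⟩
      rw [bElt_lamMin, one_smul, sub_self]; exact Submodule.zero_mem _
    · exact ⟨0, by rw [zero_smul, sub_zero]; exact bElt_mem_higher hn hmu⟩
  | zero => exact ⟨0, by rw [zero_smul, sub_zero]; exact Submodule.zero_mem _⟩
  | add a b ha' hb' ha hb =>
    rw [corner_eq_span] at ha' hb'
    obtain ⟨c, hc⟩ := ha ha'
    obtain ⟨d, hd⟩ := hb hb'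
    refine ⟨c + d, ?_⟩
    rw [add_smul, add_sub_add_comm]
    exact Submodule.add_mem _ hc hd
  | smul t a ha' ha =>
    rw [corner_eq_span] at ha'
    obtain ⟨c, hc⟩ := ha ha'
    refine ⟨t * c, ?_⟩
    rw [mul_smul, ← smul_sub]
    exact smul_mem_higher _ hc

theorem bElt_mem_grade (mu : MPart ℓ n) :
    bElt K mu ∈ grade K ℓ n (2 * (∑ i, (expo mu i : ℤ)) - 2 * ∑ i, (expo (lamMin hn) i : ℤ)) := by
  have h1 := mul_mem_grade (mul_mem_grade (psiLong_mem_grade (K := K) (ℓ := ℓ) (n := n))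
    (yMonomial_mem_grade (expo mu))) (psiLong_mul_yStair_mem_grade)
  rw [← mul_assoc] at h1
  have e : 2 * (∑ i, (expo mu i : ℤ)) - 2 * ∑ i, (expo (lamMin hn) i : ℤ) =
      -(((n - 1) * n : ℕ) : ℤ) + 2 * ∑ i, (expo mu i : ℤ) + 0 := by
    rw [← sum_stair, expo_lamMin, Nat.cast_mul, Nat.cast_sum]
    push_cast
    abel
  rw [e]
  exact h1

/-- The span of the elements of degree at least `k`. -/
def fil (K : Type u) [Field K] (ℓ n : ℕ) (k : ℤ) : Submodule K (Alg K ℓ n) :=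
  Submodule.span K {x | ∃ d, k ≤ d ∧ x ∈ grade K ℓ n d}

theorem mul_mem_fil {i j : ℤ} {a b : Alg K ℓ n} (ha : a ∈ fil K ℓ n i) (hb : b ∈ fil K ℓ n j) :
    a * b ∈ fil K ℓ n (i + j) := by
  have := Submodule.mul_mem_mul ha hb
  rw [fil, fil, Submodule.span_mul_span] at this
  refine Submodule.span_mono ?_ this
  rintro _ ⟨_, ⟨d, hd, hx⟩, _, ⟨e, he, hz⟩, rfl⟩
  exact ⟨d + e, add_le_add hd he, mul_mem_grade hx hz⟩

theorem comp_eq_zero_of_mem_fil {k d : ℤ} (hd : d < k) {x : Alg K ℓ n} (hx : x ∈ fil K ℓ n k) :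
    comp d x = 0 := by
  induction hx using Submodule.span_induction with
  | mem x hx =>
    obtain ⟨e, he, hx⟩ := hx
    exact comp_of_mem_ne hx (by omega)
  | zero => exact map_zero _
  | add x z _ _ hx hz => rw [map_add, hx, hz, add_zero]
  | smul c x _ hx => rw [map_smul, hx, smul_zero]

theorem comp_eq_zero_of_mem_corner {x : Alg K ℓ n} (hx : x ∈ corner K ℓ n) {d : ℤ}
    (hd : 2 * ((n : ℤ) * ℓ) < d) : comp d x = 0 := by
  have := mem_span_bElt hx
  clear hx
  induction this using Submodule.span_induction with
  | mem x h =>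
    obtain ⟨mu, rfl⟩ := h
    have hn : n ≤ ℓ := by
      rw [← mu.2]; simpa using Finset.card_le_univ mu.1
    refine comp_of_mem_ne (bElt_mem_grade hn mu) ?_
    have h1 : ∑ i, (expo mu i : ℤ) ≤ ∑ _i : Fin n, (ℓ : ℤ) :=
      Finset.sum_le_sum fun i _ => by have := expo_lt mu i; omega
    have h2 : 0 ≤ ∑ i, (expo (lamMin hn) i : ℤ) := Finset.sum_nonneg fun i _ => by omega
    simp only [Finset.sum_const, Finset.card_univ, Fintype.card_fin, nsmul_eq_mul] at h1
    omega
  | zero => exact map_zero _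
  | add a b _ _ ha hb => rw [map_add, ha, hb, add_zero]
  | smul c a _ ha => rw [map_smul, ha, smul_zero]

/-- Elements of the corner in `H^{>λ_min}` are nilpotent. -/
theorem isNilpotent_of_mem {x : Alg K ℓ n} (hx : x ∈ corner K ℓ n)
    (hx' : x ∈ higher K (lamMin hn)) : IsNilpotent x := by
  -- Such an x is a combination of the b_μ with μ ≠ λ_min, all of positive degree.
  have h1 : x ∈ fil K ℓ n 1 := by
    have h2 := psiLong_mul_higher_mem hn (mul_mem_higher (yStair K ℓ n) hx') 1
    rw [one_mul] at h2
    rw [eq_of_mem_corner hx]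
    generalize psiLong K ℓ n * (yStair K ℓ n * x) * psiLong K ℓ n = t at h2
    induction h2 using Submodule.span_induction with
    | mem t h =>
      obtain ⟨mu, hmu, rfl⟩ := h
      have h3 := sum_expo_lt hn hmu
      refine Submodule.subset_span ⟨_, ?_, bElt_mem_grade hn mu⟩
      have : (∑ i, expo (lamMin hn) i : ℤ) < (∑ i, expo mu i : ℤ) := by exact_mod_cast h3
      omega
    | zero => rw [zero_mul]; exact Submodule.zero_mem _
    | add a b _ _ ha hb => rw [add_mul]; exact Submodule.add_mem _ ha hb
    | smul c a _ ha => rw [smul_mul_assoc]; exact Submodule.smul_mem _ _ ha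
  have hpow : ∀ k : ℕ, x ^ (k + 1) ∈ fil K ℓ n (k + 1 : ℕ) ∧ x ^ (k + 1) ∈ corner K ℓ n := by
    intro k
    induction k with
    | zero => simpa using ⟨h1, hx⟩
    | succ k ih =>
      rw [pow_succ]
      refine ⟨?_, mul_mem_corner ih.2 hx⟩
      have := mul_mem_fil ih.1 h1
      exact_mod_cast this
  -- The corner has no components in degrees above 2nℓ, while this power has none below 2nℓ + 1.
  refine ⟨2 * (n * ℓ) + 1, eq_zero_of_comp fun d => ?_⟩
  by_cases hd : 2 * ((n : ℤ) * ℓ) < d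
  · exact comp_eq_zero_of_mem_corner (hpow _).2 hd
  · exact comp_eq_zero_of_mem_fil (by push_cast; omega) (hpow _).1

/-- If `c ≠ 0`, an element of the corner congruent to `c 𝔣_{1,1}` divides `𝔣_{1,1}` from both
sides. -/
theorem exists_unit_of_sub_mem {x : Alg K ℓ n} (hx : x ∈ corner K ℓ n)
    (h : x - f11 K ℓ n ∈ higher K (lamMin hn)) :
    ∃ z, x * z = f11 K ℓ n ∧ z * x = f11 K ℓ n := by
  have hf : f11 K ℓ n ∈ corner K ℓ n := mem_corner.2 ⟨f11_mul_self, f11_mul_self⟩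
  have hm : x - f11 K ℓ n ∈ corner K ℓ n := Submodule.sub_mem _ hx hf
  -- The unit u = 1 + (x - e) of H satisfies eu = x = ue, where e is the idempotent.
  obtain ⟨u, hu⟩ := (isNilpotent_of_mem hn hm h).isUnit_one_add
  obtain ⟨e1, e2⟩ := mem_corner.1 hm
  have hl : f11 K ℓ n * u = x := by rw [hu, mul_add, mul_one, e1]; abel
  have hr : u * f11 K ℓ n = x := by rw [hu, add_mul, one_mul, e2]; abel
  refine ⟨↑u⁻¹, ?_, ?_⟩
  · rw [← hl, mul_assoc, Units.mul_inv, mul_one]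
  · rw [← hr, ← mul_assoc, Units.inv_mul, one_mul]

end Higher

/-! ### The module `D₀` -/

section DZero

variable {K : Type u} [Field K] {ℓ n : ℕ} (hn : n ≤ ℓ)

theorem smul_dGen_eq_zero_iff {mu : MPart ℓ n} (h : Alg K ℓ n) : op h • dGen K mu = 0 ↔
    ∀ k, yPart K mu * h * (k * yPart K mu) ∈ higher K mu := by
  rw [dGen, ← map_smul, Submodule.mkQ_apply, Submodule.Quotient.mk_eq_zero]
  refine forall_congr' fun k => ?_
  rw [Subtype.ext_iff, Submodule.coe_smul, Submodule.coe_smul, Submodule.coe_zero, ← map_smul,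
    ← map_smul, Submodule.mkQ_apply, Submodule.Quotient.mk_eq_zero, op_smul_eq_mul, op_smul_eq_mul]

theorem smul_dGen_eq_zero {mu : MPart ℓ n} {h : Alg K ℓ n}
    (hh : yPart K mu * h ∈ higher K mu) : op h • dGen K mu = 0 :=
  (smul_dGen_eq_zero_iff h).2 fun _ => higher_mul_mem _ hh

theorem exists_eq_smul_dGen {mu : MPart ℓ n} (d : DMod K mu) :
    ∃ h : Alg K ℓ n, d = op h • dGen K mu := by
  obtain ⟨⟨x, hx⟩, rfl⟩ := (spechtRad K mu).mkQ_surjective d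
  obtain ⟨a, rfl⟩ := Submodule.mem_span_singleton.1 hx
  refine ⟨unop a, ?_⟩
  exact (spechtRad K mu).mkQ.map_smul a
    ⟨(higher K mu).mkQ (yPart K mu), Submodule.subset_span (Set.mem_singleton _)⟩

theorem exists_smul_f11_dGen : ∃ c : K, c ≠ 0 ∧
    op (f11 K ℓ n) • dGen K (lamMin hn) = op (c • (1 : Alg K ℓ n)) • dGen K (lamMin hn) := by
  obtain ⟨c, hc, h⟩ := exists_yStair_mul_f11 (K := K) hn
  refine ⟨c, hc, ?_⟩
  rw [← sub_eq_zero, ← sub_smul, ← op_sub]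
  apply smul_dGen_eq_zero
  rwa [yPart_lamMin, mul_sub, mul_smul_comm, mul_one]

theorem smul_f11_dGen_ne_zero {c : K} (hc : c ≠ 0) :
    op (c • f11 K ℓ n) • dGen K (lamMin hn) ≠ 0 := by
  rw [Ne, smul_dGen_eq_zero_iff]
  intro h
  -- Testing against ψ_{w₀} produces y^δ ψ_{w₀} y^δ, which is known to lie outside the ideal.
  have h1 := h (psiLong K ℓ n)
  rw [yPart_lamMin, mul_smul_comm, smul_mul_assoc] at h1
  have h2 := smul_mem_higher c⁻¹ h1
  rw [smul_smul, inv_mul_cancel₀ hc, one_smul, mul_assoc, ← mul_assoc (f11 K ℓ n), f11_mul_psiLong,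
    ← mul_assoc] at h2
  exact yStair_psiLong_yStair_notMem_higher hn h2

/-- `D₀` is generated by the image of `𝔣_{1,1}`. -/
theorem exists_eq_smul_smul_dGen (d : D0 K hn) :
    ∃ h : Alg K ℓ n, d = op h • op (f11 K ℓ n) • dGen K (lamMin hn) := by
  obtain ⟨h, rfl⟩ := exists_eq_smul_dGen d
  obtain ⟨c, hc, e⟩ := exists_smul_f11_dGen (K := K) hn
  refine ⟨c⁻¹ • h, ?_⟩
  rw [e, smul_smul, ← op_mul, smul_mul_smul_comm, one_mul, mul_inv_cancel₀ hc, one_smul]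

theorem exists_smul_eq_of_mem_corner {x : Alg K ℓ n} (hx : x ∈ corner K ℓ n) : ∃ c : K,
    x - c • f11 K ℓ n ∈ higher K (lamMin hn) ∧
      op x • dGen K (lamMin hn) = op (c • f11 K ℓ n) • dGen K (lamMin hn) := by
  obtain ⟨c, hc⟩ := exists_sub_mem_higher hn hx
  refine ⟨c, hc, ?_⟩
  rw [← sub_eq_zero, ← sub_smul, ← op_sub]
  exact smul_dGen_eq_zero (mul_mem_higher _ hc)

theorem sub_f11_mem_higher {x : Alg K ℓ n} (hx : x ∈ corner K ℓ n)
    (h : op x • dGen K (lamMin hn) = op (f11 K ℓ n) • dGen K (lamMin hn)) :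
    x - f11 K ℓ n ∈ higher K (lamMin hn) := by
  obtain ⟨c, hc, e⟩ := exists_smul_eq_of_mem_corner hn hx
  by_cases h1 : c = 1
  · rwa [h1, one_smul] at hc
  · exfalso
    apply smul_f11_dGen_ne_zero (K := K) hn (sub_ne_zero.2 h1)
    rw [sub_smul, op_sub, sub_smul, ← e, h, one_smul, sub_self]

/-- `D₀ 𝔣_{1,1}` is one-dimensional. -/
theorem exists_smul_f11 (d : D0 K hn) :
    ∃ t : K, op (f11 K ℓ n) • d = op (t • f11 K ℓ n) • dGen K (lamMin hn) := by
  obtain ⟨h, rfl⟩ := exists_eq_smul_smul_dGen hn d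
  have hm : f11 K ℓ n * h * f11 K ℓ n ∈ corner K ℓ n := ⟨h, by simp [mul_assoc]⟩
  obtain ⟨c, -, e⟩ := exists_smul_eq_of_mem_corner hn hm
  refine ⟨c, ?_⟩
  rw [← e, smul_smul, smul_smul, ← op_mul, ← op_mul, mul_assoc]

end DZero

/-! ### Existence of the projective cover -/

section Cover

variable {K : Type u} [Field K] {ℓ n : ℕ} (hn : n ≤ ℓ)

/-- The right ideal `𝔣_{1,1} H`. -/
def rightIdeal (K : Type u) [Field K] (ℓ n : ℕ) : Submodule (Alg K ℓ n)ᵐᵒᵖ (Alg K ℓ n) where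
  carrier := {x | f11 K ℓ n * x = x}
  add_mem' {a b} ha hb := by
    change _ = _ at ha hb ⊢
    rw [mul_add, ha, hb]
  zero_mem' := mul_zero _
  smul_mem' c x hx := by
    change _ = _ at hx ⊢
    rw [← op_unop c, op_smul_eq_mul, ← mul_assoc, hx]

/-- The grading of `𝔣_{1,1} H`, shifted so that `𝔣_{1,1}` has the degree of `y_{λ_min}`. -/
def coverGrade {ℓ n : ℕ} (hn : n ≤ ℓ) (K : Type u) [Field K] (d : ℤ) : Submodule K (rightIdeal K ℓ n) where
  carrier := {x | (x : Alg K ℓ n) ∈ grade K ℓ n (d - ∑ i, (expo (lamMin hn) i : ℤ))}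
  add_mem' ha hb := (grade K ℓ n _).add_mem ha hb
  zero_mem' := (grade K ℓ n _).zero_mem
  smul_mem' c _ hx := (grade K ℓ n _).smul_mem c hx

/-- The projection `𝔣_{1,1} H → D₀`. -/
def coverMap (K : Type u) [Field K] : rightIdeal K ℓ n →ₗ[(Alg K ℓ n)ᵐᵒᵖ] D0 K hn where
  toFun x := op (x : Alg K ℓ n) • dGen K (lamMin hn)
  map_add' x z := by rw [Submodule.coe_add, op_add, add_smul]
  map_smul' a x := by
    rw [RingHom.id_apply, Submodule.coe_smul, smul_smul, ← op_unop a, op_smul_eq_mul, op_mul]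

theorem coverMap_apply (x : rightIdeal K ℓ n) :
    coverMap hn K x = op (x : Alg K ℓ n) • dGen K (lamMin hn) := rfl

/-- The generator `𝔣_{1,1}` of the right ideal. -/
def coverGen (K : Type u) [Field K] (ℓ n : ℕ) : rightIdeal K ℓ n := ⟨f11 K ℓ n, f11_mul_self⟩

theorem f11_mul_coe (x : rightIdeal K ℓ n) : f11 K ℓ n * (x : Alg K ℓ n) = x := x.2

theorem isInternal_coverGrade : DirectSum.IsInternal (coverGrade hn K) := by
  set s := ∑ i, (expo (lamMin hn) i : ℤ) with hs
  rw [DirectSum.isInternal_submodule_iff_iSupIndep_and_iSup_eq_top]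
  constructor
  · intro i
    rw [Submodule.disjoint_def]
    intro x hx hx'
    have : ∀ x ∈ ⨆ j, ⨆ (_ : j ≠ i), coverGrade hn K j,
        comp (i - s) (x : Alg K ℓ n) = 0 := by
      intro x hx
      induction hx using Submodule.iSup_induction' with
      | mem j x hx =>
        by_cases hj : j = i
        · simp only [hj, ne_eq, not_true_eq_false, iSup_false, Submodule.mem_bot] at hx
          rw [hx, Submodule.coe_zero, map_zero]
        · simp only [ne_eq, hj, not_false_eq_true, iSup_true] at hx
          exact comp_of_mem_ne (d := j - s) hx (by omega)
      | zero => rw [Submodule.coe_zero, map_zero]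
      | add x z _ _ hx hz => rw [Submodule.coe_add, map_add, hx, hz, add_zero]
    have h2 := this x hx'
    rw [comp_of_mem hx] at h2
    exact Subtype.ext h2
  · rw [eq_top_iff]
    rintro x -
    obtain ⟨T, hT⟩ := sum_comp (x : Alg K ℓ n)
    -- As the idempotent is homogeneous of degree 0, the right ideal contains the components of its
    -- elements.
    have hmem : ∀ d, comp d (x : Alg K ℓ n) ∈ rightIdeal K ℓ n := by
      intro d
      change f11 K ℓ n * _ = _
      rw [← mul_comp_of_mem _ _ _ f11_mem_grade, zero_add, f11_mul_coe]
    have hx : x = ∑ d ∈ T, (⟨comp d (x : Alg K ℓ n), hmem d⟩ : rightIdeal K ℓ n) := by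
      apply Subtype.ext
      rw [AddSubmonoidClass.coe_finsetSum]
      exact (hT T subset_rfl).symm
    rw [hx]
    refine Submodule.sum_mem _ fun d _ => Submodule.mem_iSup_of_mem (d + s) ?_
    change comp d (x : Alg K ℓ n) ∈ grade K ℓ n (d + s - s)
    rw [add_sub_cancel_right]
    exact comp_mem _ _

theorem projective_rightIdeal : Module.Projective (Alg K ℓ n)ᵐᵒᵖ (rightIdeal K ℓ n) := by
  let i : rightIdeal K ℓ n →ₗ[(Alg K ℓ n)ᵐᵒᵖ] (Alg K ℓ n)ᵐᵒᵖ :=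
    { toFun := fun x => op (x : Alg K ℓ n)
      map_add' := fun x z => rfl
      map_smul' := fun a x => rfl }
  let s : (Alg K ℓ n)ᵐᵒᵖ →ₗ[(Alg K ℓ n)ᵐᵒᵖ] rightIdeal K ℓ n :=
    LinearMap.toSpanSingleton _ _ (coverGen K ℓ n)
  refine Module.Projective.of_split i s ?_
  apply LinearMap.ext
  intro x
  apply Subtype.ext
  exact f11_mul_coe x

theorem isGradedProjectiveCover_coverMap :
    IsGradedProjectiveCover K (lamMin hn) (coverGrade hn K) (coverMap hn K) where
  isInternal := isInternal_coverGrade hn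
  smul_mem i j x h hx hh := by
    change (x : Alg K ℓ n) * h ∈ grade K ℓ n _
    rw [add_sub_right_comm]
    exact mul_mem_grade hx hh
  projective := projective_rightIdeal
  map_mem d x hx := Submodule.subset_span ⟨x, hx, rfl⟩
  surjective d := by
    obtain ⟨h, rfl⟩ := exists_eq_smul_smul_dGen hn d
    exact ⟨op h • coverGen K ℓ n, by rw [map_smul]; rfl⟩
  superfluous N _ hN := by
    have h1 : coverGen K ℓ n ∈ N ⊔ LinearMap.ker (coverMap hn K) := by rw [hN]; trivial
    obtain ⟨ν, hν, κ, hκ, e⟩ := Submodule.mem_sup.1 h1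
    -- The element ν of N has the same image in D₀ as the idempotent e. So νe is congruent to e in
    -- the local corner, hence divides e, which puts e itself into N.
    have h2 : op ((ν : Alg K ℓ n) * f11 K ℓ n) • dGen K (lamMin hn) =
        op (f11 K ℓ n) • dGen K (lamMin hn) := by
      have h3 : coverMap hn K ν = coverMap hn K (coverGen K ℓ n) := by
        rw [← e, map_add, LinearMap.mem_ker.1 hκ, add_zero]
      rw [op_mul, mul_smul, ← coverMap_apply, h3, coverMap_apply, smul_smul, ← op_mul]
      exact congrArg (fun x => op x • dGen K (lamMin hn)) f11_mul_self
    have h4 : (ν : Alg K ℓ n) * f11 K ℓ n ∈ corner K ℓ n :=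
      mem_corner.2 ⟨by rw [← mul_assoc, f11_mul_coe], by rw [mul_assoc, f11_mul_self]⟩
    obtain ⟨z, hz, -⟩ := exists_unit_of_sub_mem hn h4 (sub_f11_mem_higher hn h4 h2)
    have h5 : coverGen K ℓ n ∈ N := by
      have : coverGen K ℓ n = op (f11 K ℓ n * z) • ν := by
        apply Subtype.ext
        rw [Submodule.coe_smul, op_smul_eq_mul, ← mul_assoc, hz]; rfl
      rw [this]
      exact N.smul_mem _ hν
    rw [eq_top_iff]
    rintro x -
    have : x = op (x : Alg K ℓ n) • coverGen K ℓ n := by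
      apply Subtype.ext
      exact (f11_mul_coe x).symm
    rw [this]
    exact N.smul_mem _ h5

end Cover

/-! ### Endomorphisms of a projective cover -/

section Endomorphisms

variable {K : Type u} [Field K] {ℓ n : ℕ} {hn : n ≤ ℓ} {P : Type v} [AddCommGroup P] [Module K P]
  [Module (Alg K ℓ n)ᵐᵒᵖ P]

theorem comp_mem_center (d : ℤ) {z : Alg K ℓ n} (hz : z ∈ Subalgebra.center K (Alg K ℓ n)) :
    comp d z ∈ Subalgebra.center K (Alg K ℓ n) := by
  rw [Subalgebra.mem_center_iff] at *
  intro h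
  induction h using homogeneous_induction with
  | hom j x hx =>
    rw [← mul_comp_of_mem _ _ _ hx, ← comp_mul_of_mem _ _ _ hx, hz, add_comm]
  | add a b ha hb => rw [add_mul, mul_add, ha, hb]

/-- The action of the center on a right module. -/
def centerAction (P : Type v) [AddCommGroup P] [Module K P] [Module (Alg K ℓ n)ᵐᵒᵖ P]
    [IsScalarTower K (Alg K ℓ n)ᵐᵒᵖ P] :
    Subalgebra.center K (Alg K ℓ n) →ₐ[K] Module.End (Alg K ℓ n)ᵐᵒᵖ P where
  toFun z :=
    { toFun := fun x => op (z : Alg K ℓ n) • x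
      map_add' := fun x w => smul_add _ x w
      map_smul' := fun a x => by
        rw [RingHom.id_apply, smul_smul, smul_smul, ← op_unop a, ← op_mul, ← op_mul,
          Subalgebra.mem_center_iff.1 z.2] }
  map_one' := LinearMap.ext fun x => one_smul _ x
  map_mul' z w := LinearMap.ext fun x => by
    change op ((z : Alg K ℓ n) * w) • x = op (z : Alg K ℓ n) • op (w : Alg K ℓ n) • x
    rw [smul_smul, ← op_mul, Subalgebra.mem_center_iff.1 z.2]
  map_zero' := LinearMap.ext fun x => zero_smul _ x
  map_add' z w := LinearMap.ext fun x => add_smul (op (z : Alg K ℓ n)) (op (w : Alg K ℓ n)) x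
  commutes' c := LinearMap.ext fun x => by
    change op (algebraMap K (Alg K ℓ n) c) • x = c • x
    rw [← MulOpposite.algebraMap_apply, algebraMap_smul]

theorem centerAction_apply [IsScalarTower K (Alg K ℓ n)ᵐᵒᵖ P]
    (z : Subalgebra.center K (Alg K ℓ n)) (x : P) :
    centerAction P z x = op (z : Alg K ℓ n) • x := rfl

namespace IsGradedProjectiveCover

variable {gr : ℤ → Submodule K P} {π : P →ₗ[(Alg K ℓ n)ᵐᵒᵖ] D0 K hn}

/-- A graded projective cover is generated by a homogeneous element that corresponds to
`𝔣_{1,1}`. -/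
theorem exists_generator (h : IsGradedProjectiveCover K (lamMin hn) gr π) :
    ∃ (i : ℤ) (p : P), p ∈ gr i ∧ op (f11 K ℓ n) • p = p ∧ (∀ q, ∃ k : Alg K ℓ n, q = op k • p) ∧
      ∀ k : Alg K ℓ n, op k • p = 0 → f11 K ℓ n * k = 0 := by
  obtain ⟨p', hp'⟩ := h.surjective (op (f11 K ℓ n) • dGen K (lamMin hn))
  -- The cover is spanned by homogeneous elements and D₀ e ≠ 0, so some homogeneous q has an image
  -- that e does not kill. Since D₀ e is a line, a multiple of qe then lifts the chosen generator.
  obtain ⟨i, q, hq, hne⟩ : ∃ i, ∃ q ∈ gr i, op (f11 K ℓ n) • π q ≠ 0 := by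
    by_contra! hall
    have h0 : ∀ p : P, op (f11 K ℓ n) • π p = 0 := by
      intro p
      have : p ∈ ⨆ i, gr i := by rw [h.isInternal.submodule_iSup_eq_top]; trivial
      induction this using Submodule.iSup_induction' with
      | mem i x hx => exact hall i x hx
      | zero => rw [map_zero, smul_zero]
      | add a b _ _ ha hb => rw [map_add, smul_add, ha, hb, add_zero]
    apply smul_f11_dGen_ne_zero (K := K) hn one_ne_zero
    rw [one_smul, ← h0 p', hp', smul_smul, ← op_mul, f11_mul_self]
  obtain ⟨t, ht⟩ := exists_smul_f11 hn (π q)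
  have ht0 : t ≠ 0 := by
    rintro rfl
    rw [zero_smul, op_zero, zero_smul] at ht
    exact hne ht
  set p := op (t⁻¹ • f11 K ℓ n) • q with hp
  have hpi : p ∈ gr i := by
    have := h.smul_mem i 0 q (t⁻¹ • f11 K ℓ n) hq (Submodule.smul_mem _ _ f11_mem_grade)
    rwa [add_zero] at this
  have hpe : op (f11 K ℓ n) • p = p := by
    rw [hp, smul_smul, ← op_mul, smul_mul_assoc, f11_mul_self]
  have hπ : π p = op (f11 K ℓ n) • dGen K (lamMin hn) := by
    have e1 : t⁻¹ • f11 K ℓ n = f11 K ℓ n * (t⁻¹ • 1) := by rw [mul_smul_comm, mul_one]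
    rw [hp, map_smul, e1, op_mul, mul_smul, ht, smul_smul, ← op_mul, smul_mul_smul_comm, mul_one,
      mul_inv_cancel₀ ht0, one_smul]
  have hgen : ∀ q, ∃ k : Alg K ℓ n, q = op k • p := by
    -- The submodule generated by the homogeneous p is graded and maps onto D₀, so it is everything
    -- because the kernel is superfluous.
    have htop : Submodule.span (Alg K ℓ n)ᵐᵒᵖ {p} = ⊤ := by
      apply h.superfluous
      · apply le_antisymm
        · rw [Submodule.span_le]
          exact fun x hx => hx.1
        · rw [Submodule.span_le, Set.singleton_subset_iff]
          exact Submodule.subset_span ⟨Submodule.mem_span_singleton_self p, i, hpi⟩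
      · rw [eq_top_iff]
        rintro q -
        obtain ⟨k, hk⟩ := exists_eq_smul_smul_dGen hn (π q)
        refine Submodule.mem_sup.2 ⟨op k • p, Submodule.smul_mem _ _
          (Submodule.mem_span_singleton_self p), q - op k • p, ?_, by abel⟩
        rw [LinearMap.mem_ker, map_sub, map_smul, hπ, hk, sub_self]
    intro q
    have : q ∈ Submodule.span (Alg K ℓ n)ᵐᵒᵖ {p} := by rw [htop]; trivial
    obtain ⟨a, rfl⟩ := Submodule.mem_span_singleton.1 this
    exact ⟨unop a, by rw [op_unop]⟩
  refine ⟨i, p, hpi, hpe, hgen, fun k hk => ?_⟩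
  have := h.projective
  -- A splitting s of the surjection H → P, k ↦ pk, gives w = s(p) with pw = p and we = w. Then ew
  -- lies in the corner and acts on the generator of D₀ as e does, so some z has zew = e. If pk = 0
  -- then wk = s(pk) = 0, whence ek = 0.
  obtain ⟨s, hs⟩ := Module.projective_lifting_property
    (LinearMap.toSpanSingleton (Alg K ℓ n)ᵐᵒᵖ P p) LinearMap.id (fun q => by
      obtain ⟨k, rfl⟩ := hgen q
      exact ⟨op k, rfl⟩)
  have hs' : s p • p = p := LinearMap.congr_fun hs p
  set w := unop (s p) with hw
  have hwe : w * f11 K ℓ n = w := by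
    have := congrArg (fun x => unop (s x)) hpe
    simpa [hw] using this
  have hwp : op w • p = p := hs'
  have hc : f11 K ℓ n * w ∈ corner K ℓ n :=
    mem_corner.2 ⟨by rw [← mul_assoc, f11_mul_self], by rw [mul_assoc, hwe]⟩
  have hd : op (f11 K ℓ n * w) • dGen K (lamMin hn) = op (f11 K ℓ n) • dGen K (lamMin hn) := by
    rw [op_mul, mul_smul, ← hπ, ← map_smul, hwp]
  obtain ⟨z, -, hz⟩ := exists_unit_of_sub_mem hn hc (sub_f11_mem_higher hn hc hd)
  have hwk : w * k = 0 := by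
    have := congrArg (fun x => unop (s x)) hk
    simpa [hw] using this
  rw [← hz, mul_assoc, mul_assoc, hwk, mul_zero, mul_zero]

/-- An endomorphism φ is determined by φ(p) = pk, and p = pe gives φ(p) = p(eke); since eke = ze for
a central z, φ is the action of z. A central z that kills p satisfies ez = 0, so z = 0 because e is
full. -/
theorem centerAction_bijective [IsScalarTower K (Alg K ℓ n)ᵐᵒᵖ P]
    (h : IsGradedProjectiveCover K (lamMin hn) gr π) :
    Function.Bijective (centerAction (K := K) (ℓ := ℓ) (n := n) P) := by
  obtain ⟨i, p, -, hpe, hgen, hinj⟩ := h.exists_generator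
  constructor
  · rw [injective_iff_map_eq_zero]
    intro z hz
    apply Subtype.ext
    apply eq_zero_of_central_mul_f11 z.2
    rw [← Subalgebra.mem_center_iff.1 z.2]
    exact hinj _ (LinearMap.congr_fun hz p)
  · intro φ
    obtain ⟨k, hk⟩ := hgen (φ p)
    obtain ⟨z, hz, e⟩ := exists_central_mul_f11
      (show f11 K ℓ n * k * f11 K ℓ n ∈ corner K ℓ n from ⟨k, by simp [mul_assoc]⟩)
    have hzp : op z • p = φ p := by
      calc op z • p = op z • op (f11 K ℓ n) • p := by rw [hpe]
        _ = op (f11 K ℓ n) • op k • op (f11 K ℓ n) • p := by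
          rw [smul_smul, ← op_mul, Subalgebra.mem_center_iff.1 hz, e, op_mul, op_mul, mul_smul,
            mul_smul]
        _ = φ p := by rw [hpe, ← hk, ← map_smul, hpe]
    refine ⟨⟨z, hz⟩, LinearMap.ext fun q => ?_⟩
    obtain ⟨m, rfl⟩ := hgen q
    rw [map_smul, map_smul, centerAction_apply, hzp]

theorem mem_grade_iff [IsScalarTower K (Alg K ℓ n)ᵐᵒᵖ P]
    (h : IsGradedProjectiveCover K (lamMin hn) gr π) (d : ℤ)
    (z : Subalgebra.center K (Alg K ℓ n)) :
    (z : Alg K ℓ n) ∈ grade K ℓ n d ↔ IsHomogeneousEnd gr d (centerAction P z) := by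
  constructor
  · intro hz i x hx
    exact h.smul_mem i d x z hx hz
  · intro hz
    obtain ⟨i, p, hp, -, -, hinj⟩ := h.exists_generator
    have h1 : op ((z : Alg K ℓ n) - comp d (z : Alg K ℓ n)) • p ∈ gr (i + d) := by
      rw [op_sub, sub_smul]
      exact Submodule.sub_mem _ (hz i p hp) (h.smul_mem i d p _ hp (comp_mem _ _))
    -- The other components of z move p into degrees different from i + d. The difference of z and
    -- its degree d part therefore kills p, and being central it is zero.
    have h2 : op ((z : Alg K ℓ n) - comp d (z : Alg K ℓ n)) • p ∈
        ⨆ j, ⨆ (_ : j ≠ i + d), gr j := by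
      obtain ⟨T, hT⟩ := sum_comp (z : Alg K ℓ n)
      have hsum := hT (insert d T) (Finset.subset_insert d T)
      rw [← Finset.add_sum_erase _ _ (Finset.mem_insert_self d T)] at hsum
      have e := sub_eq_iff_eq_add'.2 hsum.symm
      rw [e]
      change MulOpposite.opAddEquiv (∑ j ∈ (insert d T).erase d, comp j (z : Alg K ℓ n)) • p ∈ _
      rw [map_sum, Finset.sum_smul]
      refine Submodule.sum_mem _ fun j hj => ?_
      refine Submodule.mem_iSup_of_mem (i + j) (Submodule.mem_iSup_of_mem ?_
        (h.smul_mem i j p _ hp (comp_mem _ _)))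
      have := Finset.ne_of_mem_erase hj
      omega
    have h3 := Submodule.disjoint_def.1 (h.isInternal.submodule_iSupIndep (i + d)) _ h1 h2
    have h4 := hinj _ h3
    have hc : (z : Alg K ℓ n) - comp d (z : Alg K ℓ n) ∈ Subalgebra.center K (Alg K ℓ n) :=
      Subalgebra.sub_mem _ z.2 (comp_mem_center d z.2)
    rw [Subalgebra.mem_center_iff.1 hc] at h4
    have h5 := eq_zero_of_central_mul_f11 hc h4
    rw [sub_eq_zero] at h5
    rw [h5]
    exact comp_mem _ _

end IsGradedProjectiveCover

end Endomorphisms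

end NilHecke

end

theorem mainTheorem4 (K : Type u) [Field K] (ℓ n : ℕ) (hn : n ≤ ℓ) :
    -- the elements `b_μ` form a basis of `𝔣_{1,1} H 𝔣_{1,1}`
    (∃ B : Module.Basis (NilHecke.MPart ℓ n) K (NilHecke.corner K ℓ n),
      ∀ mu, (B mu : NilHecke.Alg K ℓ n) = NilHecke.bElt K mu) ∧
    -- `D₀` has a graded projective cover
    (∃ (P : Type u) (_ : AddCommGroup P) (_ : Module K P)
      (_ : Module (NilHecke.Alg K ℓ n)ᵐᵒᵖ P) (_ : IsScalarTower K (NilHecke.Alg K ℓ n)ᵐᵒᵖ P)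
      (gr : ℤ → Submodule K P) (π : P →ₗ[(NilHecke.Alg K ℓ n)ᵐᵒᵖ] NilHecke.D0 K hn),
      NilHecke.IsGradedProjectiveCover K (NilHecke.lamMin hn) gr π) ∧
    -- for every graded projective cover `P₀` of `D₀`, the algebra `End(P₀)` is commutative and
    -- isomorphic, as a graded algebra, to the center
    (∀ (P : Type v) [AddCommGroup P] [Module K P] [Module (NilHecke.Alg K ℓ n)ᵐᵒᵖ P]
      [IsScalarTower K (NilHecke.Alg K ℓ n)ᵐᵒᵖ P]
      (gr : ℤ → Submodule K P) (π : P →ₗ[(NilHecke.Alg K ℓ n)ᵐᵒᵖ] NilHecke.D0 K hn),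
      NilHecke.IsGradedProjectiveCover K (NilHecke.lamMin hn) gr π →
        (∀ φ χ : Module.End (NilHecke.Alg K ℓ n)ᵐᵒᵖ P, φ * χ = χ * φ) ∧
        ∃ e : Subalgebra.center K (NilHecke.Alg K ℓ n) ≃ₐ[K]
            Module.End (NilHecke.Alg K ℓ n)ᵐᵒᵖ P,
          ∀ (d : ℤ) (z : Subalgebra.center K (NilHecke.Alg K ℓ n)),
            (z : NilHecke.Alg K ℓ n) ∈ NilHecke.grade K ℓ n d ↔
              NilHecke.IsHomogeneousEnd gr d (e z)) ∧
    -- the dimension of the center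
    Module.Finite K (Subalgebra.center K (NilHecke.Alg K ℓ n)) ∧
    Module.finrank K (Subalgebra.center K (NilHecke.Alg K ℓ n)) = ℓ.choose n := by
  refine ⟨⟨NilHecke.cornerBasis K ℓ n, NilHecke.cornerBasis_apply⟩,
    ⟨NilHecke.rightIdeal K ℓ n, inferInstance, inferInstance, inferInstance, inferInstance,
      NilHecke.coverGrade hn K, NilHecke.coverMap hn K,
      NilHecke.isGradedProjectiveCover_coverMap hn⟩, ?_,
    NilHecke.finite_center, NilHecke.finrank_center⟩
  intro P _ _ _ _ gr π h
  have hb := h.centerAction_bijective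
  refine ⟨fun φ χ => ?_, AlgEquiv.ofBijective _ hb, fun d z => h.mem_grade_iff d z⟩
  obtain ⟨z, rfl⟩ := hb.2 φ
  obtain ⟨w, rfl⟩ := hb.2 χ
  rw [← map_mul, ← map_mul, mul_comm]
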